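/- Let $\theta=z\,\partial_z$ and consider the Picard–Fuchs operator of the (mirror) quintic family, $$\mathcal D=\theta^4-z\,(\theta+\tfrac15)(\theta+\tfrac25)(\theta+\tfrac35)(\theta+\tfrac45).$$ For $n\ge 0$ put $c_n(\varepsilon)=\prod_{m=0}^{n-1}\frac{\prod_{k=1}^4(\varepsilon+m+k/5)}{(\varepsilon+m+1)^4}$, and let $I_0=\sum_n c_n(0)z^n$ and $I_1=I_0\log z+\sum_n c_n'(0)z^n$ be the first two Frobenius solutions of $\mathcal D I=0$ at $z=0$. Let $T=I_1/I_0$ and $'=\partial_z$. The Yamaguchi–Yau ring is the subring $$\mathcal F_{YY}=\mathbb C(z)\Big[\frac{I_0'}{I_0},\frac{I_0''}{I_0},\frac{I_0'''}{I_0},\frac{T''}{T'}\Big]\subset\mathbb C((z)).$$ Let $w=2\cos(\pi/10)$ and let $\Gamma=\Gamma_{\infty,\infty,5}<\mathrm{PSL}_2(\mathbb R)$ be the triangle group generated by $\sigma_0=\begin{pmatrix}1&w\\0&1\end{pmatrix}$ and $\sigma_1=\begin{pmatrix}1&0\\-w&1\end{pmatrix}$, so that $\sigma_1\sigma_0$ is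 elliptic of order $5$. A meromorphic automorphy factor of rank $r$ for $\Gamma$ is a family $(e_\gamma)_{\gamma\in\Gamma}$ of invertible $r\times r$ matrices of meromorphic functions on the upper half-plane $\mathcal H$ with $e_{\gamma_2}(\gamma_1\tau)e_{\gamma_1}(\tau)=e_{\gamma_2\gamma_1}(\tau)$; an automorphic form with factor $e$ is a vector $\phi$ of $r$ meromorphic functions on $\mathcal H$ with $\phi(\gamma\tau)=e_\gamma(\tau)\phi(\tau)$ for all $\gamma\in\Gamma$. It is called flat if $e_\gamma(\tau)=\rho(\gamma)$ for a representation $\rho:\Gamma\to\mathrm{GL}_r(\mathbb C)$. Then: 1. $\mathcal F_{YY}$ is closed under $\partial_z$, so $(\mathcal F_{YY},\partial_z)$ is a differential ring. 2. There is a $\Gamma$-invariant holomorphic function $b=1/z$ on $\mathcal H$ that induces a bijection $\Gamma\backslash\mathcal H\to\mathbb C\setminus\{1\}$, vanishes (so $z=\infty$) at the fixed point of $\sigma_1\sigma_0$, and tends to $\infty$ (so $z\to0$) at the cusp $i\infty$ and to $1$ at the cusp $0$. Each of the four generators $\frac{I_0'}{I_0},\frac{I_0''}{I_0},\frac{I_0'''}{I_0},\frac{T''}{T'}$,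 viewed via $z=1/b(\tau)$ as a function of $\tau$ near $i\infty$, continues to a meromorphic function on $\mathcal H$, and this function is a component of an automorphic form for $\Gamma$. Its automorphy factor can be taken to be $e_\gamma(\tau)=\frac{B(\tau)}{B(\gamma\tau)}\,\rho(\gamma)$, where $\rho:\Gamma\to\mathrm{GL}_r(\mathbb C)$ is a representation and $B\not\equiv0$ is a component of a flat automorphic form for $\Gamma$. -/

import Mathlib

open scoped RatFunc

noncomputable section

namespace YamaguchiYau

open Filter Topology Matrix UpperHalfPlane
open scoped MatrixGroups LaurentSeries PowerSeries

/-! ### The periods at `z = 0` and the Yamaguchi–Yau ring -/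

/-- The coefficients of the Frobenius series `∑ₙ cₙ(ε) z ^ (n + ε)` of the operator
`θ⁴ - z (θ + 1/5) (θ + 2/5) (θ + 3/5) (θ + 4/5)`, `θ = z d/dz`, that is
`c₀(ε) = 1` and `(ε + m + 1)⁴ cₘ₊₁(ε) = ∏ₖ (ε + m + k/5) cₘ(ε)`. -/
def frobeniusCoeff (n : ℕ) (ε : ℂ) : ℂ :=
  ∏ m ∈ Finset.range n,
    (∏ k ∈ Finset.Icc (1 : ℕ) 4, (ε + (m : ℂ) + (k : ℂ) / 5)) / (ε + (m : ℂ) + 1) ^ 4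

/-- The solution `I₀` that is holomorphic at `z = 0`, as a Laurent series in `z`. -/
def I₀ : ℂ⸨X⸩ :=
  ((PowerSeries.mk fun n => frobeniusCoeff n 0 : ℂ⟦X⟧) : ℂ⸨X⸩)

/-- The part without logarithm of the second solution `I₁ = I₀ log z + J₁`, which is the
`ε`-derivative at `ε = 0` of the Frobenius series. -/
def J₁ : ℂ⸨X⸩ :=
  ((PowerSeries.mk fun n => deriv (frobeniusCoeff n) 0 : ℂ⟦X⟧) : ℂ⸨X⸩)

/-- The derivation `∂_z` on Laurent series in `z`. -/
abbrev ddz (f : ℂ⸨X⸩) : ℂ⸨X⸩ := LaurentSeries.derivative ℂ f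

/-- The derivative `T'` of `T = I₁ / I₀ = log z + J₁ / I₀`. -/
def T' : ℂ⸨X⸩ := HahnSeries.single (-1) 1 + ddz (J₁ / I₀)

/-- The generators `I₀'/I₀, I₀''/I₀, I₀'''/I₀, T''/T'`, as Laurent series in `z`. -/
def generator : Fin 4 → ℂ⸨X⸩ :=
  ![ddz I₀ / I₀, ddz (ddz I₀) / I₀, ddz (ddz (ddz I₀)) / I₀, ddz T' / T']

/-- The Yamaguchi–Yau ring, generated over the field `ℂ(z)` of rational functions. -/
def FYY : Subalgebra (RatFunc ℂ) ℂ⸨X⸩ :=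
  Algebra.adjoin (RatFunc ℂ) (Set.range generator)

/-! ### The triangle group -/

/-- The action of `PSL(2, ℝ)` on the upper half-plane by Möbius transformations. -/
instance pslAction : MulAction (Matrix.ProjectiveSpecialLinearGroup (Fin 2) ℝ) ℍ :=
  MulAction.compHom ℍ
    (QuotientGroup.lift (Subgroup.center SL(2, ℝ)) (MulAction.toPermHom SL(2, ℝ) ℍ) (by
      intro g hg
      obtain ⟨r, hr, hg⟩ := Matrix.SpecialLinearGroup.mem_center_iff.mp hg
      have h00 : (g : Matrix (Fin 2) (Fin 2) ℝ) 0 0 = r := by rw [← hg]; simp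
      have h01 : (g : Matrix (Fin 2) (Fin 2) ℝ) 0 1 = 0 := by rw [← hg]; simp
      have h10 : (g : Matrix (Fin 2) (Fin 2) ℝ) 1 0 = 0 := by rw [← hg]; simp
      have h11 : (g : Matrix (Fin 2) (Fin 2) ℝ) 1 1 = r := by rw [← hg]; simp
      have hr0 : r ≠ 0 := by
        rintro rfl
        simp at hr
      ext τ
      simp [UpperHalfPlane.specialLinearGroup_apply, h00, h01, h10, h11, hr0]))

/-- The translation length `2 cos (π / 10)` of the two parabolic generators. -/
def width : ℝ := 2 * Real.cos (Real.pi / 10)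

/-- The parabolic generator `τ ↦ τ + width`, which fixes the cusp `i∞`. -/
def σ₀ : Matrix.ProjectiveSpecialLinearGroup (Fin 2) ℝ :=
  QuotientGroup.mk (⟨!![1, width; 0, 1], by simp⟩ : SL(2, ℝ))

/-- The parabolic generator `τ ↦ τ / (1 - width * τ)`, which fixes the cusp `0`. -/
def σ₁ : Matrix.ProjectiveSpecialLinearGroup (Fin 2) ℝ :=
  QuotientGroup.mk (⟨!![1, 0; -width, 1], by simp⟩ : SL(2, ℝ))

/-- The triangle group `Γ_{∞,∞,5}`, generated by `σ₀` and `σ₁`. The product `σ₁ σ₀` has trace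
`2 - width ^ 2 = - 2 cos (π / 5)`: it is elliptic of order `5`. -/
def Γ : Subgroup (Matrix.ProjectiveSpecialLinearGroup (Fin 2) ℝ) :=
  Subgroup.closure {σ₀, σ₁}

/-- The Hauptmodul `b = 1 / z`: a holomorphic function on the upper half-plane that identifies
`Γ \ ℍ` with `ℂ ∖ {1}`, takes the value `0` (that is, `z = ∞`) at the elliptic points of order `5`,
and tends to `∞` (`z = 0`) at the cusp `i∞` and to `1` (`z = 1`) at the cusp `0`.
These conditions determine `b`. -/
structure IsHauptmodul (b : ℍ → ℂ) : Prop where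
  holomorphic : DifferentiableOn ℂ (b ∘ UpperHalfPlane.ofComplex) {τ : ℂ | 0 < τ.im}
  eq_iff : ∀ τ τ' : ℍ, b τ = b τ' ↔ ∃ γ ∈ Γ, γ • τ = τ'
  range_eq : Set.range b = {1}ᶜ
  elliptic : ∀ τ : ℍ, (σ₁ * σ₀) • τ = τ → b τ = 0
  cusp_zero : Tendsto b atImInfty (Bornology.cobounded ℂ)
  cusp_one : Tendsto (fun τ : ℍ => b (ModularGroup.S • τ)) atImInfty (𝓝 1)

/-! ### Automorphic forms -/

/-- Meromorphic functions on the upper half-plane (values at poles are irrelevant, and identities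
between meromorphic functions are required to hold off a closed discrete set). -/
def IsMeromorphic (f : ℍ → ℂ) : Prop :=
  ∀ τ : ℍ, MeromorphicAt (f ∘ UpperHalfPlane.ofComplex) (τ : ℂ)

/-- Automorphy factors of rank `r` with meromorphic entries. -/
structure AutomorphyFactor (Λ : Subgroup (Matrix.ProjectiveSpecialLinearGroup (Fin 2) ℝ))
    (r : ℕ) where
  toFun : Λ → ℍ → Matrix (Fin r) (Fin r) ℂ
  meromorphic : ∀ γ i j, IsMeromorphic fun τ => toFun γ τ i j
  invertible : ∀ γ, ∀ᶠ τ in codiscrete ℍ, IsUnit (toFun γ τ)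
  cocycle : ∀ γ₁ γ₂, ∀ᶠ τ in codiscrete ℍ,
    toFun γ₂ (γ₁ • τ) * toFun γ₁ τ = toFun (γ₂ * γ₁) τ

/-- `φ : ℍ → ℂʳ` is a vector-valued automorphic form with automorphy factor `e`. -/
def IsAutomorphicForm {Λ : Subgroup (Matrix.ProjectiveSpecialLinearGroup (Fin 2) ℝ)} {r : ℕ}
    (e : AutomorphyFactor Λ r) (φ : ℍ → Fin r → ℂ) : Prop :=
  (∀ i, IsMeromorphic fun τ => φ τ i) ∧
    ∀ γ : Λ, ∀ᶠ τ in codiscrete ℍ, φ (γ • τ) = e.toFun γ τ *ᵥ φ τ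

/-- The constant automorphy factor given by a representation, which defines a flat bundle. -/
def AutomorphyFactor.ofRep {Λ : Subgroup (Matrix.ProjectiveSpecialLinearGroup (Fin 2) ℝ)} {r : ℕ}
    (ρ : Λ →* GL (Fin r) ℂ) : AutomorphyFactor Λ r where
  toFun γ _ := (ρ γ : Matrix (Fin r) (Fin r) ℂ)
  meromorphic γ i j τ := MeromorphicAt.const _ _
  invertible γ := Eventually.of_forall fun _ => (ρ γ).isUnit
  cocycle γ₁ γ₂ := Eventually.of_forall fun _ => by simp

/-- `B` is a component of an automorphic form with values in a flat bundle. -/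
def IsFlatComponent (Λ : Subgroup (Matrix.ProjectiveSpecialLinearGroup (Fin 2) ℝ))
    (B : ℍ → ℂ) : Prop :=
  ∃ (s : ℕ) (ρ : Λ →* GL (Fin s) ℂ) (χ : ℍ → Fin s → ℂ) (i : Fin s),
    IsAutomorphicForm (AutomorphyFactor.ofRep ρ) χ ∧ ∀ τ, χ τ i = B τ

/-- The automorphy factor is `e_γ(τ) = (B(τ) / B(γτ)) ρ(γ)` for a representation `ρ` and a
function `B ≢ 0` that is itself a component of an automorphic form with values in a flat bundle. -/
def AutomorphyFactor.IsTwistOfFlat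
    {Λ : Subgroup (Matrix.ProjectiveSpecialLinearGroup (Fin 2) ℝ)} {r : ℕ}
    (e : AutomorphyFactor Λ r) : Prop :=
  ∃ (ρ : Λ →* GL (Fin r) ℂ) (B : ℍ → ℂ), IsFlatComponent Λ B ∧
    (∀ᶠ τ in codiscrete ℍ, B τ ≠ 0) ∧
    ∀ γ : Λ, ∀ᶠ τ in codiscrete ℍ,
      e.toFun γ τ = (B τ / B (γ • τ)) • (ρ γ : Matrix (Fin r) (Fin r) ℂ)

/-- `G` is the meromorphic continuation to the upper half-plane of the Laurent series `g` in
`z = 1 / b`, starting from the cusp `i∞`, where `z = 0`. -/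
def IsContinuation (b : ℍ → ℂ) (g : ℂ⸨X⸩) (G : ℍ → ℂ) : Prop :=
  IsMeromorphic G ∧
    ∀ᶠ τ in atImInfty, HasSum (fun n : ℤ => g.coeff n * (b τ)⁻¹ ^ n) (G τ)

end YamaguchiYau

end

open scoped RatFunc
noncomputable section
namespace YamaguchiYau
open Filter Topology Matrix UpperHalfPlane
open scoped MatrixGroups LaurentSeries PowerSeries

/-! ### Analytic continuation -/

section Continuation

variable {F : Type*} [NormedAddCommGroup F] [NormedSpace ℂ F]

/-! Closure under `∂_z`. Differentiating the generators only produces two new quantities,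
`I₀''''/I₀` and `T'''/T'`. The first is eliminated by the Picard–Fuchs equation. For the second, put
`W = I₀ θI₁ - I₁ θI₀ = z I₀² T'`. The operator is self-dual, so it preserves a symplectic form on
its solutions. The form takes a constant value on the pair `(I₀, I₁)`, and this value is zero, as
one sees at `z = 0` (`symplectic_eq_zero`). Written in terms of `W`, this is a second order equation
whose coefficients involve only `z`, `I₀` and its first two `θ`-derivatives (`wronskPS_ode`).

The Hauptmodul. The hypergeometric equation of `F = F(2/5, 3/5; 1; z)` has exponent differences `0,
0, 1/5` at `0, 1, ∞`, so its Schwarz map `τ = i F(1 - z) / F(z)` should invert `z = 1/b`. It takes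
values in `ℍ` because `F(1 - z)` times the conjugate of `F(z)` has positive real part
(`re_hyp_mul_conj_pos`), which is visible on Euler integrals. Instead of gluing fundamental
polygons, the proof inverts the map by analytic continuation. Three charts describe it: the nome `q
= exp(2πiτ/w)` near `z = 0`, its mirror image under `z ↦ 1 - z`, and a branch of `τ` as a function
of `z ^ (-1/5)` near `∞`. By compactness of the relevant pieces and invariance of the hyperbolic
metric, every branch of `b` extends to a hyperbolic disc of a fixed radius (`exists_adm_extension`).
Continuation on the convex set `ℍ` then produces `b`. Its fibres are `Γ`-orbits because two branches
of `τ` over the same `z` differ by an element of `Γ` (`Link.unique`, completed by the elliptic chart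
over `z = ∞`).

Automorphy. On `ℍ` the function `b` has a holomorphic fifth root `h`. The exponents of the
Picard–Fuchs operator at `z = ∞` are `1/5, …, 4/5`, so in terms of `h` the equation becomes a linear
system without singularities on all of `ℍ`, the points `z = 0, 1` being cusps. Hence all its
solutions and their `θ`-derivatives are holomorphic on `ℍ`, and `Γ` acts on the solution space,
whose dimension is four (`IsPFSol.flat`). Functions whose translates span a finite-dimensional space
are closed under sums and products and are exactly what is needed for components of flat forms
(`Flat.exists_rep`). Each generator is a quotient of two of them, which gives the twisted factor
(`Flat.exists_automorphicForm`). For `T''/T'` the quotient is built from `W`, in which the logarithm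
cancels. -/

/-- One step of analytic continuation along a homothety: a family of germs that can be extended by a
uniform radius is continued from the set `c + r • (V - c)` to `c + r' • (V - c)`. -/
theorem exists_extension_homothety {P : (ℂ → F) → ℂ → Prop} {V : Set ℂ} {c : ℂ} {ε : ℝ}
    (hVo : IsOpen V) (hV : StarConvex ℝ c V) (hε : 0 < ε)
    (hcongr : ∀ β β' x, P β x → β' =ᶠ[𝓝 x] β → P β' x)
    (han : ∀ β x, P β x → AnalyticAt ℂ β x)
    (hloc : ∀ β, ∀ x ∈ V, P β x → ∃ β' : ℂ → F, β' =ᶠ[𝓝 x] β ∧ ∀ y ∈ Metric.ball x ε, P β' y)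
    {W : Set ℂ} {r : ℝ} (hr0 : 0 ≤ r) (hr1 : r ≤ 1) (hWV : W ⊆ V) (hcW : c ∈ W)
    (hW : ∀ y ∈ W, dist (c + (r : ℂ) * (y - c)) y < ε)
    {β b : ℂ → F} (hb : b =ᶠ[𝓝 c] β) (hP : ∀ y ∈ W, P b (c + (r : ℂ) * (y - c))) :
    ∃ b' : ℂ → F, b' =ᶠ[𝓝 c] β ∧ ∀ y ∈ W, P b' y := by
  classical
  have hπV : ∀ y ∈ W, c + (r : ℂ) * (y - c) ∈ V := by
    intro y hy
    have h := hV (hWV hy) (sub_nonneg.2 hr1) hr0 (by ring)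
    convert h using 1
    simp only [Complex.real_smul]
    push_cast
    ring
  choose! g hg using fun x (hx : x ∈ V ∧ P b x) => hloc b x hx.1 hx.2
  have hg1 : ∀ x, x ∈ V → P b x → g x =ᶠ[𝓝 x] b := fun x h1 h2 => (hg x ⟨h1, h2⟩).1
  have hg2 : ∀ x, x ∈ V → P b x → ∀ y ∈ Metric.ball x ε, P (g x) y :=
    fun x h1 h2 => (hg x ⟨h1, h2⟩).2
  have hπc : Continuous fun y : ℂ => c + (r : ℂ) * (y - c) := by fun_prop
  -- The germ chosen at the contracted point is evaluated at `y` itself. Germs chosen at two nearby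
  -- contracted points agree there, because the intersection of two discs is convex, hence
  -- connected.
  have key : ∀ y ∈ W, (fun y => g (c + (r : ℂ) * (y - c)) y) =ᶠ[𝓝 y]
      g (c + (r : ℂ) * (y - c)) := by
    intro y hy
    set x := c + (r : ℂ) * (y - c) with hx
    have hxV := hπV y hy
    have hxP := hP y hy
    have hgx := hg1 x hxV hxP
    have hopen : ∀ᶠ x' in 𝓝 x, P b x' := by
      filter_upwards [hgx.eventuallyEq_nhds, Metric.ball_mem_nhds x hε] with x' h1 h2
      exact hcongr _ _ _ (hg2 x hxV hxP x' h2) h1.symm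
    have hev : ∀ᶠ x' in 𝓝 x, x' ∈ V ∧ P b x' ∧ g x =ᶠ[𝓝 x'] b ∧ x' ∈ Metric.ball x ε := by
      filter_upwards [hVo.mem_nhds hxV, hopen, hgx.eventuallyEq_nhds,
        Metric.ball_mem_nhds x hε] with x' h1 h2 h3 h4 using ⟨h1, h2, h3, h4⟩
    have hd1 : ∀ᶠ y' in 𝓝 y, dist (c + (r : ℂ) * (y' - c)) y' < ε :=
      (hπc.dist continuous_id).continuousAt.eventually_lt continuousAt_const (hW y hy)
    have hd2 : ∀ᶠ y' in 𝓝 y, dist y' x < ε :=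
      (continuous_id.dist continuous_const).continuousAt.eventually_lt continuousAt_const
        (by rw [dist_comm]; exact hW y hy)
    filter_upwards [hπc.continuousAt.eventually hev, hd1, hd2] with y' h1 h2 h3
    obtain ⟨h1V, h1P, h1e, h1b⟩ := h1
    set x' := c + (r : ℂ) * (y' - c)
    have hpc : IsPreconnected (Metric.ball x ε ∩ Metric.ball x' ε) :=
      ((convex_ball x ε).inter (convex_ball x' ε)).isPreconnected
    refine AnalyticOnNhd.eqOn_of_preconnected_of_eventuallyEq (z₀ := x')
      (f := g x') (g := g x) (fun t ht => han _ _ (hg2 x' h1V h1P t ht.2))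
      (fun t ht => han _ _ (hg2 x hxV hxP t ht.1)) hpc ⟨h1b, Metric.mem_ball_self hε⟩
      ((hg1 x' h1V h1P).trans h1e.symm) ⟨?_, ?_⟩
    · exact h3
    · rw [Metric.mem_ball, dist_comm]; exact h2
  refine ⟨fun y => g (c + (r : ℂ) * (y - c)) y, ?_, fun y hy => ?_⟩
  · have h := key c hcW
    have h0 : c + (r : ℂ) * (c - c) = c := by ring
    have hPc := hP c hcW
    rw [h0] at h hPc
    exact h.trans ((hg1 c (hWV hcW) hPc).trans hb)
  · refine hcongr _ _ _ (hg2 _ (hπV y hy) (hP y hy) y ?_) (key y hy)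
    rw [Metric.mem_ball, dist_comm]; exact hW y hy

/-- A germ that can be extended by a uniform radius extends to a bounded star-shaped open set. -/
theorem exists_extension_of_starConvex {P : (ℂ → F) → ℂ → Prop} {V : Set ℂ} {c : ℂ} {ε R : ℝ}
    (hVo : IsOpen V) (hV : StarConvex ℝ c V) (hcV : c ∈ V) (hR : ∀ x ∈ V, dist x c ≤ R)
    (hε : 0 < ε)
    (hcongr : ∀ β β' x, P β x → β' =ᶠ[𝓝 x] β → P β' x)
    (han : ∀ β x, P β x → AnalyticAt ℂ β x)
    (hloc : ∀ β, ∀ x ∈ V, P β x → ∃ β' : ℂ → F, β' =ᶠ[𝓝 x] β ∧ ∀ y ∈ Metric.ball x ε, P β' y)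
    {β : ℂ → F} (hβ : P β c) :
    ∃ b : ℂ → F, b =ᶠ[𝓝 c] β ∧ ∀ x ∈ V, P b x := by
  -- Continuation proceeds along the homotheties of ratio `n / N`. One step moves a point by at most
  -- `R / N < ε`.
  obtain ⟨N, hN⟩ := exists_nat_gt (R / ε)
  have hR0 : 0 ≤ R := by simpa using hR c hcV
  have hN0 : (0 : ℝ) < N := lt_of_le_of_lt (by positivity) hN
  have hN0' : (N : ℂ) ≠ 0 := by exact_mod_cast hN0.ne'
  have hRN : R / N < ε := by
    rw [div_lt_iff₀ hε] at hN
    rw [div_lt_iff₀ hN0]; linarith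
  have main : ∀ n : ℕ, n ≤ N → ∃ b : ℂ → F, b =ᶠ[𝓝 c] β ∧
      ∀ v ∈ V, P b (c + ((n / N : ℝ) : ℂ) * (v - c)) := by
    intro n
    induction n with
    | zero => exact fun _ => ⟨β, EventuallyEq.rfl, fun v _ => by simpa using hβ⟩
    | succ n ih =>
      intro hn
      obtain ⟨b, hb, hP⟩ := ih (by omega)
      have hn1 : ((n : ℂ) + 1) ≠ 0 := by exact_mod_cast n.succ_ne_zero
      set W := (fun v => c + (((n + 1 : ℕ) / N : ℝ) : ℂ) * (v - c)) '' V with hW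
      have hWV : W ⊆ V := by
        rintro _ ⟨v, hv, rfl⟩
        have hle : ((n + 1 : ℕ) / N : ℝ) ≤ 1 := by
          rw [div_le_one hN0]; exact_mod_cast hn
        have h0 : (0 : ℝ) ≤ (n + 1 : ℕ) / N := by positivity
        have h := hV hv (sub_nonneg.2 hle) h0 (by ring)
        convert h using 1
        simp only [Complex.real_smul]
        push_cast
        ring
      have hWd : ∀ y ∈ W, dist (c + ((n / (n + 1) : ℝ) : ℂ) * (y - c)) y < ε := by
        rintro _ ⟨v, hv, rfl⟩
        rw [dist_eq_norm]
        have : c + ((n / (n + 1) : ℝ) : ℂ) * (c + (((n + 1 : ℕ) / N : ℝ) : ℂ) * (v - c) - c) -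
            (c + (((n + 1 : ℕ) / N : ℝ) : ℂ) * (v - c)) = - ((v - c) / N) := by
          push_cast
          field_simp
          ring
        rw [this, norm_neg, norm_div, Complex.norm_natCast, ← dist_eq_norm]
        exact lt_of_le_of_lt (by gcongr; exact hR v hv) hRN
      have hWP : ∀ y ∈ W, P b (c + ((n / (n + 1) : ℝ) : ℂ) * (y - c)) := by
        rintro _ ⟨v, hv, rfl⟩
        convert hP v hv using 1
        push_cast
        field_simp
        ring
      obtain ⟨b', hb', hP'⟩ := exists_extension_homothety hVo hV hε hcongr han hloc
        (by positivity) (by rw [div_le_one (by positivity)]; linarith) hWV ⟨c, hcV, by simp⟩ hWd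
        hb hWP
      exact ⟨b', hb', fun v hv => hP' _ ⟨v, hv, rfl⟩⟩
  obtain ⟨b, hb, hP⟩ := main N le_rfl
  refine ⟨b, hb, fun x hx => ?_⟩
  have := hP x hx
  rw [div_self hN0.ne'] at this
  simpa using this

/-- Analytic continuation on an open set that is exhausted by bounded convex open sets, for a class
of germs that can be extended by a locally uniform radius. -/
theorem exists_extension_of_exhaustion {P : (ℂ → F) → ℂ → Prop} {V K : ℕ → Set ℂ} {U : Set ℂ}
    {c : ℂ} (hVo : ∀ n, IsOpen (V n)) (hV : ∀ n, Convex ℝ (V n)) (hmono : Monotone V)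
    (hcV : ∀ n, c ∈ V n) (hVK : ∀ n, V n ⊆ K n) (hK : ∀ n, IsCompact (K n)) (hKU : ∀ n, K n ⊆ U)
    (hU : ∀ x ∈ U, ∃ n, x ∈ V n)
    (hcongr : ∀ β β' x, P β x → β' =ᶠ[𝓝 x] β → P β' x)
    (han : ∀ β x, P β x → AnalyticAt ℂ β x)
    (hloc : ∀ x₀ ∈ U, ∃ ε > 0, ∀ β, ∀ x ∈ Metric.ball x₀ ε, P β x →
      ∃ β' : ℂ → F, β' =ᶠ[𝓝 x] β ∧ ∀ y ∈ Metric.ball x ε, P β' y)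
    {β : ℂ → F} (hβ : P β c) :
    ∃ b : ℂ → F, b =ᶠ[𝓝 c] β ∧ ∀ x ∈ U, P b x := by
  classical
  have step : ∀ n, ∃ b : ℂ → F, b =ᶠ[𝓝 c] β ∧ ∀ x ∈ V n, P b x := by
    intro n
    obtain ⟨R, hR⟩ := (hK n).isBounded.subset_closedBall c
    -- Compactness of `K n` turns the locally uniform radius into a uniform one.
    obtain ⟨ε, hε, h⟩ : ∃ ε > 0, ∀ x ∈ K n, ∀ β, P β x →
        ∃ β' : ℂ → F, β' =ᶠ[𝓝 x] β ∧ ∀ y ∈ Metric.ball x ε, P β' y := by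
      refine (hK n).induction_on (p := fun s => ∃ ε > 0, ∀ x ∈ s, ∀ β, P β x →
        ∃ β' : ℂ → F, β' =ᶠ[𝓝 x] β ∧ ∀ y ∈ Metric.ball x ε, P β' y) ⟨1, one_pos, by simp⟩ ?_ ?_ ?_
      · rintro s t hst ⟨ε, hε, h⟩
        exact ⟨ε, hε, fun x hx => h x (hst hx)⟩
      · rintro s t ⟨ε, hε, h⟩ ⟨ε', hε', h'⟩
        refine ⟨min ε ε', lt_min hε hε', ?_⟩
        rintro x (hx | hx) β hβ
        · obtain ⟨β', h1, h2⟩ := h x hx β hβ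
          exact ⟨β', h1, fun y hy => h2 y (Metric.ball_subset_ball (min_le_left _ _) hy)⟩
        · obtain ⟨β', h1, h2⟩ := h' x hx β hβ
          exact ⟨β', h1, fun y hy => h2 y (Metric.ball_subset_ball (min_le_right _ _) hy)⟩
      · intro x hx
        obtain ⟨ε, hε, h⟩ := hloc x (hKU n hx)
        exact ⟨Metric.ball x ε, mem_nhdsWithin_of_mem_nhds (Metric.ball_mem_nhds x hε), ε, hε,
          fun y hy β hβ => h β y hy hβ⟩
    exact exists_extension_of_starConvex (hVo n) ((hV n).starConvex (hcV n)) (hcV n)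
      (fun x hx => hR (hVK n hx)) hε hcongr han (fun β x hx => h x (hVK n hx) β) hβ
  choose b hb hP using step
  have hagree : ∀ m n, m ≤ n → Set.EqOn (b m) (b n) (V m) := fun m n hmn =>
    AnalyticOnNhd.eqOn_of_preconnected_of_eventuallyEq (fun x hx => han _ _ (hP m x hx))
      (fun x hx => han _ _ (hP n x (hmono hmn hx))) (hV m).isPreconnected (hcV m)
      ((hb m).trans (hb n).symm)
  -- By `hagree` the choice of `n` is immaterial; taking the least one makes a single function of
  -- the extensions.
  set B : ℂ → F := fun x => if h : ∃ n, x ∈ V n then b (Nat.find h) x else 0 with hB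
  have hBb : ∀ n, ∀ x ∈ V n, B x = b n x := by
    intro n x hx
    have h : ∃ n, x ∈ V n := ⟨n, hx⟩
    simp only [hB, dif_pos h]
    exact hagree _ _ (Nat.find_min' h hx) (Nat.find_spec h)
  have hBev : ∀ n, ∀ x ∈ V n, B =ᶠ[𝓝 x] b n := fun n x hx => by
    filter_upwards [(hVo n).mem_nhds hx] with y hy using hBb n y hy
  refine ⟨B, (hBev 0 c (hcV 0)).trans (hb 0), fun x hx => ?_⟩
  obtain ⟨n, hn⟩ := hU x hx
  exact hcongr _ _ _ (hP n x hn) (hBev n x hn)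

/-- Analytic continuation on a disc. -/
theorem exists_extension_ball {P : (ℂ → F) → ℂ → Prop} {x₁ : ℂ} {R : ℝ}
    {c : ℂ} (hc : c ∈ Metric.ball x₁ R)
    (hcongr : ∀ β β' x, P β x → β' =ᶠ[𝓝 x] β → P β' x)
    (han : ∀ β x, P β x → AnalyticAt ℂ β x)
    (hloc : ∀ x₀ ∈ Metric.ball x₁ R, ∃ ε > 0, ∀ β, ∀ x ∈ Metric.ball x₀ ε, P β x →
      ∃ β' : ℂ → F, β' =ᶠ[𝓝 x] β ∧ ∀ y ∈ Metric.ball x ε, P β' y)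
    {β : ℂ → F} (hβ : P β c) :
    ∃ b : ℂ → F, b =ᶠ[𝓝 c] β ∧ ∀ x ∈ Metric.ball x₁ R, P b x := by
  have hc' : 0 < R - dist c x₁ := sub_pos.2 hc
  -- Concentric discs with radii increasing to `R`. The denominator `n + 2`, rather than `n + 1`,
  -- keeps `c` strictly inside already for `n = 0`.
  refine exists_extension_of_exhaustion
    (V := fun n => Metric.ball x₁ (R - (R - dist c x₁) / (n + 2)))
    (K := fun n => Metric.closedBall x₁ (R - (R - dist c x₁) / (n + 2)))
    (fun n => Metric.isOpen_ball) (fun n => convex_ball _ _) ?_ ?_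
    (fun n => Metric.ball_subset_closedBall) (fun n => isCompact_closedBall _ _) ?_ ?_
    hcongr han hloc hβ
  · intro m n hmn
    apply Metric.ball_subset_ball
    gcongr
  · intro n
    rw [Metric.mem_ball]
    have : (R - dist c x₁) / (n + 2) < R - dist c x₁ := div_lt_self hc' (by
      have : (0 : ℝ) ≤ n := n.cast_nonneg
      linarith)
    linarith
  · intro n
    apply Metric.closedBall_subset_ball
    have : 0 < (R - dist c x₁) / (n + 2) := by positivity
    linarith
  · intro x hx
    have hx' : 0 < R - dist x x₁ := sub_pos.2 hx
    obtain ⟨n, hn⟩ := exists_nat_gt ((R - dist c x₁) / (R - dist x x₁))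
    refine ⟨n, ?_⟩
    rw [Metric.mem_ball]
    rw [div_lt_iff₀ hx'] at hn
    have : (R - dist c x₁) / (n + 2) < R - dist x x₁ := by
      rw [div_lt_iff₀ (by positivity)]
      nlinarith
    linarith

/-- Analytic continuation on the upper half-plane. -/
theorem exists_extension_upperHalfPlane {P : (ℂ → F) → ℂ → Prop}
    {c : ℂ} (hc : 0 < c.im)
    (hcongr : ∀ β β' x, P β x → β' =ᶠ[𝓝 x] β → P β' x)
    (han : ∀ β x, P β x → AnalyticAt ℂ β x)
    (hloc : ∀ x₀ : ℂ, 0 < x₀.im → ∃ ε > 0, ∀ β, ∀ x ∈ Metric.ball x₀ ε, P β x →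
      ∃ β' : ℂ → F, β' =ᶠ[𝓝 x] β ∧ ∀ y ∈ Metric.ball x ε, P β' y)
    {β : ℂ → F} (hβ : P β c) :
    ∃ b : ℂ → F, b =ᶠ[𝓝 c] β ∧ ∀ x : ℂ, 0 < x.im → P b x := by
  refine exists_extension_of_exhaustion (U := {x : ℂ | 0 < x.im})
    (V := fun n => Set.Ioo (-((n : ℝ) + 1 + ‖c‖)) (n + 1 + ‖c‖) ×ℂ
      Set.Ioo (c.im / (n + 2)) (n + 1 + ‖c‖))
    (K := fun n => Set.Icc (-((n : ℝ) + 1 + ‖c‖)) (n + 1 + ‖c‖) ×ℂ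
      Set.Icc (c.im / (n + 2)) (n + 1 + ‖c‖))
    (fun n => isOpen_Ioo.reProdIm isOpen_Ioo)
    (fun n => ((convex_Ioo _ _).linear_preimage Complex.reLm).inter
      ((convex_Ioo _ _).linear_preimage Complex.imLm)) ?_ ?_
    (fun n => ?_) (fun n => isCompact_Icc.reProdIm isCompact_Icc) ?_ ?_
    hcongr han hloc hβ
  · intro m n hmn
    have hmn' : (m : ℝ) ≤ n := by exact_mod_cast hmn
    rintro x ⟨⟨h1, h2⟩, h3, h4⟩
    have : c.im / (n + 2) ≤ c.im / (m + 2) := by gcongr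
    exact ⟨⟨by linarith, by linarith⟩, by linarith, by linarith⟩
  · intro n
    have h0 : (0 : ℝ) ≤ n := n.cast_nonneg
    have h1 := abs_le.1 (Complex.abs_re_le_norm c)
    have h2 := abs_le.1 (Complex.abs_im_le_norm c)
    exact ⟨⟨by linarith, by linarith⟩, div_lt_self hc (by linarith), by linarith⟩
  · rintro x ⟨⟨h1, h2⟩, h3, h4⟩
    exact ⟨⟨h1.le, h2.le⟩, h3.le, h4.le⟩
  · rintro n x ⟨_, h3, _⟩
    have : 0 < c.im / (n + 2) := by positivity
    exact this.trans_le h3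
  · intro x hx
    have hx : 0 < x.im := hx
    obtain ⟨n, hn⟩ := exists_nat_gt (c.im / x.im + ‖x‖)
    have h1 := abs_le.1 (Complex.abs_re_le_norm x)
    have h2 := abs_le.1 (Complex.abs_im_le_norm x)
    have h3 : 0 < c.im / x.im := by positivity
    have h4 := norm_nonneg x
    have h5 := norm_nonneg c
    refine ⟨n, ⟨by linarith, by linarith⟩, ?_, by linarith⟩
    have hn' : c.im / x.im < n := by linarith
    rw [div_lt_iff₀ hx] at hn'
    show c.im / (n + 2) < x.im
    rw [div_lt_iff₀ (by positivity)]
    nlinarith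

end Continuation

/-! ### Linear differential equations with holomorphic coefficients -/

section LinearODE

section Coefficients

variable {𝔸 : Type*} [NormedRing 𝔸] [NormedAlgebra ℂ 𝔸]

/-- Taylor coefficients of the solution of `Y' = A Y`, `Y(0) = 1`, where `A = ∑ xⁿ aₙ`. -/
def odeCoeff (a : ℕ → 𝔸) : ℕ → 𝔸
  | 0 => 1
  | n + 1 => ((n : ℂ) + 1)⁻¹ • ∑ j : Fin (n + 1), a (n - j) * odeCoeff a j

theorem odeCoeff_succ (a : ℕ → 𝔸) (n : ℕ) :
    ((n : ℂ) + 1) • odeCoeff a (n + 1) =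
      ∑ kl ∈ Finset.HasAntidiagonal.antidiagonal n, a kl.1 * odeCoeff a kl.2 := by
  have h : ((n : ℂ) + 1) ≠ 0 := by exact_mod_cast n.succ_ne_zero
  rw [odeCoeff, smul_inv_smul₀ h, Finset.Nat.sum_antidiagonal_eq_sum_range_succ_mk,
    ← Finset.sum_range_reflect, Finset.sum_range]
  refine Finset.sum_congr rfl fun j _ => ?_
  have hj : n + 1 - 1 - (j : ℕ) = n - j := by omega
  have hj' : n - (n - (j : ℕ)) = j := by omega
  simp only [hj, hj']

/-- If `‖yⱼ‖ ρʲ ≤ C` for `j ≤ m`, the recursion and a geometric series in `θ = ρ / r` give `(m + 1)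
‖yₘ₊₁‖ ρᵐ⁺¹ ≤ (ρ M / (1 - θ)) C`. Once `m` exceeds `ρ M / (1 - θ)` the factor `m + 1` absorbs the
constant, so a `C` that dominates the finitely many earlier terms works for all. -/
theorem exists_norm_odeCoeff_le {a : ℕ → 𝔸} {M r ρ : ℝ} (hρ : 0 < ρ) (hρr : ρ < r)
    (ha : ∀ n, ‖a n‖ * r ^ n ≤ M) : ∃ C, ∀ n, ‖odeCoeff a n‖ * ρ ^ n ≤ C := by
  have hr : 0 < r := hρ.trans hρr
  have hM : 0 ≤ M := le_trans (by positivity) (ha 0)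
  set θ := ρ / r with hθ
  have hθ0 : 0 < θ := by positivity
  have hθ1 : θ < 1 := (div_lt_one hr).2 hρr
  obtain ⟨N, hN⟩ := exists_nat_ge (ρ * M / (1 - θ))
  set C := ∑ n ∈ Finset.range (N + 1), ‖odeCoeff a n‖ * ρ ^ n with hC
  have hC0 : 0 ≤ C := Finset.sum_nonneg fun _ _ => by positivity
  refine ⟨C, fun n => ?_⟩
  induction n using Nat.strong_induction_on with
  | _ n ih =>
    by_cases hn : n < N + 1
    · exact Finset.single_le_sum (f := fun n => ‖odeCoeff a n‖ * ρ ^ n)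
        (fun _ _ => by positivity) (Finset.mem_range.2 hn)
    · obtain ⟨m, rfl⟩ : ∃ m, n = m + 1 := ⟨n - 1, by omega⟩
      have hm : (N : ℝ) ≤ m := by exact_mod_cast (by omega : N ≤ m)
      have hm1 : (0 : ℝ) < m + 1 := by positivity
      have h1 : ((m : ℝ) + 1) * ‖odeCoeff a (m + 1)‖ ≤
          ∑ kl ∈ Finset.HasAntidiagonal.antidiagonal m, ‖a kl.1‖ * ‖odeCoeff a kl.2‖ := by
        have h := congrArg norm (odeCoeff_succ a m)
        rw [norm_smul] at h
        have h2 : ‖((m : ℂ) + 1)‖ = m + 1 := by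
          have := Complex.norm_natCast (m + 1)
          push_cast at this
          exact this
        rw [h2] at h
        rw [h]
        exact (norm_sum_le _ _).trans (Finset.sum_le_sum fun _ _ => norm_mul_le _ _)
      have h2 : (∑ kl ∈ Finset.HasAntidiagonal.antidiagonal m, ‖a kl.1‖ * ‖odeCoeff a kl.2‖) * ρ ^ m ≤
          M * C / (1 - θ) := by
        rw [Finset.sum_mul]
        calc _ ≤ ∑ kl ∈ Finset.HasAntidiagonal.antidiagonal m, M * C * θ ^ kl.1 := by
              refine Finset.sum_le_sum fun kl hkl => ?_
              have hs : kl.1 + kl.2 = m := Finset.HasAntidiagonal.mem_antidiagonal.1 hkl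
              have e1 : ‖a kl.1‖ * ρ ^ kl.1 ≤ M * θ ^ kl.1 := by
                have : ρ ^ kl.1 = r ^ kl.1 * θ ^ kl.1 := by
                  rw [← mul_pow, hθ, mul_div_cancel₀ _ hr.ne']
                rw [this, ← mul_assoc]
                gcongr
                exact ha _
              have e2 : ‖odeCoeff a kl.2‖ * ρ ^ kl.2 ≤ C := ih _ (by omega)
              calc ‖a kl.1‖ * ‖odeCoeff a kl.2‖ * ρ ^ m
                  = (‖a kl.1‖ * ρ ^ kl.1) * (‖odeCoeff a kl.2‖ * ρ ^ kl.2) := by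
                    rw [← hs, pow_add]; ring
                _ ≤ (M * θ ^ kl.1) * C := by gcongr
                _ = _ := by ring
          _ = M * C * ∑ k ∈ Finset.range (m + 1), θ ^ k := by
              rw [Finset.Nat.sum_antidiagonal_eq_sum_range_succ_mk]
              exact (Finset.mul_sum _ _ _).symm
          _ ≤ M * C * (1 - θ)⁻¹ := by
              gcongr
              rw [← tsum_geometric_of_lt_one hθ0.le hθ1]
              exact (summable_geometric_of_lt_one hθ0.le hθ1).sum_le_tsum _
                (fun _ _ => by positivity)
          _ = _ := by ring
      have h3 : ((m : ℝ) + 1) * (‖odeCoeff a (m + 1)‖ * ρ ^ (m + 1)) ≤ ((m : ℝ) + 1) * C := by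
        calc _ = (((m : ℝ) + 1) * ‖odeCoeff a (m + 1)‖) * ρ ^ m * ρ := by ring
          _ ≤ (M * C / (1 - θ)) * ρ := by
              gcongr
              exact (mul_le_mul_of_nonneg_right h1 (by positivity)).trans h2
          _ = (ρ * M / (1 - θ)) * C := by ring
          _ ≤ ((m : ℝ) + 1) * C := by
              gcongr
              linarith
      exact le_of_mul_le_mul_left h3 hm1

variable [CompleteSpace 𝔸]

/-- A linear differential equation whose coefficients are holomorphic in a disc has a fundamental
solution that is holomorphic in the same disc. -/
theorem exists_fundamental_solution {A : ℂ → 𝔸} {R : ℝ}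
    (hA : DifferentiableOn ℂ A (Metric.ball 0 R)) :
    ∃ Y : ℂ → 𝔸, Y 0 = 1 ∧ ∀ x ∈ Metric.ball (0 : ℂ) R, HasDerivAt Y (A x * Y x) x := by
  set a : ℕ → 𝔸 := fun n => ((n.factorial : ℂ))⁻¹ • iteratedDeriv n A 0 with ha
  have hsum : ∀ x ∈ Metric.ball (0 : ℂ) R, HasSum (fun n => x ^ n • a n) (A x) := by
    intro x hx
    have h := Complex.hasSum_taylorSeries_on_ball hA hx
    simp only [sub_zero] at h
    have e : (fun n => x ^ n • a n) =
        fun n : ℕ => ((n.factorial : ℂ))⁻¹ • x ^ n • iteratedDeriv n A 0 :=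
      funext fun n => smul_comm _ _ _
    rw [e]
    exact h
  have hbound : ∀ r, 0 < r → r < R → ∃ M, ∀ n, ‖a n‖ * r ^ n ≤ M := by
    intro r hr hrR
    have h := (hsum (r : ℂ) (by simpa [abs_of_pos hr] using hrR)).summable.tendsto_atTop_zero
    obtain ⟨M, hM⟩ := h.norm.bddAbove_range
    refine ⟨M, fun n => ?_⟩
    have := hM ⟨n, rfl⟩
    simpa [norm_smul, abs_of_pos hr, mul_comm] using this
  have hy : ∀ ρ, 0 < ρ → ρ < R → ∃ C, ∀ n, ‖odeCoeff a n‖ * ρ ^ n ≤ C := by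
    intro ρ hρ hρR
    obtain ⟨r, hr1, hr2⟩ := exists_between hρR
    obtain ⟨M, hM⟩ := hbound r (hρ.trans hr1) hr2
    exact exists_norm_odeCoeff_le hρ hr1 hM
  refine ⟨fun x => ∑' n, x ^ n • odeCoeff a n, ?_, fun x hx => ?_⟩
  · show ∑' n, (0 : ℂ) ^ n • odeCoeff a n = 1
    rw [tsum_eq_single 0 (fun n hn => by simp [hn])]
    simp [odeCoeff]
  have hx' : ‖x‖ < R := by simpa using hx
  obtain ⟨r, hr1, hr2⟩ := exists_between hx'
  have hr0 : 0 < r := (norm_nonneg x).trans_lt hr1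
  obtain ⟨ρ, hρ1, hρ2⟩ := exists_between hr2
  have hρ0 : 0 < ρ := hr0.trans hρ1
  obtain ⟨C, hC⟩ := hy ρ hρ0 hρ2
  have hC0 : 0 ≤ C := le_trans (by positivity) (hC 0)
  have hθ : ‖r / ρ‖ < 1 := by
    rw [Real.norm_of_nonneg (by positivity)]; exact (div_lt_one hρ0).2 hρ1
  have hle : ∀ n, ‖odeCoeff a n‖ * r ^ n ≤ C * (r / ρ) ^ n := by
    intro n
    have h := hC n
    rw [div_pow, mul_div_assoc', le_div_iff₀ (by positivity)]
    calc ‖odeCoeff a n‖ * r ^ n * ρ ^ n = (‖odeCoeff a n‖ * ρ ^ n) * r ^ n := by ring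
      _ ≤ C * r ^ n := by gcongr
  have hnorm : ∀ y : ℂ, ‖y‖ < r → Summable fun n => ‖y ^ n • odeCoeff a n‖ := by
    intro y hyr
    refine Summable.of_nonneg_of_le (fun _ => norm_nonneg _) (fun n => ?_)
      ((summable_geometric_of_norm_lt_one hθ).mul_left C)
    refine le_trans ?_ (hle n)
    rw [norm_smul, norm_pow, mul_comm]
    gcongr
  have hbd : ∀ (n : ℕ) (y : ℂ), ‖y‖ < r →
      ‖((n : ℂ) * y ^ (n - 1)) • odeCoeff a n‖ ≤ (C / r) * (n * (r / ρ) ^ n) := by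
    intro n y hy
    rcases Nat.eq_zero_or_pos n with rfl | hn
    · simp
    have h1 : r ^ (n - 1) * r = r ^ n := by
      rw [← pow_succ]; congr 1; omega
    rw [norm_smul, norm_mul, norm_pow, Complex.norm_natCast, div_mul_eq_mul_div,
      le_div_iff₀ hr0]
    calc (n : ℝ) * ‖y‖ ^ (n - 1) * ‖odeCoeff a n‖ * r
        ≤ n * r ^ (n - 1) * ‖odeCoeff a n‖ * r := by gcongr
      _ = n * (‖odeCoeff a n‖ * r ^ n) := by rw [← h1]; ring
      _ ≤ n * (C * (r / ρ) ^ n) := mul_le_mul_of_nonneg_left (hle n) n.cast_nonneg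
      _ = _ := by ring
  have hder := hasDerivAt_tsum_of_isPreconnected (𝕜 := ℂ) (t := Metric.ball (0 : ℂ) r)
    (g := fun (n : ℕ) y => y ^ n • odeCoeff a n)
    (g' := fun (n : ℕ) y => ((n : ℂ) * y ^ (n - 1)) • odeCoeff a n)
    (u := fun n : ℕ => (C / r) * (n * (r / ρ) ^ n)) (y₀ := 0) (y := x)
    ((by simpa using summable_pow_mul_geometric_of_norm_lt_one 1 hθ :
      Summable fun n : ℕ => (n : ℝ) * (r / ρ) ^ n).mul_left _) Metric.isOpen_ball
    (convex_ball _ _).isPreconnected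
    (fun n y _ => by simpa using (hasDerivAt_pow n y).smul_const (odeCoeff a n))
    (fun n y hy => ?_) (Metric.mem_ball_self hr0) (hnorm 0 (by simpa)).of_norm (by simpa using hr1)
  -- After dropping the vanishing term `n = 0` and shifting the index, the differentiated series
  -- matches the Cauchy product of the series of `A` and `Y` through `odeCoeff_succ`.
  · have hshift : (∑' n : ℕ, ((n : ℂ) * x ^ (n - 1)) • odeCoeff a n) =
        ∑' n : ℕ, x ^ n • (((n : ℂ) + 1) • odeCoeff a (n + 1)) := by
      rw [tsum_eq_zero_add']
      · simp [smul_smul, mul_comm]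
      · have hcont : Summable fun n : ℕ => ((n : ℂ) * x ^ (n - 1)) • odeCoeff a n := by
          refine Summable.of_norm_bounded (g := fun n : ℕ => (C / r) * (n * (r / ρ) ^ n))
            ((by simpa using summable_pow_mul_geometric_of_norm_lt_one 1 hθ :
              Summable fun n : ℕ => (n : ℝ) * (r / ρ) ^ n).mul_left _) fun n => ?_
          exact hbd n x hr1
        exact (summable_nat_add_iff 1).2 hcont
    refine HasDerivAt.congr_deriv hder ?_
    rw [hshift, ← (hsum x hx).tsum_eq,
      tsum_mul_tsum_eq_tsum_sum_antidiagonal_of_summable_norm _ (hnorm x hr1)]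
    · refine tsum_congr fun n => ?_
      rw [odeCoeff_succ, Finset.smul_sum]
      refine Finset.sum_congr rfl fun kl hkl => ?_
      rw [smul_mul_smul_comm, ← pow_add, Finset.HasAntidiagonal.mem_antidiagonal.1 hkl]
    · obtain ⟨M, hM⟩ := hbound ρ hρ0 hρ2
      have hθ' : ‖‖x‖ / ρ‖ < 1 := by
        rw [Real.norm_of_nonneg (by positivity)]; exact (div_lt_one hρ0).2 (hr1.trans hρ1)
      refine Summable.of_nonneg_of_le (fun _ => norm_nonneg _) (fun n => ?_)
        ((summable_geometric_of_norm_lt_one hθ').mul_left M)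
      rw [norm_smul, norm_pow, div_pow, mul_div_assoc', le_div_iff₀ (by positivity)]
      calc ‖x‖ ^ n * ‖a n‖ * ρ ^ n = (‖a n‖ * ρ ^ n) * ‖x‖ ^ n := by ring
        _ ≤ M * ‖x‖ ^ n := by gcongr; exact hM n
  · exact hbd n y (by simpa using hy)

end Coefficients

variable {E : Type*} [NormedAddCommGroup E] [NormedSpace ℂ E]

theorem analyticAt_of_eventually_hasDerivAt [CompleteSpace E] {Y Y' : ℂ → E} {x : ℂ}
    (h : ∀ᶠ y in 𝓝 x, HasDerivAt Y (Y' y) y) : AnalyticAt ℂ Y x :=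
  Complex.analyticAt_iff_eventually_differentiableAt.2 (h.mono fun _ hy => hy.differentiableAt)

/-- Two solutions of a linear differential equation with the same value at a point agree near that
point. -/
theorem linearODE_eventuallyEq [CompleteSpace E] {A : ℂ → E →L[ℂ] E} {Y Z : ℂ → E} {x : ℂ} (hA : ContinuousAt A x)
    (hY : ∀ᶠ y in 𝓝 x, HasDerivAt Y (A y (Y y)) y) (hZ : ∀ᶠ y in 𝓝 x, HasDerivAt Z (A y (Z y)) y)
    (hYZ : Y x = Z x) : Y =ᶠ[𝓝 x] Z := by
  have hD : ∀ᶠ y in 𝓝 x, HasDerivAt (fun y => Y y - Z y) (A y (Y y - Z y)) y := by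
    filter_upwards [hY, hZ] with y h1 h2
    rw [map_sub]
    exact h1.sub h2
  have han : AnalyticAt ℂ (fun y => Y y - Z y) x := analyticAt_of_eventually_hasDerivAt hD
  -- Otherwise the difference is `(y - x)ⁿ g` with `g x ≠ 0`, and `n ≥ 1` since it vanishes at `x`.
  -- Its derivative has exact order `n - 1`, while `A` applied to it has order at least `n`;
  -- dividing by `(y - x)ⁿ⁻¹` and passing to the limit yields `n g(x) = 0`.
  by_contra hne
  have hne' : ¬ ∀ᶠ y in 𝓝 x, Y y - Z y = 0 := fun h => hne (h.mono fun y hy => sub_eq_zero.1 hy)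
  obtain ⟨n, g, hg, hgx, hgn⟩ := han.exists_eventuallyEq_pow_smul_nonzero_iff.2 hne'
  have hgn : (fun z => Y z - Z z) =ᶠ[𝓝 x] fun z => (z - x) ^ n • g z := hgn
  have hn : n ≠ 0 := by
    rintro rfl
    have := hgn.self_of_nhds
    simp only [hYZ, sub_self, pow_zero, one_smul] at this
    exact hgx this.symm
  obtain ⟨m, rfl⟩ := Nat.exists_eq_succ_of_ne_zero hn
  have hev : ∀ᶠ y in 𝓝[≠] x, ((m : ℂ) + 1) • g y + (y - x) • deriv g y = (y - x) • A y (g y) := by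
    filter_upwards [hD.filter_mono nhdsWithin_le_nhds,
      (hgn.eventuallyEq_nhds).filter_mono nhdsWithin_le_nhds,
      (hg.eventually_analyticAt).filter_mono nhdsWithin_le_nhds,
      self_mem_nhdsWithin] with y h1 h2 h3 h4
    have hyx : y - x ≠ 0 := sub_ne_zero.2 h4
    have h5 : HasDerivAt (fun y => (y - x) ^ (m + 1) • g y)
        ((y - x) ^ (m + 1) • deriv g y + (((m : ℂ) + 1) * (y - x) ^ m) • g y) y := by
      have h6 : HasDerivAt (fun y => (y - x) ^ (m + 1)) (((m : ℂ) + 1) * (y - x) ^ m) y := by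
        simpa using ((hasDerivAt_id y).sub_const x).fun_pow (m + 1)
      exact h6.smul h3.differentiableAt.hasDerivAt
    have h7 := (h1.congr_of_eventuallyEq h2.symm).unique h5
    have h8 : Y y - Z y = (y - x) ^ (m + 1) • g y := h2.self_of_nhds
    rw [h8, map_smul] at h7
    have h9 : (y - x) ^ m • ((y - x) • A y (g y)) =
        (y - x) ^ m • (((m : ℂ) + 1) • g y + (y - x) • deriv g y) := by
      rw [smul_smul, ← pow_succ, h7, smul_add, smul_smul, smul_smul, ← pow_succ, add_comm,
        mul_comm ((y - x) ^ m)]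
    exact ((smul_right_injective _ (pow_ne_zero m hyx)) h9).symm
  have hc1 : Tendsto (fun y => ((m : ℂ) + 1) • g y + (y - x) • deriv g y) (𝓝[≠] x)
      (𝓝 (((m : ℂ) + 1) • g x + (x - x) • deriv g x)) := by
    refine Tendsto.mono_left ?_ nhdsWithin_le_nhds
    have h1 := hg.continuousAt
    have h2 := hg.deriv.continuousAt
    have h3 : ContinuousAt (fun y : ℂ => y - x) x := by fun_prop
    exact ((h1.const_smul _).add (h3.smul h2))
  have hc2 : Tendsto (fun y => (y - x) • A y (g y)) (𝓝[≠] x) (𝓝 ((x - x) • A x (g x))) := by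
    refine Tendsto.mono_left ?_ nhdsWithin_le_nhds
    have h3 : ContinuousAt (fun y : ℂ => y - x) x := by fun_prop
    exact h3.smul (hA.clm_apply hg.continuousAt)
  have h := tendsto_nhds_unique (hc1.congr' hev) hc2
  simp only [sub_self, zero_smul, add_zero] at h
  have hm : ((m : ℂ) + 1) ≠ 0 := by exact_mod_cast m.succ_ne_zero
  exact hgx ((smul_eq_zero.1 h).resolve_left hm)

/-- Uniqueness of solutions of linear differential equations on connected open sets. -/
theorem linearODE_eqOn [CompleteSpace E] {A : ℂ → E →L[ℂ] E} {Y Z : ℂ → E} {U : Set ℂ} {x : ℂ} (hU : IsOpen U)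
    (hUc : IsPreconnected U) (hx : x ∈ U) (hA : ContinuousAt A x)
    (hY : ∀ y ∈ U, HasDerivAt Y (A y (Y y)) y) (hZ : ∀ y ∈ U, HasDerivAt Z (A y (Z y)) y)
    (hYZ : Y x = Z x) : Set.EqOn Y Z U := by
  have hY' : ∀ y ∈ U, ∀ᶠ y' in 𝓝 y, HasDerivAt Y (A y' (Y y')) y' := fun y hy =>
    (hU.eventually_mem hy).mono fun y' hy' => hY y' hy'
  have hZ' : ∀ y ∈ U, ∀ᶠ y' in 𝓝 y, HasDerivAt Z (A y' (Z y')) y' := fun y hy =>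
    (hU.eventually_mem hy).mono fun y' hy' => hZ y' hy'
  exact AnalyticOnNhd.eqOn_of_preconnected_of_eventuallyEq
    (fun y hy => analyticAt_of_eventually_hasDerivAt (hY' y hy))
    (fun y hy => analyticAt_of_eventually_hasDerivAt (hZ' y hy)) hUc hx
    (linearODE_eventuallyEq hA (hY' x hx) (hZ' x hx) hYZ)

/-- A linear differential equation with holomorphic coefficients on a disc has a solution with a
given value at the centre. -/
theorem exists_linearODE_solution_center [CompleteSpace E] {A : ℂ → E →L[ℂ] E} {c : ℂ} {R : ℝ}
    (hA : DifferentiableOn ℂ A (Metric.ball c R)) (y₀ : E) :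
    ∃ Y : ℂ → E, Y c = y₀ ∧ ∀ x ∈ Metric.ball c R, HasDerivAt Y (A x (Y x)) x := by
  obtain ⟨Φ, hΦ0, hΦ⟩ := exists_fundamental_solution (A := fun x => A (c + x)) (R := R) (by
    refine hA.comp (by fun_prop) fun x hx => ?_
    simpa [Metric.mem_ball, dist_eq_norm] using hx)
  refine ⟨fun x => Φ (x - c) y₀, by simp [hΦ0], fun x hx => ?_⟩
  have h := hΦ (x - c) (by simpa [Metric.mem_ball, dist_eq_norm] using hx)
  rw [add_sub_cancel] at h
  have h2 := h.comp_sub_const x c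
  simpa using h2.clm_apply (hasDerivAt_const x y₀)

/-- Discs of radius `R / 2` centred within `R / 2` of `x₀` stay inside `U`. On such a disc the
solution with the right value at its centre exists, and uniqueness makes it a continuation. This is
the locally uniform radius that the continuation theorems ask for. -/
theorem linearODE_local_extension [CompleteSpace E] {A : ℂ → E →L[ℂ] E} {U : Set ℂ} (hU : IsOpen U)
    (hA : DifferentiableOn ℂ A U) (x₀ : ℂ) (hx₀ : x₀ ∈ U) :
    ∃ ε > 0, ∀ Y : ℂ → E, ∀ x ∈ Metric.ball x₀ ε, (∀ᶠ y in 𝓝 x, HasDerivAt Y (A y (Y y)) y) →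
      ∃ Y' : ℂ → E, Y' =ᶠ[𝓝 x] Y ∧
        ∀ y ∈ Metric.ball x ε, ∀ᶠ y' in 𝓝 y, HasDerivAt Y' (A y' (Y' y')) y' := by
  obtain ⟨R, hR, hRU⟩ := Metric.isOpen_iff.1 hU x₀ hx₀
  refine ⟨R / 2, half_pos hR, fun Y x hx hY => ?_⟩
  have hsub : Metric.ball x (R / 2) ⊆ U := by
    refine Set.Subset.trans (fun y hy => ?_) hRU
    rw [Metric.mem_ball] at *
    linarith [dist_triangle y x x₀]
  obtain ⟨Z, hZ0, hZ⟩ := exists_linearODE_solution_center (hA.mono hsub) (Y x)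
  have hxx : x ∈ Metric.ball x (R / 2) := Metric.mem_ball_self (half_pos hR)
  have hZ' : ∀ y ∈ Metric.ball x (R / 2), ∀ᶠ y' in 𝓝 y, HasDerivAt Z (A y' (Z y')) y' :=
    fun y hy => (Metric.isOpen_ball.eventually_mem hy).mono fun y' hy' => hZ y' hy'
  exact ⟨Z, linearODE_eventuallyEq ((hA.differentiableAt (hU.mem_nhds (hsub hxx))).continuousAt)
    (hZ' x hxx) hY hZ0, hZ'⟩

/-- Existence of solutions of linear differential equations on discs. -/
theorem exists_linearODE_solution_ball [CompleteSpace E] {A : ℂ → E →L[ℂ] E} {x₁ c : ℂ} {R : ℝ}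
    (hc : c ∈ Metric.ball x₁ R) (hA : DifferentiableOn ℂ A (Metric.ball x₁ R)) (y₀ : E) :
    ∃ Y : ℂ → E, Y c = y₀ ∧ ∀ x ∈ Metric.ball x₁ R, HasDerivAt Y (A x (Y x)) x := by
  obtain ⟨r, hr, hrR⟩ := Metric.isOpen_iff.1 Metric.isOpen_ball c hc
  obtain ⟨Z, hZ0, hZ⟩ := exists_linearODE_solution_center (hA.mono hrR) y₀
  obtain ⟨Y, hY1, hY2⟩ := exists_extension_ball
    (P := fun Y x => ∀ᶠ y in 𝓝 x, HasDerivAt Y (A y (Y y)) y) hc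
    (fun β β' x h1 h2 => by
      filter_upwards [h1, h2.eventuallyEq_nhds] with y h3 h4
      rw [h4.self_of_nhds]
      exact h3.congr_of_eventuallyEq h4)
    (fun β x h => analyticAt_of_eventually_hasDerivAt h)
    (fun x₀ hx₀ => linearODE_local_extension Metric.isOpen_ball hA x₀ hx₀) (β := Z)
    (eventually_of_mem (Metric.ball_mem_nhds c hr) fun y hy => hZ y hy)
  exact ⟨Y, hY1.self_of_nhds.trans hZ0, fun x hx => (hY2 x hx).self_of_nhds⟩

/-- Existence of solutions of linear differential equations on the upper half-plane. -/
theorem exists_linearODE_solution_upperHalfPlane [CompleteSpace E] {A : ℂ → E →L[ℂ] E} {c : ℂ} (hc : 0 < c.im)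
    (hA : DifferentiableOn ℂ A {x | 0 < x.im}) (y₀ : E) :
    ∃ Y : ℂ → E, Y c = y₀ ∧ ∀ x : ℂ, 0 < x.im → HasDerivAt Y (A x (Y x)) x := by
  have hopen : IsOpen {x : ℂ | 0 < x.im} := isOpen_lt continuous_const Complex.continuous_im
  obtain ⟨r, hr, hrR⟩ := Metric.isOpen_iff.1 hopen c hc
  obtain ⟨Z, hZ0, hZ⟩ := exists_linearODE_solution_center (hA.mono hrR) y₀
  obtain ⟨Y, hY1, hY2⟩ := exists_extension_upperHalfPlane
    (P := fun Y x => ∀ᶠ y in 𝓝 x, HasDerivAt Y (A y (Y y)) y) hc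
    (fun β β' x h1 h2 => by
      filter_upwards [h1, h2.eventuallyEq_nhds] with y h3 h4
      rw [h4.self_of_nhds]
      exact h3.congr_of_eventuallyEq h4)
    (fun β x h => analyticAt_of_eventually_hasDerivAt h)
    (fun x₀ hx₀ => linearODE_local_extension hopen hA x₀ hx₀) (β := Z)
    (eventually_of_mem (Metric.ball_mem_nhds c hr) fun y hy => hZ y hy)
  exact ⟨Y, hY1.self_of_nhds.trans hZ0, fun x hx => (hY2 x hx).self_of_nhds⟩

end LinearODE

/-! ### The hypergeometric function `F(2/5, 3/5; 1; z)` -/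

section Hypergeometric

open MeasureTheory

/-- The plane cut along `[1, ∞)`. -/
def cutPlane : Set ℂ := {z | 1 - z ∈ Complex.slitPlane}

theorem mem_cutPlane {z : ℂ} : z ∈ cutPlane ↔ 1 - z ∈ Complex.slitPlane := Iff.rfl

theorem isOpen_cutPlane : IsOpen cutPlane :=
  Complex.isOpen_slitPlane.preimage (by fun_prop)

theorem zero_mem_cutPlane : (0 : ℂ) ∈ cutPlane := by simp [mem_cutPlane]

theorem one_sub_mul_mem_slitPlane {z : ℂ} (hz : z ∈ cutPlane) {t : ℝ} (ht0 : 0 ≤ t) (ht1 : t ≤ 1) :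
    1 - z * t ∈ Complex.slitPlane := by
  have h := Complex.starConvex_one_slitPlane hz (sub_nonneg.2 ht1) ht0 (by ring)
  convert h using 1
  simp only [Complex.real_smul]
  push_cast
  ring

theorem mul_mem_cutPlane {z : ℂ} (hz : z ∈ cutPlane) {t : ℝ} (ht0 : 0 ≤ t) (ht1 : t ≤ 1) :
    z * t ∈ cutPlane := one_sub_mul_mem_slitPlane hz ht0 ht1

theorem ofReal_mem_cutPlane {x : ℝ} (hx : x < 1) : (x : ℂ) ∈ cutPlane := by
  rw [mem_cutPlane, ← Complex.ofReal_one, ← Complex.ofReal_sub]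
  exact Complex.ofReal_mem_slitPlane.2 (by linarith)

theorem isPreconnected_cutPlane : IsPreconnected cutPlane := by
  have h : StarConvex ℝ (0 : ℂ) cutPlane := by
    rw [starConvex_zero_iff]
    intro x hx a ha0 ha1
    have := mul_mem_cutPlane hx ha0 ha1
    rwa [mul_comm] at this
  exact (h.isPathConnected zero_mem_cutPlane).isConnected.isPreconnected

/-- Differentiation under the integral sign for Euler integrals. -/
theorem hasDerivAt_eulerIntegral {ν : ℝ → ℂ} (hν : IntervalIntegrable ν volume 0 1) (p : ℂ) {z : ℂ}
    (hz : z ∈ cutPlane) :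
    HasDerivAt (fun z : ℂ => ∫ t in (0 : ℝ)..1, ν t * (1 - z * t) ^ p)
      (∫ t in (0 : ℝ)..1, (ν t * (-p * t)) * (1 - z * t) ^ (p - 1)) z := by
  obtain ⟨ε, hε, hball⟩ := Metric.nhds_basis_closedBall.mem_iff.1 (isOpen_cutPlane.mem_nhds hz)
  have hslit : ∀ y ∈ Metric.closedBall z ε, ∀ t ∈ Set.Icc (0 : ℝ) 1,
      1 - y * t ∈ Complex.slitPlane := fun y hy t ht =>
    one_sub_mul_mem_slitPlane (hball hy) ht.1 ht.2
  have hcont : ContinuousOn (fun x : ℂ × ℝ => (-p * x.2) * (1 - x.1 * x.2) ^ (p - 1))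
      (Metric.closedBall z ε ×ˢ Set.Icc (0 : ℝ) 1) := by
    refine ContinuousOn.mul (by fun_prop) (ContinuousOn.cpow (by fun_prop) (by fun_prop) ?_)
    rintro ⟨y, t⟩ ⟨hy, ht⟩
    exact hslit y hy t ht
  obtain ⟨K, hK⟩ := ((isCompact_closedBall z ε).prod isCompact_Icc).exists_bound_of_continuousOn
    hcont
  have hcont2 : ∀ y ∈ Metric.closedBall z ε, ∀ p : ℂ,
      ContinuousOn (fun t : ℝ => (1 - y * t) ^ p) (Set.uIcc 0 1) := by
    intro y hy p
    rw [Set.uIcc_of_le zero_le_one]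
    exact ContinuousOn.cpow (by fun_prop) (by fun_prop) fun t ht => hslit y hy t ht
  have hsub : Set.uIoc (0 : ℝ) 1 ⊆ Set.Icc 0 1 := by
    rw [Set.uIoc_of_le zero_le_one]; exact Set.Ioc_subset_Icc_self
  refine (intervalIntegral.hasDerivAt_integral_of_dominated_loc_of_deriv_le
    (F := fun z t => ν t * (1 - z * t) ^ p)
    (F' := fun z t => (ν t * (-p * t)) * (1 - z * t) ^ (p - 1))
    (bound := fun t => K * ‖ν t‖) (s := Metric.ball z ε) (Metric.ball_mem_nhds z hε)
    ?_ ?_ ?_ ?_ ?_ ?_).2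
  · filter_upwards [Metric.ball_mem_nhds z hε] with y hy
    exact (hν.mul_continuousOn
      (hcont2 y (Metric.ball_subset_closedBall hy) p)).def'.aestronglyMeasurable
  · exact hν.mul_continuousOn (hcont2 z (Metric.mem_closedBall_self hε.le) p)
  · have h := (hν.mul_continuousOn (g := fun t : ℝ => (-p * t)) (by fun_prop)).mul_continuousOn
      (hcont2 z (Metric.mem_closedBall_self hε.le) (p - 1))
    exact h.def'.aestronglyMeasurable
  · refine Eventually.of_forall fun t ht y hy => ?_
    have h := hK (y, t) ⟨Metric.ball_subset_closedBall hy, hsub ht⟩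
    rw [mul_assoc, norm_mul, mul_comm]
    gcongr
  · exact hν.norm.const_mul K
  · refine Eventually.of_forall fun t ht y hy => ?_
    have h1 : HasDerivAt (fun y : ℂ => 1 - y * t) (-t) y := by
      simpa using ((hasDerivAt_id y).mul_const (t : ℂ)).const_sub 1
    have h2 := (h1.cpow_const (c := p)
      (hslit y (Metric.ball_subset_closedBall hy) t (hsub ht))).const_mul (ν t)
    refine h2.congr_deriv ?_
    ring

/-- The kernel `t ^ (-2/5) (1 - t) ^ (-3/5)` of the Euler integral. -/
def eulerKernel (t : ℝ) : ℂ := (t : ℂ) ^ (-(2 / 5) : ℂ) * (1 - (t : ℂ)) ^ (-(3 / 5) : ℂ)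

theorem eulerKernel_eq_ofReal {t : ℝ} (h0 : 0 ≤ t) (h1 : t ≤ 1) :
    eulerKernel t = ((t ^ (-(2 / 5) : ℝ) * (1 - t) ^ (-(3 / 5) : ℝ) : ℝ) : ℂ) := by
  have h2 : 0 ≤ 1 - t := by linarith
  rw [eulerKernel, Complex.ofReal_mul, Complex.ofReal_cpow h0, Complex.ofReal_cpow h2]
  push_cast
  rfl

theorem intervalIntegrable_eulerKernel : IntervalIntegrable eulerKernel volume 0 1 := by
  have h := Complex.betaIntegral_convergent (u := 3 / 5) (v := 2 / 5) (by norm_num) (by norm_num)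
  convert h using 2 with t
  rw [eulerKernel]
  norm_num

/-- A beta integral: `B(3/5, 2/5) = Γ(3/5) Γ(2/5) = π / sin(2π/5)`, and `sin(2π/5) = cos(π/10)`.
This is how the cusp width of the group enters the periods. -/
theorem integral_eulerKernel : ∫ t in (0 : ℝ)..1, eulerKernel t = 2 * Real.pi / width := by
  have h : ∫ t in (0 : ℝ)..1, eulerKernel t = Complex.betaIntegral (3 / 5) (2 / 5) := by
    rw [Complex.betaIntegral]
    refine intervalIntegral.integral_congr fun t _ => ?_
    simp only [eulerKernel]
    norm_num
  have h2 := Complex.Gamma_mul_Gamma_eq_betaIntegral (s := 3 / 5) (t := 2 / 5)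
    (by norm_num) (by norm_num)
  have h3 := Complex.Gamma_mul_Gamma_one_sub (2 / 5)
  have h4 : (1 : ℂ) - 2 / 5 = 3 / 5 := by norm_num
  have h5 : (3 / 5 : ℂ) + 2 / 5 = 1 := by norm_num
  rw [h5, Complex.Gamma_one, one_mul, mul_comm] at h2
  rw [h4, h2] at h3
  have h6 : Complex.sin (Real.pi * (2 / 5)) = ((Real.cos (Real.pi / 10) : ℝ) : ℂ) := by
    rw [← Real.sin_pi_div_two_sub, Complex.ofReal_sin]
    congr 1
    push_cast
    ring
  rw [h, h3, h6, width]
  push_cast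
  rw [mul_div_mul_left _ _ two_ne_zero]

theorem width_pos : 0 < width :=
  mul_pos two_pos (Real.cos_pos_of_mem_Ioo ⟨by linarith [Real.pi_pos], by linarith [Real.pi_pos]⟩)

theorem width_ne_zero : (width : ℂ) ≠ 0 := by exact_mod_cast width_pos.ne'

/-- The hypergeometric function `F(2/5, 3/5; 1; z)` on the plane cut along `[1, ∞)`. -/
def hyp (z : ℂ) : ℂ :=
  (width / (2 * Real.pi)) * ∫ t in (0 : ℝ)..1, eulerKernel t * (1 - z * t) ^ (-(2 / 5) : ℂ)

/-- The derivative of `hyp`. -/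
def hypDeriv (z : ℂ) : ℂ :=
  (width / (2 * Real.pi)) *
    ∫ t in (0 : ℝ)..1, (eulerKernel t * (2 / 5 * t)) * (1 - z * t) ^ (-(7 / 5) : ℂ)

/-- The second derivative of `hyp`. -/
def hypDeriv₂ (z : ℂ) : ℂ :=
  (width / (2 * Real.pi)) *
    ∫ t in (0 : ℝ)..1, (eulerKernel t * (2 / 5 * t) * (7 / 5 * t)) * (1 - z * t) ^ (-(12 / 5) : ℂ)

theorem hasDerivAt_hyp {z : ℂ} (hz : z ∈ cutPlane) : HasDerivAt hyp (hypDeriv z) z := by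
  have h := (hasDerivAt_eulerIntegral intervalIntegrable_eulerKernel (-(2 / 5)) hz).const_mul
    ((width : ℂ) / (2 * Real.pi))
  refine h.congr_deriv ?_
  rw [hypDeriv]
  norm_num

theorem hasDerivAt_hypDeriv {z : ℂ} (hz : z ∈ cutPlane) : HasDerivAt hypDeriv (hypDeriv₂ z) z := by
  have h := (hasDerivAt_eulerIntegral (intervalIntegrable_eulerKernel.mul_continuousOn
    (g := fun t : ℝ => (2 / 5 * t : ℂ)) (by fun_prop)) (-(7 / 5)) hz).const_mul
    ((width : ℂ) / (2 * Real.pi))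
  refine h.congr_deriv ?_
  rw [hypDeriv₂]
  norm_num

theorem differentiableOn_hyp : DifferentiableOn ℂ hyp cutPlane := fun _ hz =>
  (hasDerivAt_hyp hz).differentiableAt.differentiableWithinAt

theorem hyp_zero : hyp 0 = 1 := by
  have h : ∫ t in (0 : ℝ)..1, eulerKernel t * (1 - 0 * (t : ℂ)) ^ (-(2 / 5) : ℂ) =
      2 * Real.pi / width := by
    rw [← integral_eulerKernel]
    simp
  have hπ : (Real.pi : ℂ) ≠ 0 := by exact_mod_cast Real.pi_ne_zero
  have := width_ne_zero
  rw [hyp, h]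
  field_simp

end Hypergeometric

/-! ### The hypergeometric equation and the positivity of the period ratio. -/

section HypergeometricEquation

open MeasureTheory

theorem cpow_eq_mul_cpow {x p q : ℂ} (hx : x ≠ 0) (h : p = 1 + q) : x ^ p = x * x ^ q := by
  rw [h, Complex.cpow_add _ _ hx, Complex.cpow_one]

theorem continuousOn_one_sub_mul_cpow {z : ℂ} (hz : z ∈ cutPlane) (p : ℂ) :
    ContinuousOn (fun t : ℝ => (1 - z * t) ^ p) (Set.Icc 0 1) :=
  ContinuousOn.cpow (by fun_prop) (by fun_prop) fun _ ht =>
    one_sub_mul_mem_slitPlane hz ht.1 ht.2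

theorem intervalIntegrable_eulerKernel_mul {z : ℂ} (hz : z ∈ cutPlane) {g : ℝ → ℂ}
    (hg : ContinuousOn g (Set.Icc 0 1)) (p : ℂ) :
    IntervalIntegrable (fun t : ℝ => (eulerKernel t * g t) * (1 - z * t) ^ p) volume 0 1 := by
  rw [← Set.uIcc_of_le zero_le_one] at hg
  refine (intervalIntegrable_eulerKernel.mul_continuousOn hg).mul_continuousOn ?_
  rw [Set.uIcc_of_le zero_le_one]
  exact continuousOn_one_sub_mul_cpow hz p

/-- An exact differential that vanishes at both ends of `[0, 1]`. With `p = -7/5` it yields the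
hypergeometric equation, with `p = -2/5` the behaviour of the derivative of `F` at `z = 1`. -/
theorem hasDerivAt_eulerPrimitive {z : ℂ} (hz : z ∈ cutPlane) {p : ℂ} {t : ℝ}
    (ht : t ∈ Set.Ioo (0 : ℝ) 1) :
    HasDerivAt (fun t : ℝ => (t : ℂ) ^ (3 / 5 : ℂ) * (1 - (t : ℂ)) ^ (2 / 5 : ℂ) *
        (1 - z * t) ^ p)
      ((eulerKernel t * ((3 / 5 - t) * (1 - z * t) - p * z * (t * (1 - t)))) *
        (1 - z * t) ^ (p - 1)) t := by
  have ht0 : (t : ℂ) ∈ Complex.slitPlane := Complex.ofReal_mem_slitPlane.2 ht.1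
  have ht1 : 1 - (t : ℂ) ∈ Complex.slitPlane := by
    rw [← Complex.ofReal_one, ← Complex.ofReal_sub]
    exact Complex.ofReal_mem_slitPlane.2 (by linarith [ht.2])
  have hX := one_sub_mul_mem_slitPlane hz ht.1.le ht.2.le
  have h1 : HasDerivAt (fun s : ℂ => s ^ (3 / 5 : ℂ)) (3 / 5 * (t : ℂ) ^ ((3 / 5 : ℂ) - 1) * 1) t :=
    (hasDerivAt_id (t : ℂ)).cpow_const ht0
  have h2 : HasDerivAt (fun s : ℂ => (1 - s) ^ (2 / 5 : ℂ))
      (2 / 5 * (1 - (t : ℂ)) ^ ((2 / 5 : ℂ) - 1) * (-1)) t :=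
    ((hasDerivAt_id (t : ℂ)).const_sub 1).cpow_const ht1
  have h3 : HasDerivAt (fun s : ℂ => (1 - z * s) ^ p)
      (p * (1 - z * (t : ℂ)) ^ (p - 1) * (-(z * 1))) t :=
    (((hasDerivAt_id (t : ℂ)).const_mul z).const_sub 1).cpow_const hX
  have h := ((h1.mul h2).mul h3).comp_ofReal
  refine HasDerivAt.congr_deriv h ?_
  have e1 : (t : ℂ) ^ (3 / 5 : ℂ) = t * (t : ℂ) ^ (-(2 / 5) : ℂ) :=
      cpow_eq_mul_cpow (Complex.slitPlane_ne_zero ht0) (by norm_num)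
  have e2 : (1 - (t : ℂ)) ^ (2 / 5 : ℂ) = (1 - t) * (1 - (t : ℂ)) ^ (-(3 / 5) : ℂ) :=
      cpow_eq_mul_cpow (Complex.slitPlane_ne_zero ht1) (by norm_num)
  have e3 : (1 - z * t) ^ p = (1 - z * t) * (1 - z * t) ^ (p - 1) :=
      cpow_eq_mul_cpow (Complex.slitPlane_ne_zero hX) (by ring)
  have e4 : (3 / 5 : ℂ) - 1 = -(2 / 5) := by norm_num
  have e5 : (2 / 5 : ℂ) - 1 = -(3 / 5) := by norm_num
  simp only [Pi.mul_apply]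
  rw [e4, e5, e1, e2, e3, eulerKernel]
  ring

/-- The derivative of `t ^ (3/5) (1 - t) ^ (2/5) (1 - z t) ^ p` integrates to zero. -/
theorem integral_eulerPrimitive {z : ℂ} (hz : z ∈ cutPlane) (p : ℂ) :
    ∫ t in (0 : ℝ)..1, (eulerKernel t * ((3 / 5 - t) * (1 - z * t) - p * z * (t * (1 - t)))) *
        (1 - z * t) ^ (p - 1) = 0 := by
  rw [intervalIntegral.integral_eq_sub_of_hasDerivAt_of_le zero_le_one
    (f := fun t : ℝ => (t : ℂ) ^ (3 / 5 : ℂ) * (1 - (t : ℂ)) ^ (2 / 5 : ℂ) * (1 - z * t) ^ p)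
    ?_ (fun t ht => hasDerivAt_eulerPrimitive hz ht)
    (intervalIntegrable_eulerKernel_mul hz (by fun_prop) _)]
  · have h1 : (3 / 5 : ℂ) ≠ 0 := by norm_num
    have h2 : (2 / 5 : ℂ) ≠ 0 := by norm_num
    simp [Complex.zero_cpow h1, Complex.zero_cpow h2]
  · refine ContinuousOn.mul (ContinuousOn.mul ?_ ?_) (continuousOn_one_sub_mul_cpow hz p)
    · exact (Complex.continuous_ofReal_cpow_const (by norm_num)).continuousOn
    · have h := (Complex.continuous_ofReal_cpow_const (y := 2 / 5) (by norm_num)).comp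
        (continuous_const.sub continuous_id : Continuous fun t : ℝ => 1 - t)
      refine (h.congr fun t => ?_).continuousOn
      simp

/-- The hypergeometric differential equation. -/
theorem hyp_ode {z : ℂ} (hz : z ∈ cutPlane) :
    z * (1 - z) * hypDeriv₂ z + (1 - 2 * z) * hypDeriv z - 6 / 25 * hyp z = 0 := by
  have h0 := integral_eulerPrimitive hz (-(7 / 5))
  have i1 : IntervalIntegrable (fun t : ℝ => (eulerKernel t * (2 / 5 * t) * (7 / 5 * t)) *
      (1 - z * t) ^ (-(12 / 5) : ℂ)) volume 0 1 := by
    have := intervalIntegrable_eulerKernel_mul hz (g := fun t : ℝ => (2 / 5 * t) * (7 / 5 * t))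
      (by fun_prop) (-(12 / 5))
    simpa only [mul_assoc] using this
  have i2 := intervalIntegrable_eulerKernel_mul hz (g := fun t : ℝ => (2 / 5 * t : ℂ))
      (by fun_prop) (-(7 / 5))
  have i3 : IntervalIntegrable (fun t : ℝ => eulerKernel t *
      (1 - z * t) ^ (-(2 / 5) : ℂ)) volume 0 1 := by
    simpa using intervalIntegrable_eulerKernel_mul hz (g := fun t : ℝ => (1 : ℂ))
      (by fun_prop) (-(2 / 5))
  have key : z * (1 - z) * (∫ t in (0 : ℝ)..1, (eulerKernel t * (2 / 5 * t) * (7 / 5 * t)) *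
        (1 - z * t) ^ (-(12 / 5) : ℂ)) +
      (1 - 2 * z) * (∫ t in (0 : ℝ)..1, (eulerKernel t * (2 / 5 * t)) *
        (1 - z * t) ^ (-(7 / 5) : ℂ)) -
      6 / 25 * (∫ t in (0 : ℝ)..1, eulerKernel t * (1 - z * t) ^ (-(2 / 5) : ℂ)) = 0 := by
    rw [← intervalIntegral.integral_const_mul, ← intervalIntegral.integral_const_mul,
      ← intervalIntegral.integral_const_mul, ← intervalIntegral.integral_add (i1.const_mul _)
      (i2.const_mul _), ← intervalIntegral.integral_sub ((i1.const_mul _).add (i2.const_mul _))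
      (i3.const_mul _)]
    -- Once all powers of `1 - z t` are reduced to the exponent `-12/5`, the integrand of the
    -- equation is `-2/5` times the exact derivative.
    have h1 := congrArg (fun x => (-(2 / 5) : ℂ) * x) h0
    simp only [mul_zero] at h1
    rw [← intervalIntegral.integral_const_mul] at h1
    rw [← h1]
    refine intervalIntegral.integral_congr fun t ht => ?_
    rw [Set.uIcc_of_le zero_le_one] at ht
    have hX := Complex.slitPlane_ne_zero (one_sub_mul_mem_slitPlane hz ht.1 ht.2)
    have e1 : (1 - z * t) ^ (-(7 / 5) : ℂ) = (1 - z * t) * (1 - z * t) ^ (-(12 / 5) : ℂ) :=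
      cpow_eq_mul_cpow hX (by norm_num)
    have e2 : (1 - z * t) ^ (-(2 / 5) : ℂ) = (1 - z * t) * (1 - z * t) ^ (-(7 / 5) : ℂ) :=
      cpow_eq_mul_cpow hX (by norm_num)
    have e3 : (-(7 / 5) : ℂ) - 1 = -(12 / 5) := by norm_num
    rw [e3, e2, e1]
    ring
  rw [hyp, hypDeriv, hypDeriv₂]
  linear_combination ((width : ℂ) / (2 * Real.pi)) * key

theorem re_cpow_mul_conj_cpow (w₁ w₂ : ℂ) (h₁ : w₁ ≠ 0) (h₂ : w₂ ≠ 0) (c : ℝ) :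
    (w₁ ^ (c : ℂ) * (starRingEnd ℂ) (w₂ ^ (c : ℂ))).re =
      Real.exp (c * Real.log ‖w₁‖ + c * Real.log ‖w₂‖) *
        Real.cos (c * (w₁.arg - w₂.arg)) := by
  rw [Complex.cpow_def_of_ne_zero h₁, Complex.cpow_def_of_ne_zero h₂, ← Complex.exp_conj,
    ← Complex.exp_add, Complex.exp_re]
  congr 2
  · simp [Complex.log_re]; ring
  · simp [Complex.log_im]; ring

/-- For points in opposite half-planes the difference of arguments lies in `(0, 2π)`. The imaginary
part of `w₁` times the conjugate of `w₂` is a positive multiple of the sine of this difference, so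
the difference is below `π`. -/
theorem abs_arg_sub_arg_lt {w₁ w₂ : ℂ} (h₁ : 0 < w₁.im) (h₂ : w₂.im < 0)
    (h : 0 < (w₁ * (starRingEnd ℂ) w₂).im) : |w₁.arg - w₂.arg| < Real.pi := by
  have a1 : 0 ≤ w₁.arg := Complex.arg_nonneg_iff.2 h₁.le
  have a2 : w₂.arg < 0 := Complex.arg_neg_iff.2 h₂
  have a3 := Complex.arg_le_pi w₁
  have a4 := Complex.neg_pi_lt_arg w₂
  have hs : 0 < Real.sin (w₁.arg - w₂.arg) := by
    have e : (w₁ * (starRingEnd ℂ) w₂).im = ‖w₁‖ * ‖w₂‖ * Real.sin (w₁.arg - w₂.arg) := by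
      have b1 := Complex.norm_mul_cos_arg w₁
      have b2 := Complex.norm_mul_sin_arg w₁
      have b3 := Complex.norm_mul_cos_arg w₂
      have b4 := Complex.norm_mul_sin_arg w₂
      rw [Real.sin_sub, Complex.mul_im, Complex.conj_re, Complex.conj_im, ← b1, ← b2, ← b3, ← b4]
      ring
    rw [e] at h
    by_contra hn
    push Not at hn
    have : ‖w₁‖ * ‖w₂‖ * Real.sin (w₁.arg - w₂.arg) ≤ 0 :=
      mul_nonpos_of_nonneg_of_nonpos (by positivity) hn
    linarith
  rw [abs_of_pos (by linarith)]
  by_contra hn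
  push Not at hn
  have : Real.sin (w₁.arg - w₂.arg) ≤ 0 := by
    have e : w₁.arg - w₂.arg = (w₁.arg - w₂.arg - 2 * Real.pi) + 2 * Real.pi := by ring
    rw [e, Real.sin_add_two_pi]
    exact Real.sin_nonpos_of_nonpos_of_neg_pi_le (by linarith) (by linarith)
  linarith

/-- The exponent scales the difference of arguments to less than `2π/5`, which is below `π/2`. -/
theorem re_cpow_mul_conj_cpow_pos {w₁ w₂ : ℂ} (h₁ : w₁ ≠ 0) (h₂ : w₂ ≠ 0)
    (h : |w₁.arg - w₂.arg| < Real.pi) :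
    0 < (w₁ ^ (-(2 / 5) : ℂ) * (starRingEnd ℂ) (w₂ ^ (-(2 / 5) : ℂ))).re := by
  have e : (-(2 / 5) : ℂ) = ((-(2 / 5) : ℝ) : ℂ) := by push_cast; rfl
  rw [e, re_cpow_mul_conj_cpow _ _ h₁ h₂]
  rw [abs_lt] at h
  refine mul_pos (Real.exp_pos _) (Real.cos_pos_of_mem_Ioo ⟨?_, ?_⟩) <;>
    linarith [h.1, h.2, Real.pi_pos]

/-- The imaginary part of the first factor times the conjugate of the second is `Im z` times a
positive number. So `abs_arg_sub_arg_lt` applies directly for `Im z > 0` and with the factors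
exchanged for `Im z < 0`; for real `z`, which lies in `(0, 1)`, both arguments vanish. -/
theorem abs_arg_sub_arg_eulerFactor {z : ℂ} (hz : z ∈ cutPlane) (hz' : z ∈ Complex.slitPlane)
    {s t : ℝ} (hs : s ∈ Set.Ioo (0 : ℝ) 1) (ht : t ∈ Set.Ioo (0 : ℝ) 1) :
    |(1 - (1 - z) * s).arg - (1 - z * t).arg| < Real.pi := by
  have hs0 := hs.1
  have hs1 := sub_pos.2 hs.2
  have ht0 := ht.1
  have ht1 := sub_pos.2 ht.2
  have e : ((1 - (1 - z) * s) * (starRingEnd ℂ) (1 - z * t)).im =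
      z.im * ((1 - s) * t + (1 - t) * s + s * t) := by
    simp
    ring
  have hpos : 0 < (1 - s) * t + (1 - t) * s + s * t := by positivity
  rcases lt_trichotomy z.im 0 with h | h | h
  · rw [abs_sub_comm]
    refine abs_arg_sub_arg_lt ?_ ?_ ?_
    · simp; nlinarith
    · simp; nlinarith
    · have e2 : ((1 - z * t) * (starRingEnd ℂ) (1 - (1 - z) * s)).im =
          - ((1 - (1 - z) * s) * (starRingEnd ℂ) (1 - z * t)).im := by
        simp only [Complex.mul_im, Complex.conj_re, Complex.conj_im]; ring
      rw [e2, e]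
      nlinarith
  · have hx : z = (z.re : ℂ) := Complex.ext rfl (by simp [h])
    have h0 : 0 < z.re := by
      rw [hx] at hz'; exact Complex.ofReal_mem_slitPlane.1 hz'
    have h1 : z.re < 1 := by
      rw [hx, mem_cutPlane, ← Complex.ofReal_one, ← Complex.ofReal_sub] at hz
      linarith [Complex.ofReal_mem_slitPlane.1 hz]
    have a1 : (1 - (1 - z) * s).arg = 0 := by
      have : (1 - (1 - z) * s) = ((1 - (1 - z.re) * s : ℝ) : ℂ) := by rw [hx]; push_cast; simp
      rw [this]; exact Complex.arg_ofReal_of_nonneg (by nlinarith)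
    have a2 : (1 - z * t).arg = 0 := by
      have : (1 - z * t) = ((1 - z.re * t : ℝ) : ℂ) := by rw [hx]; push_cast; simp
      rw [this]; exact Complex.arg_ofReal_of_nonneg (by nlinarith)
    rw [a1, a2]
    simpa using Real.pi_pos
  · refine abs_arg_sub_arg_lt ?_ ?_ ?_
    · simp; nlinarith
    · simp; nlinarith
    · rw [e]
      positivity

theorem re_integral_mul_pos {g : ℝ → ℂ} (hg : IntervalIntegrable g volume 0 1) (u : ℂ)
    (h : ∀ t ∈ Set.Ioo (0 : ℝ) 1, 0 < (g t * u).re) : 0 < ((∫ t in (0 : ℝ)..1, g t) * u).re := by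
  rw [← intervalIntegral.integral_mul_const]
  have hi : IntervalIntegrable (fun t => g t * u) volume 0 1 := hg.mul_const u
  have e := Complex.reCLM.intervalIntegral_comp_comm hi
  simp only [Complex.reCLM_apply] at e
  rw [← e]
  have hi' : IntervalIntegrable (fun t => (g t * u).re) volume 0 1 :=
    ⟨hi.1.re, hi.2.re⟩
  exact intervalIntegral.intervalIntegral_pos_of_pos_on hi' h zero_lt_one

theorem eulerKernel_pos {t : ℝ} (ht : t ∈ Set.Ioo (0 : ℝ) 1) :
    ∃ r : ℝ, 0 < r ∧ eulerKernel t = r := by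
  refine ⟨_, ?_, eulerKernel_eq_ofReal ht.1.le ht.2.le⟩
  have h0 := ht.1
  have h1 := sub_pos.2 ht.2
  positivity

theorem intervalIntegrable_hyp {z : ℂ} (hz : z ∈ cutPlane) :
    IntervalIntegrable (fun t : ℝ => eulerKernel t * (1 - z * t) ^ (-(2 / 5) : ℂ)) volume 0 1 := by
  simpa using intervalIntegrable_eulerKernel_mul hz (g := fun t : ℝ => (1 : ℂ))
      (by fun_prop) (-(2 / 5))

theorem one_sub_mem_cutPlane {z : ℂ} : 1 - z ∈ cutPlane ↔ z ∈ Complex.slitPlane := by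
  rw [mem_cutPlane, sub_sub_cancel]

theorem hyp_const_pos : 0 < width / (2 * Real.pi) := by
  have := width_pos
  have := Real.pi_pos
  positivity

theorem hyp_const_cast : (width : ℂ) / (2 * Real.pi) = ((width / (2 * Real.pi) : ℝ) : ℂ) := by
  push_cast; rfl

/-- The product is a double Euler integral whose integrand has positive real part at every pair of
interior points; the positivity is integrated over one variable after the other. This is the source
of `Im τ > 0`. -/
theorem re_hyp_mul_conj_pos {z : ℂ} (hz : z ∈ cutPlane) (hz' : z ∈ Complex.slitPlane) :
    0 < (hyp (1 - z) * (starRingEnd ℂ) (hyp z)).re := by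
  have h1z := one_sub_mem_cutPlane.2 hz'
  have hpt : ∀ s ∈ Set.Ioo (0 : ℝ) 1, ∀ t ∈ Set.Ioo (0 : ℝ) 1,
      0 < ((eulerKernel s * (1 - (1 - z) * s) ^ (-(2 / 5) : ℂ)) *
        (starRingEnd ℂ) (eulerKernel t * (1 - z * t) ^ (-(2 / 5) : ℂ))).re := by
    intro s hs t ht
    obtain ⟨r1, hr1, e1⟩ := eulerKernel_pos hs
    obtain ⟨r2, hr2, e2⟩ := eulerKernel_pos ht
    have h := re_cpow_mul_conj_cpow_pos
      (Complex.slitPlane_ne_zero (one_sub_mul_mem_slitPlane h1z hs.1.le hs.2.le))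
      (Complex.slitPlane_ne_zero (one_sub_mul_mem_slitPlane hz ht.1.le ht.2.le))
      (abs_arg_sub_arg_eulerFactor hz hz' hs ht)
    rw [e1, e2, map_mul, Complex.conj_ofReal]
    have : ∀ x y : ℂ, (((r1 : ℂ) * x) * ((r2 : ℂ) * y)).re = (r1 * r2) * (x * y).re := by
      intro x y
      have : ((r1 : ℂ) * x) * ((r2 : ℂ) * y) = ((r1 * r2 : ℝ) : ℂ) * (x * y) := by push_cast; ring
      rw [this, Complex.re_ofReal_mul]
    rw [this]
    positivity
  set F := ∫ s in (0 : ℝ)..1, eulerKernel s * (1 - (1 - z) * s) ^ (-(2 / 5) : ℂ) with hF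
  set G := ∫ t in (0 : ℝ)..1, eulerKernel t * (1 - z * t) ^ (-(2 / 5) : ℂ) with hG
  have conj_swap : ∀ x y : ℂ, (x * (starRingEnd ℂ) y).re = (y * (starRingEnd ℂ) x).re := by
    intro x y
    simp only [Complex.mul_re, Complex.conj_re, Complex.conj_im]; ring
  have h1 : ∀ t ∈ Set.Ioo (0 : ℝ) 1,
      0 < ((eulerKernel t * (1 - z * t) ^ (-(2 / 5) : ℂ)) * (starRingEnd ℂ) F).re := by
    intro t ht
    rw [conj_swap]
    exact re_integral_mul_pos (intervalIntegrable_hyp h1z) _ fun s hs => hpt s hs t ht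
  have h2 : 0 < (G * (starRingEnd ℂ) F).re :=
    re_integral_mul_pos (intervalIntegrable_hyp hz) _ h1
  rw [hyp, hyp, ← hF, ← hG, hyp_const_cast, conj_swap, map_mul, Complex.conj_ofReal]
  have e : ((width / (2 * Real.pi) : ℝ) : ℂ) * G * (((width / (2 * Real.pi) : ℝ) : ℂ) *
      (starRingEnd ℂ) F) = ((width / (2 * Real.pi) * (width / (2 * Real.pi)) : ℝ) : ℂ) *
        (G * (starRingEnd ℂ) F) := by
    push_cast; ring
  rw [e, Complex.re_ofReal_mul]
  have := hyp_const_pos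
  positivity

/-- On the doubly cut plane a zero contradicts `re_hyp_mul_conj_pos`; on the remaining ray `z ≤ 0`
the integrand itself is positive. -/
theorem hyp_ne_zero {z : ℂ} (hz : z ∈ cutPlane) : hyp z ≠ 0 := by
  by_cases hz' : z ∈ Complex.slitPlane
  · intro h
    have := re_hyp_mul_conj_pos hz hz'
    simp [h] at this
  · have hz'' : z.re ≤ 0 ∧ z.im = 0 := by
      rw [Complex.mem_slitPlane_iff] at hz'
      push Not at hz'
      exact hz'
    have hx : z = (z.re : ℂ) := Complex.ext rfl (by simp [hz''.2])
    have h : 0 < ((∫ t in (0 : ℝ)..1, eulerKernel t * (1 - z * t) ^ (-(2 / 5) : ℂ)) * 1).re := by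
      refine re_integral_mul_pos (intervalIntegrable_hyp hz) 1 fun t ht => ?_
      obtain ⟨r, hr, e⟩ := eulerKernel_pos ht
      have hp : 0 < 1 - z.re * t := by nlinarith [ht.1, hz''.1]
      have : (1 - z * t) ^ (-(2 / 5) : ℂ) = (((1 - z.re * t) ^ (-(2 / 5) : ℝ) : ℝ) : ℂ) := by
        rw [Complex.ofReal_cpow hp.le, hx]
        push_cast
        simp
      rw [e, this, mul_one, ← Complex.ofReal_mul, Complex.ofReal_re]
      positivity
    rw [mul_one] at h
    have hc : (width : ℂ) / (2 * Real.pi) ≠ 0 := by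
      rw [hyp_const_cast]; exact_mod_cast hyp_const_pos.ne'
    rw [hyp]
    refine mul_ne_zero hc fun h0 => ?_
    rw [h0] at h
    simp at h

end HypergeometricEquation

/-! ### The Wronskian of `F(z)` and `F(1 - z)`. -/

section Wronskian

open MeasureTheory

/-- The plane cut along `(-∞, 0]` and `[1, ∞)`. -/
def doubleCutPlane : Set ℂ := cutPlane ∩ Complex.slitPlane

theorem isOpen_doubleCutPlane : IsOpen doubleCutPlane :=
  isOpen_cutPlane.inter Complex.isOpen_slitPlane

theorem one_sub_mem_doubleCutPlane {z : ℂ} (hz : z ∈ doubleCutPlane) : 1 - z ∈ doubleCutPlane :=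
  ⟨one_sub_mem_cutPlane.2 hz.2, hz.1⟩

theorem ofReal_mem_doubleCutPlane {x : ℝ} (h0 : 0 < x) (h1 : x < 1) :
    (x : ℂ) ∈ doubleCutPlane :=
  ⟨ofReal_mem_cutPlane h1, Complex.ofReal_mem_slitPlane.2 h0⟩

theorem mem_doubleCutPlane_of_im_ne_zero {z : ℂ} (h : z.im ≠ 0) : z ∈ doubleCutPlane :=
  ⟨Or.inr (by simpa using h), Or.inr h⟩

theorem isPreconnected_doubleCutPlane : IsPreconnected doubleCutPlane := by
  have h1 : StarConvex ℝ ((1 / 2 : ℝ) : ℂ) Complex.slitPlane :=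
    Complex.starConvex_ofReal_slitPlane (by norm_num)
  have h2 : StarConvex ℝ ((1 / 2 : ℝ) : ℂ) cutPlane := by
    intro z hz a b ha hb hab
    have h := h1 hz ha hb hab
    rw [mem_cutPlane]
    convert h using 1
    have e : (a : ℂ) + b = 1 := by exact_mod_cast hab
    simp only [Complex.real_smul]
    push_cast
    linear_combination -e
  have hm : ((1 / 2 : ℝ) : ℂ) ∈ doubleCutPlane :=
    ofReal_mem_doubleCutPlane (by norm_num) (by norm_num)
  exact ((h2.inter h1).isPathConnected hm).isConnected.isPreconnected

theorem doubleCutPlane_ne {z : ℂ} (hz : z ∈ doubleCutPlane) : z ≠ 0 ∧ 1 - z ≠ 0 :=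
  ⟨Complex.slitPlane_ne_zero hz.2, Complex.slitPlane_ne_zero hz.1⟩

theorem hasDerivAt_hyp_one_sub {z : ℂ} (hz : z ∈ Complex.slitPlane) :
    HasDerivAt (fun z => hyp (1 - z)) (-hypDeriv (1 - z)) z := by
  have h := (hasDerivAt_hyp (one_sub_mem_cutPlane.2 hz)).comp z
    ((hasDerivAt_id z).const_sub 1)
  simpa [Function.comp_def] using h

theorem hasDerivAt_hypDeriv_one_sub {z : ℂ} (hz : z ∈ Complex.slitPlane) :
    HasDerivAt (fun z => hypDeriv (1 - z)) (-hypDeriv₂ (1 - z)) z := by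
  have h := (hasDerivAt_hypDeriv (one_sub_mem_cutPlane.2 hz)).comp z
    ((hasDerivAt_id z).const_sub 1)
  simpa [Function.comp_def] using h

/-- `z (1 - z)` times the Wronskian of `hyp z` and `hyp (1 - z)`. -/
def hypWronskian (z : ℂ) : ℂ :=
  z * (1 - z) * (-hypDeriv (1 - z) * hyp z - hyp (1 - z) * hypDeriv z)

theorem hasDerivAt_hypWronskian {z : ℂ} (hz : z ∈ doubleCutPlane) :
    HasDerivAt hypWronskian 0 z := by
  have h1 := hasDerivAt_hyp hz.1
  have h2 := hasDerivAt_hypDeriv hz.1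
  have h3 := hasDerivAt_hyp_one_sub hz.2
  have h4 := hasDerivAt_hypDeriv_one_sub hz.2
  have h5 : HasDerivAt (fun z : ℂ => z * (1 - z)) (1 * (1 - z) + z * (-1)) z :=
    (hasDerivAt_id z).mul ((hasDerivAt_id z).const_sub 1)
  have h := h5.mul ((h4.neg.mul h1).sub (h3.mul h2))
  refine HasDerivAt.congr_deriv h ?_
  have o1 := hyp_ode hz.1
  have o2 := hyp_ode (one_sub_mem_cutPlane.2 hz.2)
  simp only [Pi.mul_apply, Pi.sub_apply, Pi.neg_apply]
  linear_combination hyp z * o2 - hyp (1 - z) * o1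

/-- Integration by parts trades the exponent `-7/5` for `-2/5` and an extra factor `1 - t`. The
right-hand side therefore has a limit at `z = 1`, which is needed to evaluate the Wronskian. -/
theorem one_sub_mul_hypDeriv {z : ℂ} (hz : z ∈ cutPlane) :
    (1 - z) * hypDeriv z = (width / (2 * Real.pi)) * (3 / 5 *
      ∫ t in (0 : ℝ)..1, (eulerKernel t * (1 - t)) * (1 - z * t) ^ (-(2 / 5) : ℂ)) := by
  have h0 := integral_eulerPrimitive hz (-(2 / 5))
  have i1 := intervalIntegrable_eulerKernel_mul hz (g := fun t : ℝ => (1 - t : ℂ))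
    (by fun_prop) (-(2 / 5))
  have i2 := intervalIntegrable_eulerKernel_mul hz (g := fun t : ℝ => (2 / 5 * t : ℂ))
    (by fun_prop) (-(7 / 5))
  have key : ∫ t in (0 : ℝ)..1, (eulerKernel t * ((3 / 5 - t) * (1 - z * t) -
      (-(2 / 5)) * z * (t * (1 - t)))) * (1 - z * t) ^ (-(2 / 5) - 1 : ℂ) =
      3 / 5 * (∫ t in (0 : ℝ)..1, (eulerKernel t * (1 - t)) * (1 - z * t) ^ (-(2 / 5) : ℂ)) -
      (1 - z) * ∫ t in (0 : ℝ)..1, (eulerKernel t * (2 / 5 * t)) *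
        (1 - z * t) ^ (-(7 / 5) : ℂ) := by
    rw [← intervalIntegral.integral_const_mul, ← intervalIntegral.integral_const_mul,
      ← intervalIntegral.integral_sub (i1.const_mul _) (i2.const_mul _)]
    refine intervalIntegral.integral_congr fun t ht => ?_
    rw [Set.uIcc_of_le zero_le_one] at ht
    have hX := Complex.slitPlane_ne_zero (one_sub_mul_mem_slitPlane hz ht.1 ht.2)
    have e2 : (1 - z * t) ^ (-(2 / 5) : ℂ) = (1 - z * t) * (1 - z * t) ^ (-(7 / 5) : ℂ) :=
      cpow_eq_mul_cpow hX (by norm_num)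
    have e3 : (-(2 / 5) : ℂ) - 1 = -(7 / 5) := by norm_num
    rw [e3, e2]
    ring
  rw [key] at h0
  rw [hypDeriv]
  linear_combination -((width : ℂ) / (2 * Real.pi)) * h0

theorem eulerKernel_one : eulerKernel 1 = 0 := by
  simp [eulerKernel]

theorem norm_one_sub_mul_cpow {x t : ℝ} (hx : x < 1) (ht0 : 0 ≤ t) (ht1 : t ≤ 1) (c : ℝ) :
    ‖(1 - (x : ℂ) * t) ^ (c : ℂ)‖ = (1 - x * t) ^ c := by
  have h : 0 < 1 - x * t := by
    rcases eq_or_lt_of_le ht0 with rfl | h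
    · simp
    · nlinarith [mul_lt_mul_of_pos_right hx h]
  have e : 1 - (x : ℂ) * t = ((1 - x * t : ℝ) : ℂ) := by push_cast; rfl
  rw [e, Complex.norm_cpow_eq_rpow_re_of_pos h, Complex.ofReal_re]

/-- Dominated convergence: the integrand of `F(1 - x)` is at most `x ^ (-2/5)` times the kernel, and
`x ^ (3/5) ≤ 1`. -/
theorem tendsto_mul_hyp_one_sub :
    Tendsto (fun x : ℝ => (x : ℂ) * hyp (1 - x)) (𝓝[>] 0) (𝓝 0) := by
  have hmem : ∀ᶠ x : ℝ in 𝓝[>] 0, x ∈ Set.Ioo (0 : ℝ) 1 := Ioo_mem_nhdsGT one_pos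
  have h : Tendsto (fun x : ℝ => ∫ t in (0 : ℝ)..1, x *
      (eulerKernel t * (1 - (1 - x) * t) ^ (-(2 / 5) : ℂ)))
      (𝓝[>] 0) (𝓝 (∫ t in (0 : ℝ)..1, (0 : ℂ))) := by
    refine intervalIntegral.tendsto_integral_filter_of_dominated_convergence
      (fun t => ‖eulerKernel t‖) ?_ ?_ intervalIntegrable_eulerKernel.norm ?_
    · filter_upwards [hmem] with x hx
      have := (intervalIntegrable_hyp (z := ((1 - x : ℝ) : ℂ))
        (ofReal_mem_cutPlane (by linarith [hx.1]))).const_mul (x : ℂ)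
      push_cast at this
      exact this.def'.aestronglyMeasurable
    · filter_upwards [hmem] with x hx
      refine Eventually.of_forall fun t ht => ?_
      rw [Set.uIoc_of_le zero_le_one] at ht
      have hx0 := hx.1
      have hx1 := hx.2
      have e1 : ‖(1 - (1 - (x : ℂ)) * t) ^ (-(2 / 5) : ℂ)‖ = (1 - (1 - x) * t) ^ (-(2 / 5) : ℝ) := by
        have := norm_one_sub_mul_cpow (x := 1 - x) (by linarith) ht.1.le ht.2 (-(2 / 5))
        push_cast at this
        exact this
      rw [norm_mul, norm_mul, e1, Complex.norm_real, Real.norm_of_nonneg hx0.le]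
      have h2 : (1 - (1 - x) * t) ^ (-(2 / 5) : ℝ) ≤ x ^ (-(2 / 5) : ℝ) :=
        Real.rpow_le_rpow_of_nonpos hx0 (by nlinarith [ht.2]) (by norm_num)
      have h3 : x * x ^ (-(2 / 5) : ℝ) ≤ 1 := by
        have : x * x ^ (-(2 / 5) : ℝ) = x ^ (3 / 5 : ℝ) := by
          nth_rewrite 1 [← Real.rpow_one x]
          rw [← Real.rpow_add hx0]; norm_num
        rw [this]
        exact Real.rpow_le_one hx0.le hx1.le (by norm_num)
      calc x * (‖eulerKernel t‖ * (1 - (1 - x) * t) ^ (-(2 / 5) : ℝ))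
          ≤ x * (‖eulerKernel t‖ * x ^ (-(2 / 5) : ℝ)) := by gcongr
        _ = ‖eulerKernel t‖ * (x * x ^ (-(2 / 5) : ℝ)) := by ring
        _ ≤ ‖eulerKernel t‖ * 1 := by gcongr
        _ = _ := mul_one _
    · refine Eventually.of_forall fun t ht => ?_
      rw [Set.uIoc_of_le zero_le_one] at ht
      rcases eq_or_lt_of_le ht.2 with rfl | ht1
      · simp [eulerKernel_one]
      · refine Tendsto.mono_left ?_ nhdsWithin_le_nhds
        have hc : ContinuousAt (fun x : ℝ => (x : ℂ) *
            (eulerKernel t * (1 - (1 - (x : ℂ)) * t) ^ (-(2 / 5) : ℂ))) 0 := by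
          refine ContinuousAt.mul (by fun_prop) (continuousAt_const.mul
            (ContinuousAt.cpow (by fun_prop) continuousAt_const ?_))
          have : (1 - (1 - ((0 : ℝ) : ℂ)) * t) = ((1 - t : ℝ) : ℂ) := by push_cast; ring
          rw [this]
          exact Complex.ofReal_mem_slitPlane.2 (by linarith)
        have := hc.tendsto
        simpa using this
  rw [intervalIntegral.integral_zero] at h
  have h' := h.const_mul ((width : ℂ) / (2 * Real.pi))
  rw [mul_zero] at h'
  refine h'.congr fun x => ?_
  rw [intervalIntegral.integral_const_mul, hyp]
  ring

/-- By `one_sub_mul_hypDeriv` and dominated convergence. In the limit the powers of `1 - t` cancel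
and `t ^ (-2/5)` remains, whose integral `5/3` cancels the prefactor `3/5`. -/
theorem tendsto_mul_hypDeriv_one_sub :
    Tendsto (fun x : ℝ => (x : ℂ) * hypDeriv (1 - x)) (𝓝[>] 0) (𝓝 (width / (2 * Real.pi))) := by
  have hmem : ∀ᶠ x : ℝ in 𝓝[>] 0, x ∈ Set.Ioo (0 : ℝ) 1 := Ioo_mem_nhdsGT one_pos
  have h : Tendsto (fun x : ℝ => ∫ t in (0 : ℝ)..1,
      (eulerKernel t * (1 - t)) * (1 - (1 - x) * t) ^ (-(2 / 5) : ℂ))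
      (𝓝[>] 0) (𝓝 (∫ t in (0 : ℝ)..1, (t : ℂ) ^ (-(2 / 5) : ℂ))) := by
    refine intervalIntegral.tendsto_integral_filter_of_dominated_convergence
      (fun t => ‖eulerKernel t‖) ?_ ?_ intervalIntegrable_eulerKernel.norm ?_
    · filter_upwards [hmem] with x hx
      have := (intervalIntegrable_eulerKernel_mul (z := ((1 - x : ℝ) : ℂ))
        (ofReal_mem_cutPlane (by linarith [hx.1])) (g := fun t : ℝ => (1 - t : ℂ))
        (by fun_prop) (-(2 / 5)))
      push_cast at this
      exact this.def'.aestronglyMeasurable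
    · filter_upwards [hmem] with x hx
      refine Eventually.of_forall fun t ht => ?_
      rw [Set.uIoc_of_le zero_le_one] at ht
      rcases eq_or_lt_of_le ht.2 with rfl | ht1
      · simp [eulerKernel_one]
      have hx0 := hx.1
      have hx1 := hx.2
      have hs : 0 < 1 - t := by linarith
      have e1 : ‖(1 - (1 - (x : ℂ)) * t) ^ (-(2 / 5) : ℂ)‖ = (1 - (1 - x) * t) ^ (-(2 / 5) : ℝ) := by
        have := norm_one_sub_mul_cpow (x := 1 - x) (by linarith) ht.1.le ht.2 (-(2 / 5))
        push_cast at this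
        exact this
      have e2 : ‖(1 - (t : ℂ))‖ = 1 - t := by
        rw [← Complex.ofReal_one, ← Complex.ofReal_sub, Complex.norm_real,
          Real.norm_of_nonneg hs.le]
      rw [norm_mul, norm_mul, e1, e2]
      have h2 : (1 - (1 - x) * t) ^ (-(2 / 5) : ℝ) ≤ (1 - t) ^ (-(2 / 5) : ℝ) :=
        Real.rpow_le_rpow_of_nonpos hs (by nlinarith [ht.1]) (by norm_num)
      have h3 : (1 - t) * (1 - t) ^ (-(2 / 5) : ℝ) ≤ 1 := by
        have : (1 - t) * (1 - t) ^ (-(2 / 5) : ℝ) = (1 - t) ^ (3 / 5 : ℝ) := by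
          nth_rewrite 1 [← Real.rpow_one (1 - t)]
          rw [← Real.rpow_add hs]; norm_num
        rw [this]
        exact Real.rpow_le_one hs.le (by linarith [ht.1]) (by norm_num)
      calc ‖eulerKernel t‖ * (1 - t) * (1 - (1 - x) * t) ^ (-(2 / 5) : ℝ)
          ≤ ‖eulerKernel t‖ * (1 - t) * (1 - t) ^ (-(2 / 5) : ℝ) := by gcongr
        _ = ‖eulerKernel t‖ * ((1 - t) * (1 - t) ^ (-(2 / 5) : ℝ)) := by ring
        _ ≤ ‖eulerKernel t‖ * 1 := by gcongr
        _ = _ := mul_one _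
    · have hne : ∀ᵐ t : ℝ, t ≠ 1 := by
        rw [ae_iff]
        simp
      filter_upwards [hne] with t ht' ht
      rw [Set.uIoc_of_le zero_le_one] at ht
      have ht1 : t < 1 := lt_of_le_of_ne ht.2 ht'
      have hs : ((1 - t : ℝ) : ℂ) ∈ Complex.slitPlane :=
        Complex.ofReal_mem_slitPlane.2 (by linarith)
      refine Tendsto.mono_left ?_ nhdsWithin_le_nhds
      have hc : ContinuousAt (fun x : ℝ =>
          (eulerKernel t * (1 - t)) * (1 - (1 - (x : ℂ)) * t) ^ (-(2 / 5) : ℂ)) 0 := by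
        refine continuousAt_const.mul (ContinuousAt.cpow (by fun_prop) continuousAt_const ?_)
        have : (1 - (1 - ((0 : ℝ) : ℂ)) * t) = ((1 - t : ℝ) : ℂ) := by push_cast; ring
        rw [this]
        exact hs
      have hl := hc.tendsto
      convert hl using 2
      have hs0 : (1 - (t : ℂ)) ≠ 0 := by
        have := Complex.slitPlane_ne_zero hs
        push_cast at this
        exact this
      have e1 : (1 - (t : ℂ)) ^ (-(2 / 5) : ℂ) * (1 - (t : ℂ)) ^ (-(3 / 5) : ℂ) *
          (1 - (t : ℂ)) = 1 := by
        rw [← Complex.cpow_add _ _ hs0]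
        norm_num
        rw [Complex.cpow_neg_one, inv_mul_cancel₀ hs0]
      have e0 : (1 - (1 - ((0 : ℝ) : ℂ)) * t) = 1 - t := by push_cast; ring
      rw [e0, eulerKernel]
      linear_combination -(t : ℂ) ^ (-(2 / 5) : ℂ) * e1
  have hval : ∫ t in (0 : ℝ)..1, (t : ℂ) ^ (-(2 / 5) : ℂ) = 5 / 3 := by
    rw [integral_cpow (Or.inl (by norm_num))]
    have h1 : (-(2 / 5) + 1 : ℂ) = 3 / 5 := by norm_num
    have h2 : (3 / 5 : ℂ) ≠ 0 := by norm_num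
    rw [h1]
    simp
  rw [hval] at h
  have h' := (h.const_mul (3 / 5)).const_mul ((width : ℂ) / (2 * Real.pi))
  have e : (width : ℂ) / (2 * Real.pi) * (3 / 5 * (5 / 3)) = width / (2 * Real.pi) := by ring
  rw [e] at h'
  refine h'.congr' ?_
  filter_upwards [hmem] with x hx
  have := one_sub_mul_hypDeriv (z := ((1 - x : ℝ) : ℂ)) (ofReal_mem_cutPlane (by linarith [hx.1]))
  push_cast at this
  rw [sub_sub_cancel] at this
  rw [this]

/-- It is constant by the differential equation. As `z` tends to `0` along the positive reals only
the term `-z F'(1 - z) F(z)` survives, and it gives the value. -/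
theorem hypWronskian_eq {z : ℂ} (hz : z ∈ doubleCutPlane) :
    hypWronskian z = -(width / (2 * Real.pi)) := by
  obtain ⟨a, ha⟩ := isOpen_doubleCutPlane.exists_is_const_of_deriv_eq_zero
    isPreconnected_doubleCutPlane
    (fun z hz => (hasDerivAt_hypWronskian hz).differentiableAt.differentiableWithinAt)
    (fun z hz => (hasDerivAt_hypWronskian hz).deriv)
  have hmem : ∀ᶠ x : ℝ in 𝓝[>] 0, x ∈ Set.Ioo (0 : ℝ) 1 := Ioo_mem_nhdsGT one_pos
  have h1 : Tendsto (fun x : ℝ => hypWronskian x) (𝓝[>] 0) (𝓝 a) := by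
    refine tendsto_const_nhds.congr' ?_
    filter_upwards [hmem] with x hx
    exact (ha x (ofReal_mem_doubleCutPlane hx.1 hx.2)).symm
  have c0 : Tendsto (fun x : ℝ => (x : ℂ)) (𝓝[>] 0) (𝓝 0) := by
    have : Continuous fun x : ℝ => (x : ℂ) := by fun_prop
    simpa using (this.tendsto 0).mono_left nhdsWithin_le_nhds
  have c1 : Tendsto (fun x : ℝ => hyp x) (𝓝[>] 0) (𝓝 1) := by
    rw [← hyp_zero]
    exact (hasDerivAt_hyp zero_mem_cutPlane).continuousAt.tendsto.comp c0
  have c2 : Tendsto (fun x : ℝ => hypDeriv x) (𝓝[>] 0) (𝓝 (hypDeriv 0)) :=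
    (hasDerivAt_hypDeriv zero_mem_cutPlane).continuousAt.tendsto.comp c0
  have h2 : Tendsto (fun x : ℝ => hypWronskian x) (𝓝[>] 0)
      (𝓝 ((1 - 0) * (-(width / (2 * Real.pi)) * 1 - 0 * hypDeriv 0))) := by
    refine ((c0.const_sub 1).mul ((tendsto_mul_hypDeriv_one_sub.neg.mul c1).sub
      (tendsto_mul_hyp_one_sub.mul c2))).congr fun x => ?_
    rw [hypWronskian]
    ring
  rw [ha z hz, tendsto_nhds_unique h1 h2]
  ring

end Wronskian

/-! ### The period ratio and the nome. -/

section Nome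

open MeasureTheory

/-- The inverse of the Hauptmodul `z` on the doubly cut plane: the ratio of the two periods. -/
def hypTau (z : ℂ) : ℂ := Complex.I * hyp (1 - z) / hyp z

theorem hypTau_im_pos {z : ℂ} (hz : z ∈ doubleCutPlane) : 0 < (hypTau z).im := by
  have h := re_hyp_mul_conj_pos hz.1 hz.2
  have h0 := hyp_ne_zero hz.1
  have e : hypTau z = ((Complex.normSq (hyp z))⁻¹ : ℝ) *
      (Complex.I * (hyp (1 - z) * (starRingEnd ℂ) (hyp z))) := by
    rw [hypTau, div_eq_mul_inv, Complex.inv_def]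
    ring
  rw [e, Complex.im_ofReal_mul, Complex.I_mul_im]
  have := Complex.normSq_pos.2 h0
  positivity

theorem hypTau_one_sub {z : ℂ} (hz : z ∈ doubleCutPlane) : hypTau (1 - z) = -(hypTau z)⁻¹ := by
  have h0 := hyp_ne_zero hz.1
  have h1 := hyp_ne_zero (one_sub_mem_doubleCutPlane hz).1
  rw [hypTau, hypTau, sub_sub_cancel]
  field_simp
  rw [Complex.I_sq]

/-- The numerator in the quotient rule is the constant Wronskian, so the derivative has no zeros. -/
theorem hasDerivAt_hypTau {z : ℂ} (hz : z ∈ doubleCutPlane) :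
    HasDerivAt hypTau (-(Complex.I * (width / (2 * Real.pi))) / (z * (1 - z) * hyp z ^ 2)) z := by
  have h0 := hyp_ne_zero hz.1
  obtain ⟨hz0, hz1⟩ := doubleCutPlane_ne hz
  have h := ((hasDerivAt_hyp_one_sub hz.2).const_mul Complex.I).div (hasDerivAt_hyp hz.1) h0
  refine HasDerivAt.congr_deriv h ?_
  have hw := hypWronskian_eq hz
  rw [hypWronskian] at hw
  rw [div_eq_div_iff (pow_ne_zero 2 h0) (by positivity)]
  linear_combination Complex.I * hyp z ^ 2 * hw

/-- Holomorphic functions on the plane cut along `[1, ∞)` have primitives. -/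
theorem exists_primitive_cutPlane {g : ℂ → ℂ} (hg : DifferentiableOn ℂ g cutPlane) :
    ∃ G : ℂ → ℂ, ∀ z ∈ cutPlane, HasDerivAt G (g z) z := by
  refine ⟨fun z => ∫ t in (0 : ℝ)..1, z * g (z * t), fun z hz => ?_⟩
  have hg' : DifferentiableOn ℂ (deriv g) cutPlane := hg.deriv isOpen_cutPlane
  obtain ⟨ε, hε, hball⟩ := Metric.nhds_basis_closedBall.mem_iff.1 (isOpen_cutPlane.mem_nhds hz)
  have hmem : ∀ y ∈ Metric.closedBall z ε, ∀ t ∈ Set.Icc (0 : ℝ) 1, y * t ∈ cutPlane :=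
    fun y hy t ht => mul_mem_cutPlane (hball hy) ht.1 ht.2
  have hmaps : Set.MapsTo (fun x : ℂ × ℝ => x.1 * (x.2 : ℂ))
      (Metric.closedBall z ε ×ˢ Set.Icc (0 : ℝ) 1) cutPlane := fun x hx => hmem _ hx.1 _ hx.2
  have hcont : ContinuousOn (fun x : ℂ × ℝ => g (x.1 * x.2) + x.1 * x.2 * deriv g (x.1 * x.2))
      (Metric.closedBall z ε ×ˢ Set.Icc (0 : ℝ) 1) :=
    ((hg.continuousOn.comp (by fun_prop) hmaps).add
      (ContinuousOn.mul (by fun_prop) (hg'.continuousOn.comp (by fun_prop) hmaps)))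
  obtain ⟨K, hK⟩ := ((isCompact_closedBall z ε).prod isCompact_Icc).exists_bound_of_continuousOn
    hcont
  have hsec : ∀ y ∈ Metric.closedBall z ε, ∀ k : ℂ → ℂ, ContinuousOn k cutPlane →
      ContinuousOn (fun t : ℝ => k (y * t)) (Set.Icc 0 1) := fun y hy k hk =>
    hk.comp (by fun_prop) fun t ht => hmem y hy t ht
  have hzz := Metric.mem_closedBall_self (x := z) hε.le
  have hsub : Set.uIoc (0 : ℝ) 1 ⊆ Set.Icc 0 1 := by
    rw [Set.uIoc_of_le zero_le_one]; exact Set.Ioc_subset_Icc_self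
  have hintegrable : ∀ k : ℝ → ℂ, ContinuousOn k (Set.Icc 0 1) → IntervalIntegrable k volume 0 1 :=
    fun k hk => ContinuousOn.intervalIntegrable (by rwa [Set.uIcc_of_le zero_le_one])
  have hd : ∀ y ∈ Metric.closedBall z ε, ∀ t ∈ Set.Icc (0 : ℝ) 1,
      HasDerivAt g (deriv g (y * t)) (y * t) := fun y hy t ht =>
    (hg.differentiableAt (isOpen_cutPlane.mem_nhds (hmem y hy t ht))).hasDerivAt
  have hF'c : ContinuousOn (fun t : ℝ => g (z * t) + z * t * deriv g (z * t)) (Set.Icc 0 1) :=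
    (hsec z hzz g hg.continuousOn).add
      (ContinuousOn.mul (by fun_prop) (hsec z hzz _ hg'.continuousOn))
  -- The `z`-derivative of `z g(zt)` equals the `t`-derivative of `t g(zt)`, so it integrates to `g
  -- z`.
  have h := (intervalIntegral.hasDerivAt_integral_of_dominated_loc_of_deriv_le
    (F := fun z (t : ℝ) => z * g (z * t))
    (F' := fun z (t : ℝ) => g (z * t) + z * t * deriv g (z * t))
    (bound := fun t => K) (s := Metric.ball z ε) (a := 0) (b := 1) (μ := volume)
    (Metric.ball_mem_nhds z hε) ?_ ?_ ?_ ?_ ?_ ?_).2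
  · refine HasDerivAt.congr_deriv h ?_
    rw [intervalIntegral.integral_eq_sub_of_hasDerivAt_of_le zero_le_one
      (f := fun t : ℝ => t * g (z * t)) ?_ ?_ (hintegrable _ hF'c)]
    · simp
    · exact ContinuousOn.mul (by fun_prop) (hsec z hzz g hg.continuousOn)
    · intro t ht
      have h1 : HasDerivAt (fun s : ℂ => g (z * s)) (deriv g (z * t) * (z * 1)) t :=
        (hd z hzz t (Set.Ioo_subset_Icc_self ht)).comp (t : ℂ)
          ((hasDerivAt_id (t : ℂ)).const_mul z)
      have h2 := ((hasDerivAt_id (t : ℂ)).mul h1).comp_ofReal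
      refine HasDerivAt.congr_deriv h2 ?_
      simp
      ring
  · filter_upwards [Metric.ball_mem_nhds z hε] with y hy
    exact (hintegrable _ (continuousOn_const.mul (hsec y (Metric.ball_subset_closedBall hy) g
      hg.continuousOn))).def'.aestronglyMeasurable
  · exact hintegrable _ (continuousOn_const.mul (hsec z hzz g hg.continuousOn))
  · exact (hintegrable _ hF'c).def'.aestronglyMeasurable
  · exact Eventually.of_forall fun t ht y hy =>
      hK (y, t) ⟨Metric.ball_subset_closedBall hy, hsub ht⟩
  · exact intervalIntegrable_const
  · refine Eventually.of_forall fun t ht y hy => ?_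
    have h1 : HasDerivAt (fun y : ℂ => g (y * t)) (deriv g (y * t) * (1 * t)) y :=
      (hd y (Metric.ball_subset_closedBall hy) t (hsub ht)).comp y
        ((hasDerivAt_id y).mul_const (t : ℂ))
    refine HasDerivAt.congr_deriv ((hasDerivAt_id y).mul h1) ?_
    simp
    ring

/-- `exp (2 π i τ / width)`, the local parameter at the cusp `i∞`. -/
def cuspParam (τ : ℂ) : ℂ := Complex.exp (2 * Real.pi * Complex.I / width * τ)

theorem norm_cuspParam (τ : ℂ) : ‖cuspParam τ‖ = Real.exp (-(2 * Real.pi / width * τ.im)) := by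
  rw [cuspParam, Complex.norm_exp]
  congr 1
  have : 2 * (Real.pi : ℂ) * Complex.I / width * τ =
      ((2 * Real.pi / width : ℝ) : ℂ) * (Complex.I * τ) := by push_cast; ring
  rw [this, Complex.re_ofReal_mul, Complex.I_mul_re]
  ring

theorem cuspParam_ne_zero (τ : ℂ) : cuspParam τ ≠ 0 := Complex.exp_ne_zero _

theorem norm_cuspParam_lt_one {τ : ℂ} (h : 0 < τ.im) : ‖cuspParam τ‖ < 1 := by
  rw [norm_cuspParam, Real.exp_lt_one_iff]
  have := width_pos
  have := Real.pi_pos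
  have : 0 < 2 * Real.pi / width * τ.im := by positivity
  linarith

theorem hasDerivAt_cuspParam (τ : ℂ) :
    HasDerivAt cuspParam (2 * Real.pi * Complex.I / width * cuspParam τ) τ := by
  have h := ((hasDerivAt_id τ).const_mul (2 * Real.pi * Complex.I / width : ℂ)).cexp
  refine HasDerivAt.congr_deriv h ?_
  simp [cuspParam]
  ring

theorem cuspParam_deriv_ne_zero (τ : ℂ) : 2 * Real.pi * Complex.I / width * cuspParam τ ≠ 0 := by
  have hπ : (Real.pi : ℂ) ≠ 0 := by exact_mod_cast Real.pi_ne_zero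
  exact mul_ne_zero (div_ne_zero (mul_ne_zero (mul_ne_zero two_ne_zero hπ) Complex.I_ne_zero)
    width_ne_zero) (cuspParam_ne_zero τ)

theorem cuspParam_eq_iff {τ τ' : ℂ} : cuspParam τ = cuspParam τ' ↔ ∃ n : ℤ, τ = τ' + n * width := by
  have hπ : (Real.pi : ℂ) ≠ 0 := by exact_mod_cast Real.pi_ne_zero
  have hw := width_ne_zero
  have hI := Complex.I_ne_zero
  rw [cuspParam, cuspParam, Complex.exp_eq_exp_iff_exists_int]
  refine exists_congr fun n => ?_
  constructor
  · intro h
    field_simp at h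
    linear_combination h
  · intro h
    rw [h]
    field_simp

theorem exists_cuspParam_eq {q : ℂ} (h0 : q ≠ 0) (h1 : ‖q‖ < 1) :
    ∃ τ : ℂ, 0 < τ.im ∧ cuspParam τ = q := by
  have hπ : (Real.pi : ℂ) ≠ 0 := by exact_mod_cast Real.pi_ne_zero
  have hw := width_ne_zero
  have hI := Complex.I_ne_zero
  have e : cuspParam (width / (2 * Real.pi * Complex.I) * Complex.log q) = q := by
    rw [cuspParam]
    have : 2 * Real.pi * Complex.I / width * (width / (2 * Real.pi * Complex.I) * Complex.log q) =
      Complex.log q := by field_simp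
    rw [this, Complex.exp_log h0]
  refine ⟨_, ?_, e⟩
  by_contra hn
  push Not at hn
  rw [← e, norm_cuspParam, Real.exp_lt_one_iff] at h1
  have := width_pos
  have := Real.pi_pos
  have : 0 ≤ 2 * Real.pi / width := by positivity
  nlinarith

/-- The function `q = exp (2 π i τ / width)` in terms of `z`: it extends the function
`cuspParam ∘ hypTau` to the plane cut along `[1, ∞)`. -/
theorem exists_nome : ∃ Q : ℂ → ℂ, Q 0 = 0 ∧ (∀ z ∈ cutPlane, z ≠ 0 → Q z ≠ 0) ∧
    (∀ z ∈ cutPlane, DifferentiableAt ℂ Q z ∧ deriv Q z ≠ 0) ∧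
    ∀ z ∈ doubleCutPlane, Q z = cuspParam (hypTau z) := by
  -- The logarithmic derivative of `q` is `1 / (z (1 - z) F²)`, with residue `1` at `z = 0` since
  -- `F(0) = 1`. Subtracting `1 / z` leaves `N / (z (1 - z) F²)`, which is holomorphic because `N(0)
  -- = 0`. With a primitive `G` of it, `q` is a constant times `z exp(G)`.
  set N : ℂ → ℂ := fun z => 1 - (1 - z) * hyp z ^ 2 with hN
  have hNd : DifferentiableOn ℂ N cutPlane := by
    have := differentiableOn_hyp
    fun_prop
  have hNs : DifferentiableOn ℂ (dslope N 0) cutPlane :=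
    (Complex.differentiableOn_dslope (isOpen_cutPlane.mem_nhds zero_mem_cutPlane)).2 hNd
  have hden : ∀ z ∈ cutPlane, (1 - z) * hyp z ^ 2 ≠ 0 := fun z hz =>
    mul_ne_zero (Complex.slitPlane_ne_zero hz) (pow_ne_zero 2 (hyp_ne_zero hz))
  have hgd : DifferentiableOn ℂ (fun z => dslope N 0 z / ((1 - z) * hyp z ^ 2)) cutPlane := by
    refine hNs.div ?_ hden
    have := differentiableOn_hyp
    fun_prop
  obtain ⟨G, hG⟩ := exists_primitive_cutPlane hgd
  have hder : ∀ z ∈ cutPlane, HasDerivAt (fun z => z * Complex.exp (G z))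
      (Complex.exp (G z) / ((1 - z) * hyp z ^ 2)) z := by
    intro z hz
    have h := (hasDerivAt_id z).mul (hG z hz).cexp
    refine HasDerivAt.congr_deriv h ?_
    have h1 := hden z hz
    have h2 : z * dslope N 0 z = N z := by
      have := sub_smul_dslope N 0 z
      simp only [sub_zero, smul_eq_mul] at this
      rw [this]
      simp [hN, hyp_zero]
    have h1a : 1 - z ≠ 0 := Complex.slitPlane_ne_zero hz
    have h1b := hyp_ne_zero hz
    simp only [id, one_mul]
    rw [eq_div_iff h1, add_mul]
    have h3 : z * (Complex.exp (G z) * (dslope N 0 z / ((1 - z) * hyp z ^ 2))) *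
        ((1 - z) * hyp z ^ 2) = Complex.exp (G z) * (z * dslope N 0 z) := by
      field_simp
    rw [h3, h2, hN]
    ring
  obtain ⟨A, hA⟩ := isOpen_doubleCutPlane.exists_is_const_of_deriv_eq_zero
    isPreconnected_doubleCutPlane
    (f := fun z => cuspParam (hypTau z) / (z * Complex.exp (G z)))
    (fun z hz => by
      have h0 : z * Complex.exp (G z) ≠ 0 :=
        mul_ne_zero (doubleCutPlane_ne hz).1 (Complex.exp_ne_zero _)
      exact (((hasDerivAt_cuspParam _).comp z (hasDerivAt_hypTau hz)).div (hder z hz.1)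
        h0).differentiableAt.differentiableWithinAt)
    (fun z hz => by
      have h0 : z * Complex.exp (G z) ≠ 0 :=
        mul_ne_zero (doubleCutPlane_ne hz).1 (Complex.exp_ne_zero _)
      have h := ((hasDerivAt_cuspParam _).comp z (hasDerivAt_hypTau hz)).div (hder z hz.1) h0
      refine h.deriv.trans ?_
      have hπ : (Real.pi : ℂ) ≠ 0 := by exact_mod_cast Real.pi_ne_zero
      have hw := width_ne_zero
      have hf := hyp_ne_zero hz.1
      obtain ⟨hz0, hz1⟩ := doubleCutPlane_ne hz
      simp only [Function.comp_apply, Pi.zero_apply]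
      rw [div_eq_zero_iff]
      left
      field_simp
      rw [Complex.I_sq]
      ring)
  have hA' : ∀ z ∈ doubleCutPlane, cuspParam (hypTau z) = A * (z * Complex.exp (G z)) := by
    intro z hz
    have h0 : z * Complex.exp (G z) ≠ 0 :=
      mul_ne_zero (doubleCutPlane_ne hz).1 (Complex.exp_ne_zero _)
    rw [← hA z hz]
    exact (div_mul_cancel₀ _ h0).symm
  have hA0 : A ≠ 0 := by
    rintro rfl
    have := hA' _ (ofReal_mem_doubleCutPlane (x := 1 / 2) (by norm_num) (by norm_num))
    rw [zero_mul] at this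
    exact cuspParam_ne_zero _ this
  refine ⟨fun z => A * (z * Complex.exp (G z)), by simp, fun z _ h0 =>
    mul_ne_zero hA0 (mul_ne_zero h0 (Complex.exp_ne_zero _)), fun z hz => ?_, fun z hz =>
    (hA' z hz).symm⟩
  have h := (hder z hz).const_mul A
  refine ⟨h.differentiableAt, ?_⟩
  rw [h.deriv]
  exact mul_ne_zero hA0 (div_ne_zero (Complex.exp_ne_zero _) (hden z hz))

/-- The function `q = exp (2 π i τ / width)` in terms of `z`, on the plane cut along `[1, ∞)`. -/
def nome : ℂ → ℂ := exists_nome.choose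

theorem nome_zero : nome 0 = 0 := exists_nome.choose_spec.1

theorem nome_ne_zero {z : ℂ} (hz : z ∈ cutPlane) (h : z ≠ 0) : nome z ≠ 0 :=
  exists_nome.choose_spec.2.1 z hz h

theorem differentiableAt_nome {z : ℂ} (hz : z ∈ cutPlane) : DifferentiableAt ℂ nome z :=
  (exists_nome.choose_spec.2.2.1 z hz).1

theorem deriv_nome_ne_zero {z : ℂ} (hz : z ∈ cutPlane) : deriv nome z ≠ 0 :=
  (exists_nome.choose_spec.2.2.1 z hz).2

theorem nome_eq {z : ℂ} (hz : z ∈ doubleCutPlane) : nome z = cuspParam (hypTau z) :=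
  exists_nome.choose_spec.2.2.2 z hz

theorem cutPlane_subset_closure : cutPlane ⊆ closure doubleCutPlane := by
  intro z hz
  by_cases h : z ∈ Complex.slitPlane
  · exact subset_closure ⟨hz, h⟩
  · have him : z.im = 0 := by
      rw [Complex.mem_slitPlane_iff] at h
      push Not at h
      exact h.2
    have hl : Tendsto (fun n : ℕ => z + ((1 / ((n : ℝ) + 1) : ℝ) : ℂ) * Complex.I) atTop
        (𝓝 (z + ((0 : ℝ) : ℂ) * Complex.I)) :=
      tendsto_const_nhds.add (((Complex.continuous_ofReal.tendsto 0).comp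
        tendsto_one_div_add_atTop_nhds_zero_nat).mul_const _)
    simp only [Complex.ofReal_zero, zero_mul, add_zero] at hl
    refine mem_closure_of_tendsto hl (Eventually.of_forall fun n => ?_)
    apply mem_doubleCutPlane_of_im_ne_zero
    have : (0 : ℝ) < 1 / ((n : ℝ) + 1) := by positivity
    rw [Complex.add_im, Complex.im_ofReal_mul, Complex.I_im, him]
    linarith

/-- The bound is strict where `q` comes from a point of `ℍ`, and weak on the remaining cut by
density. The maximum principle makes it strict everywhere, as the nome vanishes at `0`. -/
theorem norm_nome_lt_one {z : ℂ} (hz : z ∈ cutPlane) : ‖nome z‖ < 1 := by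
  have hle : ∀ z ∈ cutPlane, ‖nome z‖ ≤ 1 := by
    intro z hz
    obtain ⟨x, hx, hxz⟩ := mem_closure_iff_seq_limit.1 (cutPlane_subset_closure hz)
    refine le_of_tendsto ((differentiableAt_nome hz).continuousAt.norm.tendsto.comp hxz)
      (Eventually.of_forall fun n => ?_)
    show ‖nome (x n)‖ ≤ 1
    rw [nome_eq (hx n)]
    exact (norm_cuspParam_lt_one (hypTau_im_pos (hx n))).le
  refine lt_of_le_of_ne (hle z hz) fun h => ?_
  have := Complex.norm_eqOn_of_isPreconnected_of_isMaxOn isPreconnected_cutPlane isOpen_cutPlane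
    (f := nome) (fun y hy => (differentiableAt_nome hy).differentiableWithinAt) hz
    (fun y hy => by simpa [h] using hle y hy) zero_mem_cutPlane
  simp [nome_zero, h] at this

end Nome

/-! ### The triangle group as a group of matrices. -/

section TriangleGroup

/-- The translation by `width`, as a matrix. -/
def tMat : SL(2, ℝ) := ⟨!![1, width; 0, 1], by simp⟩

/-- The parabolic generator fixing the cusp `0`, as a matrix. -/
def uMat : SL(2, ℝ) := ⟨!![1, 0; -width, 1], by simp⟩

/-- The inversion `τ ↦ -1 / τ`, as a matrix. -/
def sMat : SL(2, ℝ) := ⟨!![0, -1; 1, 0], by simp⟩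

/-- The subgroup of `SL(2, ℝ)` generated by the two parabolic generators. -/
def Γs : Subgroup SL(2, ℝ) := Subgroup.closure {tMat, uMat}

theorem tMat_mem : tMat ∈ Γs := Subgroup.subset_closure (by simp)

theorem uMat_mem : uMat ∈ Γs := Subgroup.subset_closure (by simp)

theorem uMat_eq : uMat = sMat * tMat * sMat⁻¹ := by
  rw [eq_mul_inv_iff_mul_eq]
  apply Subtype.ext
  rw [Matrix.SpecialLinearGroup.coe_mul, Matrix.SpecialLinearGroup.coe_mul]
  ext i j
  fin_cases i <;> fin_cases j <;> simp [uMat, sMat, tMat]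

theorem sMat_mul_self : sMat * sMat = -1 := by
  apply Subtype.ext
  rw [Matrix.SpecialLinearGroup.coe_mul]
  ext i j
  fin_cases i <;> fin_cases j <;> simp [sMat]

theorem sMat_inv : (sMat⁻¹ : SL(2, ℝ)) = -sMat := by
  rw [inv_eq_iff_mul_eq_one, mul_neg, sMat_mul_self, neg_neg]

theorem Γ_eq_map : Γ = Γs.map (QuotientGroup.mk' (Subgroup.center SL(2, ℝ))) := by
  rw [Γs, MonoidHom.map_closure, Set.image_pair]
  rfl

theorem mk_smul (M : SL(2, ℝ)) (τ : ℍ) :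
    (QuotientGroup.mk M : Matrix.ProjectiveSpecialLinearGroup (Fin 2) ℝ) • τ = M • τ := rfl

theorem exists_mem_Γ_smul_iff {τ τ' : ℍ} : (∃ γ ∈ Γ, γ • τ = τ') ↔ ∃ M ∈ Γs, M • τ = τ' := by
  rw [Γ_eq_map]
  constructor
  · rintro ⟨_, ⟨M, hM, rfl⟩, h⟩
    exact ⟨M, hM, h⟩
  · rintro ⟨M, hM, h⟩
    exact ⟨_, ⟨M, hM, rfl⟩, h⟩

/-- The Möbius transformation defined by a matrix. -/
def mob (M : SL(2, ℝ)) (x : ℂ) : ℂ := ((M 0 0 : ℝ) * x + (M 0 1 : ℝ)) / ((M 1 0 : ℝ) * x + (M 1 1 : ℝ))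

theorem mob_coe (M : SL(2, ℝ)) (τ : ℍ) : mob M τ = ↑(M • τ) := by
  rw [UpperHalfPlane.specialLinearGroup_apply]
  simp [mob]

theorem mob_im_pos (M : SL(2, ℝ)) {x : ℂ} (hx : 0 < x.im) : 0 < (mob M x).im := by
  have := mob_coe M ⟨x, hx⟩
  simp only at this
  rw [this]
  exact (M • (⟨x, hx⟩ : ℍ)).im_pos

theorem mob_mul (M N : SL(2, ℝ)) {x : ℂ} (hx : 0 < x.im) : mob (M * N) x = mob M (mob N x) := by
  have h1 := mob_coe N ⟨x, hx⟩
  have h2 := mob_coe (M * N) ⟨x, hx⟩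
  simp only at h1 h2
  rw [h1, h2, mob_coe, mul_smul]

theorem mob_one (x : ℂ) : mob 1 x = x := by simp [mob]

theorem mob_inv_mob (M : SL(2, ℝ)) {x : ℂ} (hx : 0 < x.im) : mob M⁻¹ (mob M x) = x := by
  rw [← mob_mul _ _ hx, inv_mul_cancel, mob_one]

theorem mob_denom_ne_zero (M : SL(2, ℝ)) {x : ℂ} (hx : 0 < x.im) :
    ((M 1 0 : ℝ) * x + (M 1 1 : ℝ) : ℂ) ≠ 0 := by
  intro h
  have h1 : (M 1 0 : ℝ) = 0 := by
    have := congrArg Complex.im h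
    simp at this
    exact this.resolve_right hx.ne'
  have h2 : (M 1 1 : ℝ) = 0 := by
    have := congrArg Complex.re h
    simpa [h1] using this
  have := M.det_coe
  rw [Matrix.det_fin_two, h1, h2] at this
  simp at this

theorem hasDerivAt_mob (M : SL(2, ℝ)) {x : ℂ} (hx : 0 < x.im) :
    HasDerivAt (mob M) (1 / ((M 1 0 : ℝ) * x + (M 1 1 : ℝ)) ^ 2) x := by
  have h0 := mob_denom_ne_zero M hx
  have h := (((hasDerivAt_id x).const_mul ((M 0 0 : ℝ) : ℂ)).add_const ((M 0 1 : ℝ) : ℂ)).div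
    (((hasDerivAt_id x).const_mul ((M 1 0 : ℝ) : ℂ)).add_const ((M 1 1 : ℝ) : ℂ)) h0
  refine HasDerivAt.congr_deriv h ?_
  have hd : ((M 0 0 : ℝ) : ℂ) * (M 1 1 : ℝ) - (M 0 1 : ℝ) * (M 1 0 : ℝ) = 1 := by
    have := M.det_coe
    rw [Matrix.det_fin_two] at this
    exact_mod_cast this
  simp only [id]
  congr 1
  linear_combination hd

theorem analyticAt_mob (M : SL(2, ℝ)) {x : ℂ} (hx : 0 < x.im) : AnalyticAt ℂ (mob M) x := by
  have h0 := mob_denom_ne_zero M hx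
  unfold mob
  fun_prop (disch := assumption)

theorem mob_tMat (x : ℂ) : mob tMat x = x + width := by simp [mob, tMat]

theorem mob_tMat_zpow (k : ℤ) {x : ℂ} (hx : 0 < x.im) : mob (tMat ^ k) x = x + k * width := by
  induction k using Int.induction_on with
  | zero => simp [mob_one]
  | succ n ih =>
    rw [add_comm, _root_.zpow_add, zpow_one, mob_mul _ _ hx, ih, mob_tMat]
    push_cast
    ring
  | pred n ih =>
    have h : mob tMat (mob (tMat ^ (-(n : ℤ) - 1)) x) = x + (-(n : ℤ) : ℤ) * width := by
      rw [← mob_mul _ _ hx, ← ih, ← _root_.zpow_one_add]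
      congr 2
      ring
    rw [mob_tMat] at h
    push_cast at h ⊢
    linear_combination h

theorem mob_sMat (x : ℂ) : mob sMat x = -x⁻¹ := by
  simp [mob, sMat, neg_div]

/-- Conjugation by the inversion exchanges the two parabolic generators, because its square `-1` is
central. So the inversion, which realises `z ↦ 1 - z`, normalises the group. -/
theorem sMat_conj_mem {M : SL(2, ℝ)} (hM : M ∈ Γs) : sMat * M * sMat⁻¹ ∈ Γs := by
  induction hM using Subgroup.closure_induction with
  | mem x hx =>
    rcases hx with rfl | rfl
    · rw [← uMat_eq]; exact uMat_mem
    · rw [uMat_eq, show sMat * (sMat * tMat * sMat⁻¹) * sMat⁻¹ =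
        (sMat * sMat) * tMat * (sMat⁻¹ * sMat⁻¹) by group, sMat_inv, neg_mul_neg, sMat_mul_self]
      simpa using tMat_mem
  | one => simp
  | mul x y _ _ hx hy =>
    have := mul_mem hx hy
    rwa [show sMat * x * sMat⁻¹ * (sMat * y * sMat⁻¹) = sMat * (x * y) * sMat⁻¹ by group] at this
  | inv x _ hx =>
    have := inv_mem hx
    rwa [show (sMat * x * sMat⁻¹)⁻¹ = sMat * x⁻¹ * sMat⁻¹ by group] at this

theorem sMat_conj_mem' {M : SL(2, ℝ)} (hM : M ∈ Γs) : sMat⁻¹ * M * sMat ∈ Γs := by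
  have := sMat_conj_mem hM
  rw [sMat_inv] at this ⊢
  simpa using this

end TriangleGroup

/-! ### Branches of the period map and their uniqueness up to the group. -/

section Link

/-- If two continuous functions have the same image under `cuspParam`, then they differ by a
constant multiple of the period. -/
theorem eventually_eq_add_of_cuspParam_eq {X : Type*} [TopologicalSpace X] {f g : X → ℂ} {x : X}
    (hf : ContinuousAt f x) (hg : ContinuousAt g x)
    (h : ∀ᶠ y in 𝓝 x, cuspParam (f y) = cuspParam (g y)) :
    ∃ k : ℤ, ∀ᶠ y in 𝓝 x, f y = g y + k * width := by
  have hw := width_pos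
  obtain ⟨k, hk⟩ := cuspParam_eq_iff.1 h.self_of_nhds
  refine ⟨k, ?_⟩
  have hc : ContinuousAt (fun y => f y - g y - k * width) x := (hf.sub hg).sub continuousAt_const
  -- The expression is an integer multiple of `width`; by continuity it stays smaller than `width`,
  -- so it vanishes.
  have hsm : ∀ᶠ y in 𝓝 x, ‖f y - g y - k * width‖ < width := by
    have : ‖f x - g x - k * width‖ < width := by
      rw [hk]; simpa using hw
    exact hc.norm.eventually_lt continuousAt_const this
  filter_upwards [h, hsm] with y hy hy'
  obtain ⟨n, hn⟩ := cuspParam_eq_iff.1 hy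
  have e : f y - g y - k * width = ((n - k : ℤ) : ℂ) * width := by
    rw [hn]; push_cast; ring
  rw [e, norm_mul, Complex.norm_intCast, Complex.norm_real, Real.norm_of_nonneg hw.le] at hy'
  have h1 : |((n - k : ℤ) : ℝ)| < 1 := by
    by_contra hc
    push Not at hc
    nlinarith
  have h2 : n - k = 0 := by
    rw [← Int.cast_abs] at h1
    have : |n - k| < 1 := by exact_mod_cast h1
    exact Int.abs_lt_one_iff.1 this
  have : n = k := by omega
  rw [hn, this]

/-- The functions `ζ` and `τ`, analytic at `x`, are related by the (multivalued) period map: near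
`x`, a translate of `τ` by the triangle group is a branch of `hypTau ∘ ζ`. -/
def Link (ζ τ : ℂ → ℂ) (x : ℂ) : Prop :=
  AnalyticAt ℂ ζ x ∧ AnalyticAt ℂ τ x ∧ 0 < (τ x).im ∧ ∃ M ∈ Γs,
    (ζ x ∈ cutPlane ∧ ∀ᶠ y in 𝓝 x, cuspParam (mob M (τ y)) = nome (ζ y)) ∨
    (1 - ζ x ∈ cutPlane ∧ ∀ᶠ y in 𝓝 x, cuspParam (mob sMat (mob M (τ y))) = nome (1 - ζ y))

theorem eventually_im_pos {τ : ℂ → ℂ} {x : ℂ} (h : ContinuousAt τ x) (h0 : 0 < (τ x).im) :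
    ∀ᶠ y in 𝓝 x, 0 < (τ y).im :=
  continuousAt_const.eventually_lt (Complex.continuous_im.continuousAt.comp h) h0

/-- Each alternative in `Link` determines `τ` up to a translation. In the second one the translation
is conjugated by the inversion, so it still belongs to `Γs`. -/
theorem Link.exists_hypTau {ζ τ : ℂ → ℂ} {x : ℂ} (h : Link ζ τ x) (hx : ζ x ∈ doubleCutPlane) :
    ∃ M ∈ Γs, ∀ᶠ y in 𝓝 x, mob M (τ y) = hypTau (ζ y) := by
  obtain ⟨hζ, hτ, him, M, hM, h⟩ := h
  have hev : ∀ᶠ y in 𝓝 x, ζ y ∈ doubleCutPlane :=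
    hζ.continuousAt.eventually_mem (isOpen_doubleCutPlane.mem_nhds hx)
  have hpos := eventually_im_pos hτ.continuousAt him
  have hMc : ∀ M : SL(2, ℝ), ContinuousAt (fun y => mob M (τ y)) x := fun M =>
    ContinuousAt.comp (f := τ) (analyticAt_mob M him).continuousAt hτ.continuousAt
  rcases h with ⟨-, h⟩ | ⟨-, h⟩
  · obtain ⟨k, hk⟩ := eventually_eq_add_of_cuspParam_eq (f := fun y => hypTau (ζ y))
      (g := fun y => mob M (τ y))
      (ContinuousAt.comp (f := ζ) (hasDerivAt_hypTau hx).continuousAt hζ.continuousAt) (hMc M) (by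
        filter_upwards [h, hev] with y h1 h2
        rw [h1, nome_eq h2])
    refine ⟨tMat ^ k * M, mul_mem (zpow_mem tMat_mem k) hM, ?_⟩
    filter_upwards [hk, hpos] with y h1 h2
    rw [mob_mul _ _ h2, mob_tMat_zpow _ (mob_im_pos _ h2), h1]
  · obtain ⟨k, hk⟩ := eventually_eq_add_of_cuspParam_eq (f := fun y => hypTau (1 - ζ y))
      (g := fun y => mob (sMat * M) (τ y))
      (ContinuousAt.comp (f := fun y => 1 - ζ y)
        (hasDerivAt_hypTau (one_sub_mem_doubleCutPlane hx)).continuousAt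
        (continuousAt_const.sub hζ.continuousAt)) (hMc _) (by
        filter_upwards [h, hev, hpos] with y h1 h2 h3
        rw [mob_mul _ _ h3, h1, nome_eq (one_sub_mem_doubleCutPlane h2)])
    refine ⟨sMat⁻¹ * tMat ^ k * sMat * M, mul_mem (sMat_conj_mem' (zpow_mem tMat_mem k)) hM, ?_⟩
    filter_upwards [hk, hpos, hev] with y h1 h2 h3
    rw [mul_assoc, mul_assoc, mob_mul _ _ h2, mob_mul _ _ h2,
      mob_tMat_zpow _ (mob_im_pos _ h2), ← h1, hypTau_one_sub h3, ← mob_sMat,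
      mob_inv_mob _ (hypTau_im_pos h3)]

/-- The alternative can be chosen freely: where both charts are defined, either of them says that a
translate of `τ` is `hypTau ∘ ζ`. -/
theorem Link.left {ζ τ : ℂ → ℂ} {x : ℂ} (h : Link ζ τ x) (hx : ζ x ∈ cutPlane) :
    ∃ M ∈ Γs, ∀ᶠ y in 𝓝 x, cuspParam (mob M (τ y)) = nome (ζ y) := by
  have h' := h
  obtain ⟨hζ, hτ, him, M, hM, ⟨-, h1⟩ | ⟨h2, h1⟩⟩ := h
  · exact ⟨M, hM, h1⟩
  · have hx' : ζ x ∈ doubleCutPlane := ⟨hx, one_sub_mem_cutPlane.1 h2⟩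
    obtain ⟨N, hN, h3⟩ := h'.exists_hypTau hx'
    refine ⟨N, hN, ?_⟩
    filter_upwards [h3, hζ.continuousAt.eventually_mem (isOpen_doubleCutPlane.mem_nhds hx')]
      with y h4 h5
    rw [h4, nome_eq h5]

theorem Link.right {ζ τ : ℂ → ℂ} {x : ℂ} (h : Link ζ τ x) (hx : 1 - ζ x ∈ cutPlane) :
    ∃ M ∈ Γs, ∀ᶠ y in 𝓝 x, cuspParam (mob sMat (mob M (τ y))) = nome (1 - ζ y) := by
  have h' := h
  obtain ⟨hζ, hτ, him, M, hM, ⟨h2, h1⟩ | ⟨-, h1⟩⟩ := h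
  · have hx' : ζ x ∈ doubleCutPlane := ⟨h2, one_sub_mem_cutPlane.1 hx⟩
    obtain ⟨N, hN, h3⟩ := h'.exists_hypTau hx'
    refine ⟨N, hN, ?_⟩
    filter_upwards [h3, hζ.continuousAt.eventually_mem (isOpen_doubleCutPlane.mem_nhds hx')]
      with y h4 h5
    rw [h4, mob_sMat, ← hypTau_one_sub h5, nome_eq (one_sub_mem_doubleCutPlane h5)]
  · exact ⟨M, hM, h1⟩

theorem Link.cases {ζ τ : ℂ → ℂ} {x : ℂ} (h : Link ζ τ x) : ζ x ∈ cutPlane ∨ 1 - ζ x ∈ cutPlane := by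
  obtain ⟨-, -, -, M, -, ⟨h, -⟩ | ⟨h, -⟩⟩ := h
  · exact Or.inl h
  · exact Or.inr h

/-- In a common chart the nome determines a translate of `τ` up to a power of the parabolic element
of that cusp. Hence two branches over the same `ζ` differ by the group; for `b ≠ 0` this is why
fibres of the Hauptmodul are single orbits. -/
theorem Link.unique {ζ τ τ' : ℂ → ℂ} {x : ℂ} (h : Link ζ τ x) (h' : Link ζ τ' x) :
    ∃ M ∈ Γs, ∀ᶠ y in 𝓝 x, τ' y = mob M (τ y) := by
  have hpos := eventually_im_pos h.2.1.continuousAt h.2.2.1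
  have hpos' := eventually_im_pos h'.2.1.continuousAt h'.2.2.1
  have hMc : ∀ M : SL(2, ℝ), ContinuousAt (fun y => mob M (τ y)) x := fun M =>
    ContinuousAt.comp (f := τ) (analyticAt_mob M h.2.2.1).continuousAt h.2.1.continuousAt
  have hMc' : ∀ M : SL(2, ℝ), ContinuousAt (fun y => mob M (τ' y)) x := fun M =>
    ContinuousAt.comp (f := τ') (analyticAt_mob M h'.2.2.1).continuousAt h'.2.1.continuousAt
  rcases h.cases with hx | hx
  · obtain ⟨M, hM, h1⟩ := h.left hx
    obtain ⟨N, hN, h2⟩ := h'.left hx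
    obtain ⟨k, hk⟩ := eventually_eq_add_of_cuspParam_eq (hMc' N) (hMc M)
      (by filter_upwards [h1, h2] with y h1 h2; rw [h1, h2])
    refine ⟨N⁻¹ * (tMat ^ k * M), mul_mem (inv_mem hN) (mul_mem (zpow_mem tMat_mem k) hM), ?_⟩
    filter_upwards [hk, hpos, hpos'] with y h1 h2 h3
    rw [mob_mul _ _ h2, mob_mul _ _ h2, mob_tMat_zpow _ (mob_im_pos _ h2), ← h1, mob_inv_mob _ h3]
  · obtain ⟨M, hM, h1⟩ := h.right hx
    obtain ⟨N, hN, h2⟩ := h'.right hx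
    obtain ⟨k, hk⟩ := eventually_eq_add_of_cuspParam_eq (hMc' (sMat * N)) (hMc (sMat * M))
      (by
        filter_upwards [h1, h2, hpos, hpos'] with y h1 h2 h3 h4
        rw [mob_mul _ _ h3, mob_mul _ _ h4, h1, h2])
    refine ⟨N⁻¹ * (sMat⁻¹ * tMat ^ k * sMat * M), mul_mem (inv_mem hN)
      (mul_mem (sMat_conj_mem' (zpow_mem tMat_mem k)) hM), ?_⟩
    filter_upwards [hk, hpos, hpos'] with y h1 h2 h3
    rw [mob_mul _ _ h2, mul_assoc, mul_assoc, mob_mul _ _ h2, mob_mul _ _ h2,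
      mob_tMat_zpow _ (mob_im_pos _ h2), ← h1, mob_mul _ _ h3,
      mob_inv_mob _ (mob_im_pos _ h3), mob_inv_mob _ h3]

theorem Link.comp {ζ τ g : ℂ → ℂ} {x : ℂ} (h : Link ζ τ (g x)) (hg : AnalyticAt ℂ g x) :
    Link (fun y => ζ (g y)) (fun y => τ (g y)) x := by
  obtain ⟨hζ, hτ, him, M, hM, h⟩ := h
  refine ⟨hζ.fun_comp hg, hτ.fun_comp hg, him, M, hM, ?_⟩
  rcases h with ⟨h1, h2⟩ | ⟨h1, h2⟩
  · exact Or.inl ⟨h1, hg.continuousAt.eventually h2⟩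
  · exact Or.inr ⟨h1, hg.continuousAt.eventually h2⟩

theorem Link.congr {ζ τ ζ' τ' : ℂ → ℂ} {x : ℂ} (h : Link ζ τ x) (hζ : ζ' =ᶠ[𝓝 x] ζ)
    (hτ : τ' =ᶠ[𝓝 x] τ) : Link ζ' τ' x := by
  obtain ⟨h1, h2, him, M, hM, h⟩ := h
  refine ⟨h1.congr hζ.symm, h2.congr hτ.symm, by rwa [hτ.self_of_nhds], M, hM, ?_⟩
  rw [hζ.self_of_nhds]
  rcases h with ⟨h1, h2⟩ | ⟨h1, h2⟩
  · exact Or.inl ⟨h1, by filter_upwards [h2, hζ, hτ] with y a b c; rw [b, c, a]⟩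
  · exact Or.inr ⟨h1, by filter_upwards [h2, hζ, hτ] with y a b c; rw [b, c, a]⟩

theorem Link.smul {ζ τ : ℂ → ℂ} {x : ℂ} (h : Link ζ τ x) {N : SL(2, ℝ)} (hN : N ∈ Γs) :
    Link ζ (fun y => mob N (τ y)) x := by
  obtain ⟨h1, h2, him, M, hM, h⟩ := h
  have hpos := eventually_im_pos h2.continuousAt him
  refine ⟨h1, (analyticAt_mob N him).fun_comp h2, mob_im_pos _ him, M * N⁻¹,
    mul_mem hM (inv_mem hN), ?_⟩
  rcases h with ⟨h1, h2⟩ | ⟨h1, h2⟩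
  · refine Or.inl ⟨h1, ?_⟩
    filter_upwards [h2, hpos] with y a b
    rw [mob_mul _ _ (mob_im_pos _ b), mob_inv_mob _ b, a]
  · refine Or.inr ⟨h1, ?_⟩
    filter_upwards [h2, hpos] with y a b
    rw [mob_mul _ _ (mob_im_pos _ b), mob_inv_mob _ b, a]

theorem Link.eventually {ζ τ : ℂ → ℂ} {x : ℂ} (h : Link ζ τ x) : ∀ᶠ y in 𝓝 x, Link ζ τ y := by
  obtain ⟨h1, h2, him, M, hM, h⟩ := h
  have hpos := eventually_im_pos h2.continuousAt him
  rcases h with ⟨h3, h4⟩ | ⟨h3, h4⟩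
  · filter_upwards [h1.eventually_analyticAt, h2.eventually_analyticAt, hpos,
      h4.eventually_nhds, h1.continuousAt.eventually_mem (isOpen_cutPlane.mem_nhds h3)]
      with y a b c d e
    exact ⟨a, b, c, M, hM, Or.inl ⟨e, d⟩⟩
  · filter_upwards [h1.eventually_analyticAt, h2.eventually_analyticAt, hpos,
      h4.eventually_nhds, (continuousAt_const.sub h1.continuousAt).eventually_mem
      (isOpen_cutPlane.mem_nhds h3)] with y a b c d e
    exact ⟨a, b, c, M, hM, Or.inr ⟨e, d⟩⟩

/-- Freezing the germs at their values allows `Link.unique` to compare branches at two different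
points. -/
theorem Link.const {ζ τ : ℂ → ℂ} {x : ℂ} (h : Link ζ τ x) : Link (fun _ => ζ x) (fun _ => τ x) 0 :=
  Link.comp (g := fun _ => x) h analyticAt_const

/-- Local logarithms with respect to `cuspParam`. -/
theorem exists_cuspParam_comp_eq {g : ℂ → ℂ} {x : ℂ} (hg : AnalyticAt ℂ g x) (h0 : g x ≠ 0)
    (h1 : ‖g x‖ < 1) :
    ∃ τ : ℂ → ℂ, AnalyticAt ℂ τ x ∧ 0 < (τ x).im ∧ ∀ᶠ y in 𝓝 x, cuspParam (τ y) = g y := by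
  obtain ⟨τ₀, him, hτ₀⟩ := exists_cuspParam_eq h0 h1
  have hπ : (Real.pi : ℂ) ≠ 0 := by exact_mod_cast Real.pi_ne_zero
  have hw := width_ne_zero
  have hI := Complex.I_ne_zero
  have ha : AnalyticAt ℂ (fun y => g y / g x) x := hg.div analyticAt_const h0
  have hone : g x / g x = 1 := div_self h0
  refine ⟨fun y => τ₀ + width / (2 * Real.pi * Complex.I) * Complex.log (g y / g x), ?_, ?_, ?_⟩
  · exact analyticAt_const.add (analyticAt_const.mul (ha.clog (by rw [hone]; exact
      Complex.one_mem_slitPlane)))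
  · simpa [hone] using him
  · filter_upwards [ha.continuousAt.eventually_ne (show g x / g x ≠ 0 by simp [h0])] with y hy
    rw [cuspParam, mul_add, Complex.exp_add,
      show 2 * Real.pi * Complex.I / width * (width / (2 * Real.pi * Complex.I) *
        Complex.log (g y / g x)) = Complex.log (g y / g x) by field_simp, Complex.exp_log hy,
      ← cuspParam, hτ₀, mul_div_cancel₀ _ h0]

theorem analyticAt_nome {z : ℂ} (hz : z ∈ cutPlane) : AnalyticAt ℂ nome z :=
  (DifferentiableOn.analyticOnNhd (fun _ hy => (differentiableAt_nome hy).differentiableWithinAt)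
    isOpen_cutPlane) z hz

theorem cutPlane_or (z : ℂ) : z ∈ cutPlane ∨ 1 - z ∈ cutPlane := by
  rw [one_sub_mem_cutPlane, mem_cutPlane, Complex.mem_slitPlane_iff]
  by_cases him : z.im = 0
  · rcases lt_or_ge 0 z.re with h | h
    · exact Or.inr (Or.inl h)
    · exact Or.inl (Or.inl (by simp; linarith))
  · exact Or.inr (Or.inr him)

/-- One of `ζ x` and `1 - ζ x` lies in the cut plane. Its nome is non-zero and of modulus less than
`1`, so it has a local logarithm with values in `ℍ`. -/
theorem exists_link {ζ : ℂ → ℂ} {x : ℂ} (hζ : AnalyticAt ℂ ζ x) (h0 : ζ x ≠ 0) (h1 : ζ x ≠ 1) :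
    ∃ τ, Link ζ τ x := by
  rcases cutPlane_or (ζ x) with h | h
  · obtain ⟨τ, hτ, him, h2⟩ := exists_cuspParam_comp_eq (g := fun y => nome (ζ y))
      ((analyticAt_nome h).fun_comp hζ) (nome_ne_zero h h0) (norm_nome_lt_one h)
    exact ⟨τ, hζ, hτ, him, 1, one_mem _, Or.inl ⟨h, by simpa only [mob_one] using h2⟩⟩
  · obtain ⟨τ, hτ, him, h2⟩ := exists_cuspParam_comp_eq (g := fun y => nome (1 - ζ y))
      (AnalyticAt.fun_comp (f := fun y => 1 - ζ y) (analyticAt_nome h) (analyticAt_const.sub hζ))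
      (nome_ne_zero h (sub_ne_zero.2 h1.symm)) (norm_nome_lt_one h)
    refine ⟨fun y => mob sMat⁻¹ (τ y), hζ, (analyticAt_mob _ him).fun_comp hτ, mob_im_pos _ him, 1,
      one_mem _, Or.inr ⟨h, ?_⟩⟩
    filter_upwards [h2, eventually_im_pos hτ.continuousAt him] with y h2 h3
    rw [mob_one, ← mob_mul _ _ h3, mul_inv_cancel, mob_one, h2]

theorem link_hypTau {z : ℂ} (hz : z ∈ doubleCutPlane) : Link id hypTau z := by
  have hev : ∀ᶠ y in 𝓝 z, y ∈ doubleCutPlane := isOpen_doubleCutPlane.eventually_mem hz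
  refine ⟨analyticAt_id, ?_, hypTau_im_pos hz, 1, one_mem _, Or.inl ⟨hz.1, ?_⟩⟩
  · exact (DifferentiableOn.analyticOnNhd (fun _ hy =>
      (hasDerivAt_hypTau hy).differentiableAt.differentiableWithinAt) isOpen_doubleCutPlane) z hz
  · filter_upwards [hev] with y hy
    rw [mob_one, id, nome_eq hy]

end Link

/-! ### The chart at the elliptic point `z = ∞`. -/

section EllipticChart

/-- The system satisfied by `t⁻² f (t⁻⁵)` and `t⁻³ (z f' + 2/5 f) (t⁻⁵)`, for solutions `f` of the
hypergeometric equation. It is regular at `t = 0`, that is, at `z = ∞`. -/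
def ellSystem (t : ℂ) : ℂ × ℂ →L[ℂ] ℂ × ℂ :=
  (-5 : ℂ) • (ContinuousLinearMap.inl ℂ ℂ ℂ ∘L ContinuousLinearMap.snd ℂ ℂ ℂ) +
    (5 * t ^ 4 / (1 - t ^ 5)) • (ContinuousLinearMap.inr ℂ ℂ ℂ ∘L ContinuousLinearMap.snd ℂ ℂ ℂ) +
    (-(4 / 5) * t ^ 3 / (1 - t ^ 5)) •
      (ContinuousLinearMap.inr ℂ ℂ ℂ ∘L ContinuousLinearMap.fst ℂ ℂ ℂ)

theorem ellSystem_apply (t : ℂ) (u : ℂ × ℂ) : ellSystem t u =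
    (-5 * u.2, 5 * t ^ 4 / (1 - t ^ 5) * u.2 + -(4 / 5) * t ^ 3 / (1 - t ^ 5) * u.1) := by
  ext <;> simp [ellSystem]

theorem one_sub_pow_ne_zero {t : ℂ} (ht : t ∈ Metric.ball (0 : ℂ) 1) : 1 - t ^ 5 ≠ 0 := by
  intro h
  have h1 : t ^ 5 = 1 := by linear_combination -h
  have h2 : ‖t‖ ^ 5 = 1 := by rw [← norm_pow, h1, norm_one]
  have h3 : ‖t‖ < 1 := by simpa using ht
  have := pow_lt_one₀ (norm_nonneg t) h3 (n := 5) (by norm_num)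
  linarith

theorem differentiableOn_ellSystem : DifferentiableOn ℂ ellSystem (Metric.ball 0 1) := by
  have h : ∀ t ∈ Metric.ball (0 : ℂ) 1, 1 - t ^ 5 ≠ 0 := fun t => one_sub_pow_ne_zero
  unfold ellSystem
  refine DifferentiableOn.add (DifferentiableOn.add (differentiableOn_const _) ?_) ?_
  · exact DifferentiableOn.smul_const (DifferentiableOn.div (by fun_prop) (by fun_prop) h) _
  · exact DifferentiableOn.smul_const (DifferentiableOn.div (by fun_prop) (by fun_prop) h) _

/-- The vector of solutions of `ellSystem` attached to a function `f` with derivative `f'`. -/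
def ellVector (f f' : ℂ → ℂ) (t : ℂ) : ℂ × ℂ :=
  ((t ^ 2)⁻¹ * f (t ^ 5)⁻¹, (t ^ 3)⁻¹ * ((t ^ 5)⁻¹ * f' (t ^ 5)⁻¹ + 2 / 5 * f (t ^ 5)⁻¹))

theorem hasDerivAt_ellVector {f f' f'' : ℂ → ℂ} {t z : ℂ} (ht0 : t ≠ 0) (ht1 : 1 - t ^ 5 ≠ 0)
    (hz : z = (t ^ 5)⁻¹) (h1 : HasDerivAt f (f' z) z) (h2 : HasDerivAt f' (f'' z) z)
    (hode : z * (1 - z) * f'' z + (1 - 2 * z) * f' z - 6 / 25 * f z = 0) :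
    HasDerivAt (ellVector f f') (ellSystem t (ellVector f f' t)) t := by
  have hz' : HasDerivAt (fun t : ℂ => (t ^ 5)⁻¹) (-(5 * t ^ 4) / (t ^ 5) ^ 2) t := by
    have := (hasDerivAt_pow 5 t).inv (pow_ne_zero 5 ht0)
    exact HasDerivAt.congr_deriv this (by norm_num)
  have hf : HasDerivAt (fun t : ℂ => f (t ^ 5)⁻¹) (f' z * (-(5 * t ^ 4) / (t ^ 5) ^ 2)) t :=
    HasDerivAt.comp t (by rw [← hz]; exact h1) hz'
  have hf' : HasDerivAt (fun t : ℂ => f' (t ^ 5)⁻¹) (f'' z * (-(5 * t ^ 4) / (t ^ 5) ^ 2)) t :=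
    HasDerivAt.comp t (by rw [← hz]; exact h2) hz'
  have e2 := (hasDerivAt_pow 2 t).inv (pow_ne_zero 2 ht0)
  have e3 := (hasDerivAt_pow 3 t).inv (pow_ne_zero 3 ht0)
  have d1 := e2.mul hf
  have d2 := e3.mul ((hz'.mul hf').add (hf.const_mul (2 / 5)))
  rw [ellSystem_apply]
  have hzt : z * t ^ 5 = 1 := by rw [hz, inv_mul_cancel₀ (pow_ne_zero 5 ht0)]
  refine HasDerivAt.congr_deriv (d1.prodMk d2) ?_
  simp only [ellVector, ← hz, Pi.inv_apply, Pi.add_apply, Pi.mul_apply]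
  rw [hz] at hode hzt ⊢
  generalize f (t ^ 5)⁻¹ = a at *
  generalize f' (t ^ 5)⁻¹ = b at *
  generalize f'' (t ^ 5)⁻¹ = c at *
  have hode' : (t ^ 5 - 1) * c + (t ^ 5 - 2) * t ^ 5 * b - 6 / 25 * a * t ^ 10 = 0 := by
    field_simp at hode
    linear_combination hode / 25
  ext
  · simp
    field_simp
    ring
  · simp
    field_simp
    linear_combination (25 : ℂ) * hode'

theorem isPreconnected_punctured_ball : IsPreconnected (Metric.ball (0 : ℂ) 1 \ {0}) := by
  have h : Metric.ball (0 : ℂ) 1 \ {0} = Complex.exp '' {z : ℂ | z.re < 0} := by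
    ext z
    constructor
    · rintro ⟨h1, h0⟩
      refine ⟨Complex.log z, ?_, Complex.exp_log h0⟩
      rw [Set.mem_ofPred_eq, Complex.log_re]
      exact Real.log_neg (norm_pos_iff.2 h0) (by simpa using h1)
    · rintro ⟨w, hw, rfl⟩
      refine ⟨?_, Complex.exp_ne_zero w⟩
      rw [mem_ball_zero_iff, Complex.norm_exp, Real.exp_lt_one_iff]
      exact hw
  rw [h]
  exact (convex_halfSpace_re_lt 0).isPreconnected.image _ Complex.continuous_exp.continuousOn

/-- The chart at the elliptic point: a branch of `τ` as a function of `t = z ^ (-1/5)`. -/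
theorem exists_ellChart : ∃ E : ℂ → ℂ,
    (∀ t ∈ Metric.ball (0 : ℂ) 1, DifferentiableAt ℂ E t ∧ deriv E t ≠ 0 ∧ 0 < (E t).im) ∧
    (∀ t ∈ Metric.ball (0 : ℂ) 1, t ≠ 0 → Link (fun t => (t ^ 5)⁻¹) E t) ∧
    ∃ t₀ ∈ Metric.ball (0 : ℂ) 1, t₀ ≠ 0 ∧ (t₀ ^ 5)⁻¹ ∈ doubleCutPlane ∧
      E =ᶠ[𝓝 t₀] fun t => hypTau (t ^ 5)⁻¹ := by
  -- The base point has `t₀⁻⁵ = 2i`, which lies off both cuts.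
  obtain ⟨t₀, ht₀⟩ := IsAlgClosed.exists_pow_nat_eq (-Complex.I / 2) (n := 5) (by norm_num)
  have ht₀0 : t₀ ≠ 0 := by
    rintro rfl
    rw [zero_pow (by norm_num)] at ht₀
    exact absurd ht₀.symm (div_ne_zero (neg_ne_zero.2 Complex.I_ne_zero) two_ne_zero)
  have ht₀1 : t₀ ∈ Metric.ball (0 : ℂ) 1 := by
    rw [mem_ball_zero_iff]
    by_contra h
    push Not at h
    have h1 : ‖t₀‖ ^ 5 = 1 / 2 := by rw [← norm_pow, ht₀]; simp
    have := one_le_pow₀ h (n := 5)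
    linarith
  have hz₀ : (t₀ ^ 5)⁻¹ ∈ doubleCutPlane := by
    apply mem_doubleCutPlane_of_im_ne_zero
    rw [ht₀, inv_div, div_neg, Complex.neg_im, Complex.div_I]
    simp
  have hev : ∀ᶠ t in 𝓝 t₀, t ≠ 0 ∧ t ∈ Metric.ball (0 : ℂ) 1 ∧ (t ^ 5)⁻¹ ∈ doubleCutPlane := by
    have hc : ContinuousAt (fun t : ℂ => (t ^ 5)⁻¹) t₀ :=
      (continuousAt_id.pow 5).inv₀ (pow_ne_zero 5 ht₀0)
    exact (eventually_ne_nhds ht₀0).and ((Metric.isOpen_ball.eventually_mem ht₀1).and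
      (hc.eventually_mem (isOpen_doubleCutPlane.mem_nhds hz₀)))
  -- The system is regular on the whole unit disc, so a local solution of the hypergeometric
  -- equation near `t₀⁻⁵` extends across `t = 0`, that is, across `z = ∞`.
  have key : ∀ f f' f'' : ℂ → ℂ, (∀ z ∈ doubleCutPlane, HasDerivAt f (f' z) z ∧
      HasDerivAt f' (f'' z) z ∧ z * (1 - z) * f'' z + (1 - 2 * z) * f' z - 6 / 25 * f z = 0) →
      ∃ U : ℂ → ℂ × ℂ, (∀ t ∈ Metric.ball (0 : ℂ) 1, HasDerivAt U (ellSystem t (U t)) t) ∧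
        ∀ᶠ t in 𝓝 t₀, (U t).1 = (t ^ 2)⁻¹ * f (t ^ 5)⁻¹ := by
    intro f f' f'' hf
    obtain ⟨U, hU0, hU⟩ := exists_linearODE_solution_ball ht₀1 differentiableOn_ellSystem
      (ellVector f f' t₀)
    refine ⟨U, hU, ?_⟩
    have h := linearODE_eventuallyEq
      (differentiableOn_ellSystem.differentiableAt
        (Metric.isOpen_ball.mem_nhds ht₀1)).continuousAt
      ((Metric.isOpen_ball.eventually_mem ht₀1).mono hU) (Z := ellVector f f')
      (hev.mono fun t ht => hasDerivAt_ellVector ht.1 (one_sub_pow_ne_zero ht.2.1) rfl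
        (hf _ ht.2.2).1 (hf _ ht.2.2).2.1 (hf _ ht.2.2).2.2) hU0
    filter_upwards [h] with t ht
    rw [ht, ellVector]
  obtain ⟨F, hF, hF0⟩ := key hyp hypDeriv hypDeriv₂ fun z hz =>
    ⟨hasDerivAt_hyp hz.1, hasDerivAt_hypDeriv hz.1, hyp_ode hz.1⟩
  obtain ⟨G, hG, hG0⟩ := key (fun z => hyp (1 - z)) (fun z => -hypDeriv (1 - z))
    (fun z => hypDeriv₂ (1 - z)) fun z hz =>
    ⟨hasDerivAt_hyp_one_sub hz.2, 
      HasDerivAt.congr_deriv (hasDerivAt_hypDeriv_one_sub hz.2).neg (by simp), by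
      linear_combination hyp_ode (one_sub_mem_doubleCutPlane hz).1⟩
  set E : ℂ → ℂ := fun t => Complex.I * (G t).1 / (F t).1 with hE
  have hF1 : ∀ t ∈ Metric.ball (0 : ℂ) 1, HasDerivAt (fun t => (F t).1) (-5 * (F t).2) t :=
    fun t ht => HasDerivAt.congr_deriv
      ((ContinuousLinearMap.fst ℂ ℂ ℂ).hasFDerivAt.comp_hasDerivAt t (hF t ht))
      (by simp [ellSystem_apply])
  have hG1 : ∀ t ∈ Metric.ball (0 : ℂ) 1, HasDerivAt (fun t => (G t).1) (-5 * (G t).2) t :=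
    fun t ht => HasDerivAt.congr_deriv
      ((ContinuousLinearMap.fst ℂ ℂ ℂ).hasFDerivAt.comp_hasDerivAt t (hG t ht))
      (by simp [ellSystem_apply])
  have hF2 : ∀ t ∈ Metric.ball (0 : ℂ) 1, HasDerivAt (fun t => (F t).2)
      (ellSystem t (F t)).2 t := fun t ht =>
    (ContinuousLinearMap.snd ℂ ℂ ℂ).hasFDerivAt.comp_hasDerivAt t (hF t ht)
  have hG2 : ∀ t ∈ Metric.ball (0 : ℂ) 1, HasDerivAt (fun t => (G t).2)
      (ellSystem t (G t)).2 t := fun t ht =>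
    (ContinuousLinearMap.snd ℂ ℂ ℂ).hasFDerivAt.comp_hasDerivAt t (hG t ht)
  have hEd : ∀ t ∈ Metric.ball (0 : ℂ) 1, (F t).1 ≠ 0 → HasDerivAt E
      (-5 * Complex.I * ((F t).1 * (G t).2 - (F t).2 * (G t).1) / (F t).1 ^ 2) t := by
    intro t ht h0
    refine HasDerivAt.congr_deriv (((hG1 t ht).const_mul Complex.I).div (hF1 t ht) h0) ?_
    ring
  have hE0 : E =ᶠ[𝓝 t₀] fun t => hypTau (t ^ 5)⁻¹ := by
    filter_upwards [hF0, hG0, hev] with t h1 h2 h3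
    have := hyp_ne_zero h3.2.2.1
    have := h3.1
    simp only [hE, h1, h2, hypTau]
    field_simp
  have hFt₀ : (F t₀).1 ≠ 0 := by
    rw [hF0.self_of_nhds]
    exact mul_ne_zero (inv_ne_zero (pow_ne_zero 2 ht₀0)) (hyp_ne_zero hz₀.1)
  -- the Wronskian determinant
  have hW : ∀ t ∈ Metric.ball (0 : ℂ) 1, (F t).1 * (G t).2 - (F t).2 * (G t).1 ≠ 0 := by
    have hd : ∀ t ∈ Metric.ball (0 : ℂ) 1, HasDerivAt
        (fun t => (1 - t ^ 5) * ((F t).1 * (G t).2 - (F t).2 * (G t).1)) 0 t := by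
      intro t ht
      have h1 := one_sub_pow_ne_zero ht
      have h := ((hasDerivAt_pow 5 t).const_sub 1).mul
        (((hF1 t ht).mul (hG2 t ht)).sub ((hF2 t ht).mul (hG1 t ht)))
      refine HasDerivAt.congr_deriv h ?_
      simp [ellSystem_apply]
      field_simp
      ring
    obtain ⟨c, hc⟩ := Metric.isOpen_ball.exists_is_const_of_deriv_eq_zero
      (convex_ball (0 : ℂ) 1).isPreconnected
      (fun t ht => (hd t ht).differentiableAt.differentiableWithinAt)
      (fun t ht => (hd t ht).deriv)
    -- If the constant were zero, `E` would be stationary at `t₀`, where it equals `hypTau (t⁻⁵)`, a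
    -- composite with non-zero derivative.
    have hc0 : c ≠ 0 := by
      rw [← hc t₀ ht₀1]
      refine mul_ne_zero (one_sub_pow_ne_zero ht₀1) fun h0 => ?_
      have h1 := hEd t₀ ht₀1 hFt₀
      rw [h0, mul_zero, zero_div] at h1
      have hz' : HasDerivAt (fun t : ℂ => (t ^ 5)⁻¹) (-(5 * t₀ ^ 4) / (t₀ ^ 5) ^ 2) t₀ := by
        have := (hasDerivAt_pow 5 t₀).inv (pow_ne_zero 5 ht₀0)
        exact HasDerivAt.congr_deriv this (by norm_num)
      have h2 := ((hasDerivAt_hypTau hz₀).comp t₀ hz').congr_of_eventuallyEq hE0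
      have h3 := h1.unique h2
      have := hyp_ne_zero hz₀.1
      obtain ⟨_, hz1⟩ := doubleCutPlane_ne hz₀
      have hπ : (Real.pi : ℂ) ≠ 0 := by exact_mod_cast Real.pi_ne_zero
      have hw := width_ne_zero
      refine absurd h3.symm (mul_ne_zero (div_ne_zero (neg_ne_zero.2 (mul_ne_zero
        Complex.I_ne_zero (div_ne_zero hw (mul_ne_zero two_ne_zero hπ)))) ?_)
        (div_ne_zero (neg_ne_zero.2 (mul_ne_zero (by norm_num) (pow_ne_zero 4 ht₀0))) ?_))
      · exact mul_ne_zero (mul_ne_zero (inv_ne_zero (pow_ne_zero 5 ht₀0)) hz1) (pow_ne_zero 2 this)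
      · exact pow_ne_zero 2 (pow_ne_zero 5 ht₀0)
    intro t ht h0
    apply hc0
    rw [← hc t ht, h0, mul_zero]
  have hFan : ∀ t ∈ Metric.ball (0 : ℂ) 1, AnalyticAt ℂ (fun t => (F t).1) t := fun t ht =>
    analyticAt_of_eventually_hasDerivAt ((Metric.isOpen_ball.eventually_mem ht).mono hF1)
  have hGan : ∀ t ∈ Metric.ball (0 : ℂ) 1, AnalyticAt ℂ (fun t => (G t).1) t := fun t ht =>
    analyticAt_of_eventually_hasDerivAt ((Metric.isOpen_ball.eventually_mem ht).mono hG1)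
  have hzan : ∀ t : ℂ, t ≠ 0 → AnalyticAt ℂ (fun t : ℂ => (t ^ 5)⁻¹) t := fun t ht =>
    (analyticAt_id.pow 5).inv (pow_ne_zero 5 ht)
  -- on the punctured disc
  have hlink : ∀ t ∈ Metric.ball (0 : ℂ) 1, t ≠ 0 → Link (fun t => (t ^ 5)⁻¹) E t := by
    have hsub : Metric.ball (0 : ℂ) 1 \ {0} ⊆ {t | Link (fun t => (t ^ 5)⁻¹) E t} := by
      refine isPreconnected_punctured_ball.subset_of_closure_inter_subset ?_ ?_ ?_
      · rw [isOpen_iff_eventually]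
        intro t ht
        exact Link.eventually ht
      · refine ⟨t₀, ⟨ht₀1, ht₀0⟩, ?_⟩
        exact (Link.comp (g := fun t => (t ^ 5)⁻¹) (link_hypTau hz₀) (hzan t₀ ht₀0)).congr (EventuallyEq.refl _ _) hE0
      -- Closedness. A branch `τ` exists on a whole disc about the limit point, and near some `t₂`
      -- in that disc it is related to `E` by a matrix `M` of the group.
      · rintro t₁ ⟨ht₁, ht₁1, ht₁0⟩
        obtain ⟨τ, hτ⟩ := exists_link (hzan t₁ ht₁0) (inv_ne_zero (pow_ne_zero 5 ht₁0))
          (fun h => one_sub_pow_ne_zero ht₁1 (by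
            rw [inv_eq_one] at h
            rw [h, sub_self]))
        obtain ⟨ε, hε, hball⟩ := Metric.eventually_nhds_iff_ball.1
          (hτ.eventually.and (Metric.isOpen_ball.eventually_mem ht₁1))
        obtain ⟨t₂, ht₂, ht₂'⟩ := Metric.mem_closure_iff.1 ht₁ ε hε
        rw [dist_comm] at ht₂'
        obtain ⟨M, hM, hMτ⟩ := (hball t₂ ht₂').1.unique ht₂
        -- Cleared of denominators, the relation between `E` and `M τ` is analytic and spreads over
        -- the disc without assuming `F ≠ 0`. Afterwards a zero of `F` would force one of `G`,
        -- against the Wronskian.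
        have hid : Set.EqOn (fun t => Complex.I * (G t).1 * ((M 1 0 : ℝ) * τ t + (M 1 1 : ℝ)) -
            (F t).1 * ((M 0 0 : ℝ) * τ t + (M 0 1 : ℝ))) 0 (Metric.ball t₁ ε) := by
          refine AnalyticOnNhd.eqOn_zero_of_preconnected_of_eventuallyEq_zero (fun t ht => ?_)
            (U := Metric.ball t₁ ε) (𝕜 := ℂ) (convex_ball t₁ ε).isPreconnected ht₂' ?_
          · have h1 := hFan t (hball t ht).2
            have h2 := hGan t (hball t ht).2
            have h3 := (hball t ht).1.2.1
            fun_prop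
          · filter_upwards [hMτ, ((hball t₂ ht₂').1.eventually), ht₂.eventually] with t h1 h2 h3
            have hne : (F t).1 ≠ 0 := by
              intro h0
              have := h3.2.2.1
              simp [hE, h0] at this
            have hd := mob_denom_ne_zero M h2.2.2.1
            rw [hE, mob] at h1
            simp only at h1
            rw [div_eq_div_iff hne hd] at h1
            rw [Pi.zero_apply, h1]
            ring
        have hEM : ∀ t ∈ Metric.ball t₁ ε, E t = mob M (τ t) := by
          intro t ht
          have h1 := hid ht
          simp only [Pi.zero_apply] at h1
          have hd := mob_denom_ne_zero M (hball t ht).1.2.2.1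
          have hne : (F t).1 ≠ 0 := by
            intro h0
            rw [h0, zero_mul, sub_zero] at h1
            have hG0 : (G t).1 = 0 := by
              simpa [hd, Complex.I_ne_zero] using h1
            exact hW t (hball t ht).2 (by rw [h0, hG0]; ring)
          rw [hE, mob]
          simp only
          rw [div_eq_div_iff hne hd]
          linear_combination h1
        exact ((hball t₁ (Metric.mem_ball_self hε)).1.smul hM).congr (EventuallyEq.refl _ _)
          (Metric.eventually_nhds_iff_ball.2 ⟨ε, hε, hEM⟩)
    exact fun t ht h0 => hsub ⟨ht, h0⟩
  -- the real part of `G conj F` is positive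
  have hpos : ∀ t ∈ Metric.ball (0 : ℂ) 1, t ≠ 0 → ‖(G t).1 - (F t).1‖ < ‖(G t).1 + (F t).1‖ ∧
      (F t).1 ≠ 0 := by
    intro t ht h0
    have him := (hlink t ht h0).2.2.1
    have hne : (F t).1 ≠ 0 := by
      intro h0
      simp [hE, h0] at him
    refine ⟨?_, hne⟩
    have hEt : (G t).1 = -Complex.I * E t * (F t).1 := by
      simp only [hE]
      field_simp
      rw [Complex.I_sq]
      ring
    rw [hEt, show -Complex.I * E t * (F t).1 - (F t).1 = (-Complex.I * E t - 1) * (F t).1 by ring,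
      show -Complex.I * E t * (F t).1 + (F t).1 = (-Complex.I * E t + 1) * (F t).1 by ring,
      norm_mul, norm_mul]
    refine mul_lt_mul_of_pos_right ?_ (norm_pos_iff.2 hne)
    rw [← sq_lt_sq₀ (norm_nonneg _) (norm_nonneg _), ← Complex.normSq_eq_norm_sq,
      ← Complex.normSq_eq_norm_sq, Complex.normSq_apply, Complex.normSq_apply]
    simp
    nlinarith
  -- At `t = 0` only the weak inequality survives by continuity, but then `G + F = 0` implies `G = F
  -- = 0`, which the Wronskian excludes.
  have hsum : ∀ t ∈ Metric.ball (0 : ℂ) 1, (G t).1 + (F t).1 ≠ 0 := by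
    intro t ht h
    by_cases h0 : t = 0
    · subst h0
      have hle : ‖(G 0).1 - (F 0).1‖ ≤ ‖(G 0).1 + (F 0).1‖ := by
        have hc1 : ContinuousAt (fun t => ‖(G t).1 - (F t).1‖) 0 :=
          ((hGan 0 ht).continuousAt.sub (hFan 0 ht).continuousAt).norm
        have hc2 : ContinuousAt (fun t => ‖(G t).1 + (F t).1‖) 0 :=
          ((hGan 0 ht).continuousAt.add (hFan 0 ht).continuousAt).norm
        refine le_of_tendsto_of_tendsto (b := 𝓝[≠] (0 : ℂ)) (hc1.tendsto.mono_left nhdsWithin_le_nhds)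
          (hc2.tendsto.mono_left nhdsWithin_le_nhds) ?_
        filter_upwards [self_mem_nhdsWithin, mem_nhdsWithin_of_mem_nhds
          (Metric.isOpen_ball.mem_nhds ht)] with t h1 h2
        exact (hpos t h2 h1).1.le
      rw [h, norm_zero, norm_le_zero_iff] at hle
      have h1 : (G 0).1 = 0 := by linear_combination (h + hle) / 2
      have h2 : (F 0).1 = 0 := by linear_combination (h - hle) / 2
      exact hW 0 ht (by rw [h1, h2]; ring)
    · have := (hpos t ht h0).1
      rw [h, norm_zero] at this
      exact absurd this (norm_nonneg _).not_gt
  -- The Cayley transform `(G - F) / (G + F)` is holomorphic on the disc with modulus below `1` off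
  -- the origin. The maximum principle gives the strict inequality at the origin as well, hence `Im
  -- E(0) > 0`.
  have hzero : ‖(G 0).1 - (F 0).1‖ < ‖(G 0).1 + (F 0).1‖ := by
    have h0 : (0 : ℂ) ∈ Metric.ball (0 : ℂ) 1 := Metric.mem_ball_self one_pos
    set k : ℂ → ℂ := fun t => ((G t).1 - (F t).1) / ((G t).1 + (F t).1) with hk
    have hkd : DifferentiableOn ℂ k (Metric.ball 0 1) := fun t ht =>
      (((hG1 t ht).sub (hF1 t ht)).div ((hG1 t ht).add (hF1 t ht))
        (hsum t ht)).differentiableAt.differentiableWithinAt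
    have hlt : ∀ t ∈ Metric.ball (0 : ℂ) 1, t ≠ 0 → ‖k t‖ < 1 := by
      intro t ht h0
      rw [hk]
      simp only
      rw [norm_div, div_lt_one (norm_pos_iff.2 (hsum t ht))]
      exact (hpos t ht h0).1
    suffices ‖k 0‖ < 1 by
      rw [hk] at this
      simp only at this
      rwa [norm_div, div_lt_one (norm_pos_iff.2 (hsum 0 h0))] at this
    by_contra hge
    push Not at hge
    have hmax : IsMaxOn (norm ∘ k) (Metric.ball 0 1) 0 := fun t ht => by
      by_cases h : t = 0
      · subst h
        simp
      · exact (hlt t ht h).le.trans hge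
    have := Complex.norm_eqOn_of_isPreconnected_of_isMaxOn (convex_ball (0 : ℂ) 1).isPreconnected
      Metric.isOpen_ball hkd h0 hmax ht₀1
    simp only [Function.comp_apply, Function.const_apply] at this
    linarith [hlt t₀ ht₀1 ht₀0]
  have hfin : ∀ t ∈ Metric.ball (0 : ℂ) 1, (F t).1 ≠ 0 ∧ 0 < (E t).im := by
    intro t ht
    by_cases h0 : t = 0
    · subst h0
      have hne : (F 0).1 ≠ 0 := by
        intro h
        rw [h] at hzero
        simp at hzero
      refine ⟨hne, ?_⟩
      have hEt : (G 0).1 = -Complex.I * E 0 * (F 0).1 := by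
        simp only [hE]
        field_simp
        rw [Complex.I_sq]
        ring
      rw [hEt, show -Complex.I * E 0 * (F 0).1 - (F 0).1 = (-Complex.I * E 0 - 1) * (F 0).1 by ring,
        show -Complex.I * E 0 * (F 0).1 + (F 0).1 = (-Complex.I * E 0 + 1) * (F 0).1 by ring,
        norm_mul, norm_mul] at hzero
      have h1 := lt_of_mul_lt_mul_right hzero (norm_nonneg _)
      rw [← sq_lt_sq₀ (norm_nonneg _) (norm_nonneg _), ← Complex.normSq_eq_norm_sq,
        ← Complex.normSq_eq_norm_sq, Complex.normSq_apply, Complex.normSq_apply] at h1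
      simp at h1
      nlinarith
    · exact ⟨(hpos t ht h0).2, (hlink t ht h0).2.2.1⟩
  refine ⟨E, fun t ht => ?_, hlink, t₀, ht₀1, ht₀0, hz₀, hE0⟩
  have h := hEd t ht (hfin t ht).1
  refine ⟨h.differentiableAt, ?_, (hfin t ht).2⟩
  rw [h.deriv]
  exact div_ne_zero (mul_ne_zero (mul_ne_zero (by norm_num) Complex.I_ne_zero) (hW t ht))
    (pow_ne_zero 2 (hfin t ht).1)

/-- The chart at the elliptic point: a branch of `τ` as a function of `t = z ^ (-1/5)`. -/
def ellChart : ℂ → ℂ := exists_ellChart.choose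

theorem differentiableAt_ellChart {t : ℂ} (ht : t ∈ Metric.ball (0 : ℂ) 1) :
    DifferentiableAt ℂ ellChart t := (exists_ellChart.choose_spec.1 t ht).1

theorem deriv_ellChart_ne_zero {t : ℂ} (ht : t ∈ Metric.ball (0 : ℂ) 1) : deriv ellChart t ≠ 0 :=
  (exists_ellChart.choose_spec.1 t ht).2.1

theorem ellChart_im_pos {t : ℂ} (ht : t ∈ Metric.ball (0 : ℂ) 1) : 0 < (ellChart t).im :=
  (exists_ellChart.choose_spec.1 t ht).2.2

theorem link_ellChart {t : ℂ} (ht : t ∈ Metric.ball (0 : ℂ) 1) (h0 : t ≠ 0) :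
    Link (fun t => (t ^ 5)⁻¹) ellChart t := exists_ellChart.choose_spec.2.1 t ht h0

theorem exists_ellChart_eq : ∃ t₀ ∈ Metric.ball (0 : ℂ) 1, t₀ ≠ 0 ∧ (t₀ ^ 5)⁻¹ ∈ doubleCutPlane ∧
    ellChart =ᶠ[𝓝 t₀] fun t => hypTau (t ^ 5)⁻¹ := exists_ellChart.choose_spec.2.2

end EllipticChart

/-! ### Existence of the Hauptmodul by analytic continuation. -/

section Hauptmodul

theorem eventually_nhds_im_pos {x : ℂ} (hx : 0 < x.im) : ∀ᶠ y in 𝓝 x, 0 < y.im :=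
  eventually_im_pos (τ := id) continuousAt_id hx

/-- A uniform inverse function theorem on compact sets. -/
theorem exists_uniform_local_inverse {Q : ℂ → ℂ} {D K : Set ℂ} (hD : IsOpen D)
    (hQ : ∀ z ∈ D, DifferentiableAt ℂ Q z) (hQ' : ∀ z ∈ D, deriv Q z ≠ 0) (hK : IsCompact K)
    (hKD : K ⊆ D) : ∃ r > 0, ∀ ζ ∈ K, ∃ R : ℂ → ℂ,
      (∀ w ∈ Metric.ball (Q ζ) r, DifferentiableAt ℂ R w ∧ R w ∈ D ∧ Q (R w) = w) ∧
      ∀ᶠ y in 𝓝 ζ, R (Q y) = y := by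
  refine hK.induction_on (p := fun s => ∃ r > 0, ∀ ζ ∈ s, ∃ R : ℂ → ℂ,
      (∀ w ∈ Metric.ball (Q ζ) r, DifferentiableAt ℂ R w ∧ R w ∈ D ∧ Q (R w) = w) ∧
      ∀ᶠ y in 𝓝 ζ, R (Q y) = y) ⟨1, one_pos, by simp⟩ ?_ ?_ ?_
  · rintro s t hst ⟨r, hr, h⟩
    exact ⟨r, hr, fun ζ hζ => h ζ (hst hζ)⟩
  · rintro s t ⟨r, hr, h⟩ ⟨r', hr', h'⟩
    refine ⟨min r r', lt_min hr hr', fun ζ hζ => ?_⟩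
    rcases hζ with hζ | hζ
    · obtain ⟨R, h1, h2⟩ := h ζ hζ
      exact ⟨R, fun w hw => h1 w (Metric.ball_subset_ball (min_le_left _ _) hw), h2⟩
    · obtain ⟨R, h1, h2⟩ := h' ζ hζ
      exact ⟨R, fun w hw => h1 w (Metric.ball_subset_ball (min_le_right _ _) hw), h2⟩
  · intro z hz
    have hzD := hKD hz
    have han : AnalyticAt ℂ Q z :=
      (DifferentiableOn.analyticOnNhd (fun y hy => (hQ y hy).differentiableWithinAt) hD) z hzD
    have hs : HasStrictDerivAt Q (deriv Q z) z := han.hasStrictDerivAt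
    set e := (hs.hasStrictFDerivAt_equiv (hQ' z hzD)).toOpenPartialHomeomorph Q with he
    have heQ : ∀ y, e y = Q y := fun y => rfl
    have hze : z ∈ e.source :=
      (hs.hasStrictFDerivAt_equiv (hQ' z hzD)).mem_toOpenPartialHomeomorph_source
    have hopen : IsOpen (e '' (e.source ∩ D)) :=
      e.isOpen_image_of_subset_source (e.open_source.inter hD) Set.inter_subset_left
    obtain ⟨r, hr, hball⟩ := Metric.isOpen_iff.1 hopen (Q z) ⟨z, ⟨hze, hzD⟩, heQ z⟩
    refine ⟨{ζ | ζ ∈ e.source ∧ Q ζ ∈ Metric.ball (Q z) (r / 2)}, ?_, r / 2, half_pos hr, ?_⟩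
    · refine mem_nhdsWithin_of_mem_nhds ?_
      exact (e.open_source.eventually_mem hze).and
        ((hQ z hzD).continuousAt.eventually_mem (Metric.ball_mem_nhds _ (half_pos hr)))
    · rintro ζ ⟨hζ, hζ'⟩
      refine ⟨e.symm, fun w hw => ?_, ?_⟩
      · have hw' : w ∈ Metric.ball (Q z) r := by
          rw [Metric.mem_ball] at hw hζ' ⊢
          linarith [dist_triangle w (Q ζ) (Q z)]
        obtain ⟨y, ⟨hy1, hy2⟩, rfl⟩ := hball hw'
        have hinv : e.symm (e y) = y := e.left_inv hy1
        refine ⟨?_, by rwa [hinv], by rw [hinv]; rfl⟩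
        exact (e.hasDerivAt_symm (e.map_source hy1) (hQ' y hy2) (by
          rw [hinv]
          exact (hQ y hy2).hasDerivAt)).differentiableAt
      · filter_upwards [e.open_source.eventually_mem hζ] with y hy
        exact e.left_inv hy

/-- Solving `Q (ζ y) = g (N y)` for `ζ` near a point of the upper half-plane. -/
theorem exists_lift {Q g R : ℂ → ℂ} {D : Set ℂ} {r δ : ℝ} {N : SL(2, ℝ)} {τ : ℍ} {ζ : ℂ → ℂ}
    (hR : ∀ w ∈ Metric.ball (Q (ζ τ)) r, DifferentiableAt ℂ R w ∧ R w ∈ D ∧ Q (R w) = w)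
    (hRQ : ∀ᶠ y in 𝓝 (ζ τ), R (Q y) = y) (hg : ∀ x : ℂ, 0 < x.im → AnalyticAt ℂ g x)
    (hgδ : ∀ τ' : ℍ, dist τ' (N • τ) < δ → ‖g τ' - g ↑(N • τ)‖ < r)
    (hζ : ContinuousAt ζ τ) (h : ∀ᶠ y in 𝓝 (τ : ℂ), Q (ζ y) = g (mob N y)) :
    ∃ ζ' : ℂ → ℂ, ζ' =ᶠ[𝓝 (τ : ℂ)] ζ ∧ ∀ τ' : ℍ, dist τ' τ < δ → AnalyticAt ℂ ζ' τ' ∧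
      ζ' τ' ∈ D ∧ ∀ᶠ y in 𝓝 (τ' : ℂ), Q (ζ' y) = g (mob N y) := by
  refine ⟨fun y => R (g (mob N y)), ?_, fun τ' hτ' => ?_⟩
  · filter_upwards [h, hζ.eventually hRQ] with y h1 h2
    rw [← h1, h2]
  -- Möbius transformations are hyperbolic isometries, so the radius `δ` does not depend on the
  -- branch `N`.
  · have hd : dist (N • τ') (N • τ) < δ := by rwa [dist_smul]
    have hball : g (mob N τ') ∈ Metric.ball (Q (ζ τ)) r := by
      rw [h.self_of_nhds, mob_coe, mob_coe, mem_ball_iff_norm]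
      exact hgδ _ hd
    have han : AnalyticAt ℂ (fun y => g (mob N y)) τ' :=
      (hg _ (mob_im_pos _ τ'.im_pos)).fun_comp (analyticAt_mob N τ'.im_pos)
    have hRan : AnalyticAt ℂ R (g (mob N τ')) :=
      (DifferentiableOn.analyticOnNhd (fun y hy => (hR y hy).1.differentiableWithinAt)
        Metric.isOpen_ball) _ hball
    refine ⟨AnalyticAt.fun_comp (f := fun y => g (mob N y)) hRan han, (hR _ hball).2.1, ?_⟩
    filter_upwards [han.continuousAt.eventually_mem (Metric.isOpen_ball.mem_nhds hball)] with y hy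
    exact (hR _ hy).2.2

/-- `cuspParam` is uniformly continuous for the hyperbolic metric. -/
theorem exists_dist_cuspParam_lt {r : ℝ} (hr : 0 < r) :
    ∃ δ > 0, ∀ τ τ' : ℍ, dist τ' τ < δ → ‖cuspParam τ' - cuspParam τ‖ < r := by
  -- A hyperbolic distance below `log (1 + s)` bounds the Euclidean one by `s Im τ`. With `x = 2π Im
  -- τ / width` the difference is at most `exp(-x) x s exp(x / 2) ≤ 2 s < r`: the decay of `q` pays
  -- for the growth of the discs, and `s ≤ 1/2` is what keeps the exponential below `exp(x / 2)`.
  set s := min (1 / 2) (r / 4) with hs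
  have hs0 : 0 < s := by positivity
  refine ⟨Real.log (1 + s), Real.log_pos (by linarith), fun τ τ' h => ?_⟩
  have hexp : Real.exp (dist τ' τ) - 1 < s := by
    have := (Real.lt_log_iff_exp_lt (by linarith)).1 h
    linarith
  have hd : ‖(τ' : ℂ) - τ‖ ≤ τ.im * s := by
    rw [← dist_eq_norm]
    exact (UpperHalfPlane.dist_coe_le τ' τ).trans
      (mul_le_mul_of_nonneg_left hexp.le τ.im_pos.le)
  set C := 2 * Real.pi / width with hC
  have hC0 : 0 < C := div_pos (by positivity) width_pos
  set u := 2 * Real.pi * Complex.I / width * ((τ' : ℂ) - τ) with hu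
  have hun : ‖u‖ ≤ C * τ.im * s := by
    have : u = ((C : ℝ) : ℂ) * Complex.I * ((τ' : ℂ) - τ) := by
      rw [hu, hC]; push_cast; ring
    rw [this, norm_mul, norm_mul, Complex.norm_real, Complex.norm_I, Real.norm_of_nonneg hC0.le]
    nlinarith
  have e : cuspParam τ' - cuspParam τ = cuspParam τ * (Complex.exp u - 1) := by
    rw [mul_sub, cuspParam, cuspParam, ← Complex.exp_add, hu, mul_one]
    congr 2
    ring
  have hx : ‖Complex.exp u - 1‖ ≤ ‖u‖ * Real.exp ‖u‖ := by
    simpa using Complex.norm_exp_sub_sum_le_norm_mul_exp u 1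
  rw [e, norm_mul, norm_cuspParam]
  set x := C * τ.im with hxdef
  have hx0 : 0 < x := mul_pos hC0 τ.im_pos
  have h1 : ‖Complex.exp u - 1‖ ≤ x * s * Real.exp (x / 2) := by
    refine hx.trans (mul_le_mul hun (Real.exp_le_exp.2 (hun.trans ?_)) (Real.exp_pos _).le
      (by positivity))
    have : s ≤ 1 / 2 := min_le_left _ _
    nlinarith
  have h2 : x / 2 < Real.exp (x / 2) := by linarith [Real.add_one_le_exp (x / 2)]
  have h3 : Real.exp (-x) * Real.exp (x / 2) * Real.exp (x / 2) = 1 := by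
    rw [← Real.exp_add, ← Real.exp_add, Real.exp_eq_one_iff]
    ring
  have hsr : s ≤ r / 4 := min_le_right _ _
  calc Real.exp (-x) * ‖Complex.exp u - 1‖ ≤ Real.exp (-x) * (x * s * Real.exp (x / 2)) :=
        mul_le_mul_of_nonneg_left h1 (Real.exp_pos _).le
    _ = 2 * s * ((Real.exp (-x) * Real.exp (x / 2)) * (x / 2)) := by ring
    _ ≤ 2 * s * ((Real.exp (-x) * Real.exp (x / 2)) * Real.exp (x / 2)) := by gcongr
    _ = 2 * s := by rw [h3, mul_one]
    _ < r := by linarith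

/-- Local fifth roots of analytic functions. -/
theorem exists_analyticAt_pow_eq {g : ℂ → ℂ} {x : ℂ} (hg : AnalyticAt ℂ g x) (h0 : g x ≠ 0) :
    ∃ t : ℂ → ℂ, AnalyticAt ℂ t x ∧ ∀ᶠ y in 𝓝 x, t y ^ 5 = g y := by
  obtain ⟨c, hc⟩ := IsAlgClosed.exists_pow_nat_eq (g x) (n := 5) (by norm_num)
  have ha : AnalyticAt ℂ (fun y => g y / g x) x := hg.div analyticAt_const h0
  have hone : g x / g x = 1 := div_self h0
  refine ⟨fun y => c * Complex.exp (Complex.log (g y / g x) / 5), ?_, ?_⟩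
  · have := ha.clog (by rw [hone]; exact Complex.one_mem_slitPlane)
    fun_prop
  · filter_upwards [ha.continuousAt.eventually_ne (show g x / g x ≠ 0 by simp [h0])] with y hy
    rw [mul_pow, ← Complex.exp_nat_mul, hc]
    push_cast
    rw [mul_div_cancel₀ _ (by norm_num : (5 : ℂ) ≠ 0), Complex.exp_log hy, mul_div_cancel₀ _ h0]

/-- Germs of the Hauptmodul near the elliptic points. -/
def Ell (β : ℂ → ℂ) (x : ℂ) : Prop :=
  ∃ M ∈ Γs, ∃ t : ℂ → ℂ, AnalyticAt ℂ t x ∧ t x ∈ Metric.ball (0 : ℂ) 1 ∧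
    ∀ᶠ y in 𝓝 x, t y ^ 5 = β y ∧ ellChart (t y) = mob M y

/-- Germs of branches of the Hauptmodul. -/
def Adm (β : ℂ → ℂ) (x : ℂ) : Prop :=
  0 < x.im ∧ ((β x ≠ 0 ∧ Link (fun y => (β y)⁻¹) id x) ∨ Ell β x)

theorem Ell.link {β : ℂ → ℂ} {x : ℂ} (h : Ell β x) (hx : 0 < x.im) (h0 : β x ≠ 0) :
    Link (fun y => (β y)⁻¹) id x := by
  obtain ⟨M, hM, t, ht, ht1, h⟩ := h
  have ht0 : t x ≠ 0 := by
    intro h1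
    apply h0
    rw [← h.self_of_nhds.1, h1, zero_pow (by norm_num)]
  refine (((link_ellChart ht1 ht0).comp ht).smul (inv_mem hM)).congr ?_ ?_
  · filter_upwards [h] with y hy
    rw [hy.1]
  · filter_upwards [h, eventually_nhds_im_pos hx] with y h1 h2
    rw [h1.2, mob_inv_mob _ h2, id]

/-- A local fifth root `t` of `β` lies in the unit disc, and `ellChart ∘ t` is another branch over
the same `z`, so `Link.unique` supplies the matrix. -/
theorem Ell.of_link {β : ℂ → ℂ} {x : ℂ} (h : Link (fun y => (β y)⁻¹) id x) (h0 : β x ≠ 0)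
    (h1 : ‖β x‖ < 1) : Ell β x := by
  have hβ : AnalyticAt ℂ β x := by simpa using h.1.fun_inv (inv_ne_zero h0)
  obtain ⟨t, ht, hpow⟩ := exists_analyticAt_pow_eq hβ h0
  have ht0 : t x ≠ 0 := by
    intro h2
    apply h0
    rw [← hpow.self_of_nhds, h2, zero_pow (by norm_num)]
  have ht1 : t x ∈ Metric.ball (0 : ℂ) 1 := by
    rw [mem_ball_zero_iff]
    by_contra hc
    push Not at hc
    rw [← hpow.self_of_nhds, norm_pow] at h1
    exact absurd h1 (one_le_pow₀ hc).not_gt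
  have hl := ((link_ellChart ht1 ht0).comp ht).congr (ζ' := fun y => (β y)⁻¹)
    (by filter_upwards [hpow] with y hy; rw [hy]) (EventuallyEq.refl _ _)
  obtain ⟨M, hM, hu⟩ := h.unique hl
  exact ⟨M, hM, t, ht, ht1, hpow.and hu⟩

theorem Adm.link {β : ℂ → ℂ} {x : ℂ} (h : Adm β x) (h0 : β x ≠ 0) : Link (fun y => (β y)⁻¹) id x :=
  h.2.elim (fun h => h.2) fun h' => h'.link h.1 h0

theorem Adm.ell {β : ℂ → ℂ} {x : ℂ} (h : Adm β x) (h1 : ‖β x‖ < 1) : Ell β x :=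
  h.2.elim (fun h => Ell.of_link h.2 h.1 h1) id

theorem Adm.analyticAt {β : ℂ → ℂ} {x : ℂ} (h : Adm β x) : AnalyticAt ℂ β x := by
  rcases h.2 with h | ⟨M, hM, t, ht, -, h⟩
  · simpa using h.2.1.fun_inv (inv_ne_zero h.1)
  · exact (ht.fun_pow 5).congr (h.mono fun y hy => hy.1)

theorem Adm.congr {β β' : ℂ → ℂ} {x : ℂ} (h : Adm β x) (he : β' =ᶠ[𝓝 x] β) : Adm β' x := by
  refine ⟨h.1, ?_⟩
  rcases h.2 with ⟨h0, h⟩ | ⟨M, hM, t, ht, ht1, h⟩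
  · refine Or.inl ⟨by rwa [he.self_of_nhds], h.congr ?_ (EventuallyEq.refl _ _)⟩
    filter_upwards [he] with y hy
    rw [hy]
  · refine Or.inr ⟨M, hM, t, ht, ht1, ?_⟩
    filter_upwards [h, he] with y h1 h2
    rwa [h2]

/-- Branches of the Hauptmodul extend to hyperbolic discs of a fixed radius. -/
theorem exists_adm_extension : ∃ δ > 0, ∀ (τ : ℍ) (β : ℂ → ℂ), Adm β τ →
    ∃ β' : ℂ → ℂ, β' =ᶠ[𝓝 (τ : ℂ)] β ∧ ∀ τ' : ℍ, dist τ' τ < δ → Adm β' τ' := by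
  -- If `|z| ≤ 32`, then `z` or `1 - z` lies in `K`, since `|1 - z| ≤ 33`. Otherwise `|b| < 1/32 =
  -- (1/2)⁵`, and the fifth root of `b` lies in the disc of radius `1/2` of the elliptic chart.
  -- These compact sets cover all cases.
  set K : Set ℂ := Metric.closedBall 0 40 ∩ {z | z.re ≤ 1 / 2} with hKdef
  have hK : IsCompact K := (isCompact_closedBall _ _).inter_right
    (isClosed_le Complex.continuous_re continuous_const)
  have hKD : K ⊆ cutPlane := fun z hz => by
    rw [mem_cutPlane, Complex.mem_slitPlane_iff]
    have : z.re ≤ 1 / 2 := hz.2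
    left
    simp
    linarith
  obtain ⟨r, hr, hinv⟩ := exists_uniform_local_inverse isOpen_cutPlane
    (fun z hz => differentiableAt_nome hz) (fun z hz => deriv_nome_ne_zero hz) hK hKD
  obtain ⟨δ₁, hδ₁, hq⟩ := exists_dist_cuspParam_lt hr
  have hKE : Metric.closedBall (0 : ℂ) (1 / 2) ⊆ Metric.ball 0 1 :=
    Metric.closedBall_subset_ball (by norm_num)
  obtain ⟨r', hr', hinv'⟩ := exists_uniform_local_inverse Metric.isOpen_ball
    (fun z hz => differentiableAt_ellChart hz) (fun z hz => deriv_ellChart_ne_zero hz)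
    (isCompact_closedBall (0 : ℂ) (1 / 2)) hKE
  obtain ⟨Y, hY⟩ := (isCompact_closedBall (0 : ℂ) (1 / 2)).exists_bound_of_continuousOn
    (f := ellChart) fun t ht => (differentiableAt_ellChart (hKE ht)).continuousAt.continuousWithinAt
  have hY0 : 0 ≤ Y := (norm_nonneg _).trans (hY 0 (Metric.mem_closedBall_self (by norm_num)))
  -- Points in the image of the elliptic chart have imaginary part at most `Y`, so hyperbolic
  -- distance below `log (1 + s)` means Euclidean distance at most `Y s < r'`.
  set s := r' / (Y + 1) with hs
  have hs0 : 0 < s := by positivity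
  refine ⟨min δ₁ (Real.log (1 + s)), lt_min hδ₁ (Real.log_pos (by linarith)), fun τ β hβ => ?_⟩
  have hβc := hβ.analyticAt.continuousAt
  have hcusp : ∀ x : ℂ, 0 < x.im → AnalyticAt ℂ cuspParam x := fun x _ => by
    unfold cuspParam
    fun_prop
  by_cases hsmall : ‖β τ‖ < 1 / 32
  · obtain ⟨M, hM, t, ht, ht1, hev⟩ := hβ.ell (hsmall.trans (by norm_num))
    have htK : t τ ∈ Metric.closedBall (0 : ℂ) (1 / 2) := by
      rw [mem_closedBall_zero_iff]
      by_contra hc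
      push Not at hc
      rw [← hev.self_of_nhds.1, norm_pow] at hsmall
      have := pow_lt_pow_left₀ hc (by norm_num) (n := 5) (by norm_num)
      norm_num at this hsmall
      linarith
    obtain ⟨R, hR1, hR2⟩ := hinv' _ htK
    obtain ⟨t', ht', h'⟩ := exists_lift (Q := ellChart) (g := id) (N := M) (τ := τ) (ζ := t)
      (δ := min δ₁ (Real.log (1 + s))) hR1 hR2 (fun x _ => analyticAt_id) (by
        intro τ' hτ'
        have h1 : dist τ' (M • τ) < Real.log (1 + s) := hτ'.trans_le (min_le_right _ _)
        have hexp : Real.exp (dist τ' (M • τ)) - 1 < s := by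
          have := (Real.lt_log_iff_exp_lt (by linarith)).1 h1
          linarith
        have him : (M • τ).im ≤ Y := by
          have h2 : ellChart (t τ) = ↑(M • τ) := by rw [hev.self_of_nhds.2, mob_coe]
          have h3 := hY _ htK
          rw [h2] at h3
          exact ((le_abs_self _).trans (Complex.abs_im_le_norm _)).trans h3
        rw [id, id, ← dist_eq_norm]
        refine (UpperHalfPlane.dist_coe_le τ' (M • τ)).trans_lt ?_
        have h4 : (Y + 1) * s = r' := by rw [hs]; field_simp
        have h5 : 0 ≤ Real.exp (dist τ' (M • τ)) - 1 := by
          linarith [Real.add_one_le_exp (dist τ' (M • τ)), dist_nonneg (x := τ') (y := M • τ)]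
        nlinarith [(M • τ).im_pos])
      ht.continuousAt (hev.mono fun y hy => by rw [hy.2, id])
    refine ⟨fun y => t' y ^ 5, ?_, fun τ' hτ' => ?_⟩
    · filter_upwards [ht', hev] with y h1 h2
      rw [h1, h2.1]
    · obtain ⟨h1, h2, h3⟩ := h' τ' hτ'
      exact ⟨τ'.im_pos, Or.inr ⟨M, hM, t', h1, h2, h3.mono fun y hy => ⟨rfl, hy⟩⟩⟩
  · push Not at hsmall
    have h0 : β τ ≠ 0 := by
      intro h
      rw [h, norm_zero] at hsmall
      norm_num at hsmall
    have hlink := hβ.link h0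
    have hnorm : ‖(β τ)⁻¹‖ ≤ 32 := by
      rw [norm_inv]
      exact (inv_anti₀ (by norm_num) hsmall).trans (by norm_num)
    have hζc := hlink.1.continuousAt
    rcases le_or_gt ((β τ)⁻¹).re (1 / 2) with hre | hre
    · have hmem : (β τ)⁻¹ ∈ K := ⟨by rw [mem_closedBall_zero_iff]; linarith, hre⟩
      obtain ⟨M, hM, hev⟩ := hlink.left (hKD hmem)
      obtain ⟨R, hR1, hR2⟩ := hinv _ hmem
      obtain ⟨ζ', hζ', h'⟩ := exists_lift (Q := nome) (g := cuspParam) (N := M) (τ := τ)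
        (ζ := fun y => (β y)⁻¹) (δ := min δ₁ (Real.log (1 + s))) hR1 hR2 hcusp
        (fun τ' hτ' => hq _ _ (hτ'.trans_le (min_le_left _ _))) hζc
        (hev.mono fun y hy => by rw [← hy, id])
      refine ⟨fun y => (ζ' y)⁻¹, ?_, fun τ' hτ' => ?_⟩
      · filter_upwards [hζ'] with y hy
        rw [hy, inv_inv]
      · obtain ⟨h1, h2, h3⟩ := h' τ' hτ'
        have hne : ζ' τ' ≠ 0 := by
          intro h4
          have := h3.self_of_nhds
          rw [h4, nome_zero] at this
          exact cuspParam_ne_zero _ this.symm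
        refine ⟨τ'.im_pos, Or.inl ⟨inv_ne_zero hne, ?_⟩⟩
        simp only [inv_inv]
        exact ⟨h1, analyticAt_id, τ'.im_pos, M, hM, Or.inl ⟨h2, h3.mono fun y hy => by
          rw [hy, id]⟩⟩
    · have hmem : 1 - (β τ)⁻¹ ∈ K := by
        refine ⟨?_, ?_⟩
        · rw [mem_closedBall_zero_iff]
          refine (norm_sub_le _ _).trans ?_
          rw [norm_one]
          linarith
        · show (1 - (β τ)⁻¹).re ≤ 1 / 2
          rw [Complex.sub_re, Complex.one_re]
          linarith
      obtain ⟨M, hM, hev⟩ := hlink.right (hKD hmem)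
      obtain ⟨R, hR1, hR2⟩ := hinv _ hmem
      obtain ⟨ζ', hζ', h'⟩ := exists_lift (Q := nome) (g := cuspParam) (N := sMat * M) (τ := τ)
        (ζ := fun y => 1 - (β y)⁻¹) (δ := min δ₁ (Real.log (1 + s))) hR1 hR2 hcusp
        (fun τ' hτ' => hq _ _ (hτ'.trans_le (min_le_left _ _))) (continuousAt_const.sub hζc)
        (by
          filter_upwards [hev, eventually_nhds_im_pos τ.im_pos] with y h1 h2
          rw [← h1, mob_mul _ _ h2, id])
      refine ⟨fun y => (1 - ζ' y)⁻¹, ?_, fun τ' hτ' => ?_⟩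
      · filter_upwards [hζ'] with y hy
        rw [hy, sub_sub_cancel, inv_inv]
      · obtain ⟨h1, h2, h3⟩ := h' τ' hτ'
        have hne : 1 - ζ' τ' ≠ 0 := Complex.slitPlane_ne_zero h2
        refine ⟨τ'.im_pos, Or.inl ⟨inv_ne_zero hne, ?_⟩⟩
        simp only [inv_inv]
        refine ⟨analyticAt_const.sub h1, analyticAt_id, τ'.im_pos, M, hM, Or.inr ⟨?_, ?_⟩⟩
        · rwa [sub_sub_cancel]
        · filter_upwards [h3, eventually_nhds_im_pos τ'.im_pos] with y h1 h2
          rw [sub_sub_cancel, h1, mob_mul _ _ h2, id]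

/-- The uniform hyperbolic radius is in particular a locally uniform Euclidean one, so admissible
germs continue over `ℍ`. The initial germ is the reciprocal of the local inverse of `hypTau` at `z =
1/2`. -/
theorem exists_hauptmodul : ∃ b : ℂ → ℂ, (∀ x : ℂ, 0 < x.im → Adm b x) ∧
    ∀ᶠ z in 𝓝 (1 / 2 : ℂ), b (hypTau z) = z⁻¹ := by
  have hz : (1 / 2 : ℂ) ∈ doubleCutPlane := by
    have := ofReal_mem_doubleCutPlane (x := 1 / 2) (by norm_num) (by norm_num)
    simpa using this
  have hc := hypTau_im_pos hz
  obtain ⟨r, hr, hinv⟩ := exists_uniform_local_inverse (Q := hypTau) isOpen_doubleCutPlane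
    (fun z hz => (hasDerivAt_hypTau hz).differentiableAt) (fun z hz => by
      rw [(hasDerivAt_hypTau hz).deriv]
      have hπ : (Real.pi : ℂ) ≠ 0 := by exact_mod_cast Real.pi_ne_zero
      obtain ⟨hz0, hz1⟩ := doubleCutPlane_ne hz
      exact div_ne_zero (neg_ne_zero.2 (mul_ne_zero Complex.I_ne_zero (div_ne_zero width_ne_zero
        (mul_ne_zero two_ne_zero hπ)))) (mul_ne_zero (mul_ne_zero hz0 hz1)
        (pow_ne_zero 2 (hyp_ne_zero hz.1)))) isCompact_singleton (Set.singleton_subset_iff.2 hz)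
  obtain ⟨R, hR1, hR2⟩ := hinv _ rfl
  have hRc : R (hypTau (1 / 2)) = 1 / 2 := hR2.self_of_nhds
  have hRan : AnalyticAt ℂ R (hypTau (1 / 2)) :=
    (DifferentiableOn.analyticOnNhd (fun y hy => (hR1 y hy).1.differentiableWithinAt)
      Metric.isOpen_ball) _ (Metric.mem_ball_self hr)
  obtain ⟨δ, hδ, hext⟩ := exists_adm_extension
  have hloc : ∀ x₀ : ℂ, 0 < x₀.im → ∃ ε > 0, ∀ β, ∀ x ∈ Metric.ball x₀ ε, Adm β x →
      ∃ β', β' =ᶠ[𝓝 x] β ∧ ∀ y ∈ Metric.ball x ε, Adm β' y := by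
    intro x₀ hx₀
    obtain ⟨ε, hε, hball⟩ : ∃ ε > 0, ∀ y ∈ Metric.ball x₀ ε, ∃ hy : 0 < y.im,
        dist (⟨y, hy⟩ : ℍ) ⟨x₀, hx₀⟩ < δ / 2 := by
      have hcont : ContinuousAt UpperHalfPlane.ofComplex x₀ :=
        (UpperHalfPlane.contMDiffAt_ofComplex (n := ⊤) hx₀).continuousAt
      have h1 := hcont.eventually_mem (Metric.ball_mem_nhds _ (half_pos hδ))
      obtain ⟨ε, hε, h⟩ := Metric.eventually_nhds_iff_ball.1
        (h1.and (eventually_nhds_im_pos hx₀))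
      refine ⟨ε, hε, fun y hy => ?_⟩
      obtain ⟨this, hyim⟩ := h y hy
      refine ⟨hyim, ?_⟩
      rwa [UpperHalfPlane.ofComplex_apply_of_im_pos hyim,
        UpperHalfPlane.ofComplex_apply_of_im_pos hx₀, Metric.mem_ball] at this
    refine ⟨ε / 2, half_pos hε, fun β x hx hβ => ?_⟩
    obtain ⟨hxim, hxd⟩ := hball x (Metric.ball_subset_ball (by linarith) hx)
    obtain ⟨β', h1, h2⟩ := hext ⟨x, hxim⟩ β hβ
    refine ⟨β', h1, fun y hy => ?_⟩
    have hy' : y ∈ Metric.ball x₀ ε := by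
      rw [Metric.mem_ball] at hx hy ⊢
      linarith [dist_triangle y x x₀]
    obtain ⟨hyim, hyd⟩ := hball y hy'
    refine h2 ⟨y, hyim⟩ ?_
    have := dist_triangle_right (⟨y, hyim⟩ : ℍ) ⟨x, hxim⟩ ⟨x₀, hx₀⟩
    linarith
  have hbase : Adm (fun y => (R y)⁻¹) (hypTau (1 / 2)) := by
    refine ⟨hc, Or.inl ⟨by simp only [hRc]; norm_num, ?_⟩⟩
    simp only [inv_inv]
    refine (Link.comp (g := R) (by rw [hRc]; exact link_hypTau hz) hRan).congr
      (EventuallyEq.refl _ _) ?_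
    filter_upwards [Metric.isOpen_ball.eventually_mem (Metric.mem_ball_self hr)] with y hy
    rw [(hR1 y hy).2.2, id]
  obtain ⟨b, hb1, hb2⟩ := exists_extension_upperHalfPlane (P := Adm) (β := fun y => (R y)⁻¹) hc
    (fun β β' x h he => h.congr he) (fun β x h => h.analyticAt) hloc hbase
  refine ⟨b, hb2, ?_⟩
  filter_upwards [(hasDerivAt_hypTau hz).continuousAt.eventually hb1, hR2] with z h1 h2
  rw [h1, h2]

end Hauptmodul

/-! ### Values, invariance and cusps of the Hauptmodul. -/

section HauptmodulProperties

theorem isOpen_upperHalfPlane : IsOpen {x : ℂ | 0 < x.im} :=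
  isOpen_lt continuous_const Complex.continuous_im

theorem isPreconnected_upperHalfPlane : IsPreconnected {x : ℂ | 0 < x.im} :=
  (convex_halfSpace_im_gt 0).isPreconnected

/-- The Hauptmodul `b = 1 / z`, as a function on the complex plane that is meaningful on the upper
half-plane. -/
def hptm : ℂ → ℂ := exists_hauptmodul.choose

theorem adm_hptm {x : ℂ} (hx : 0 < x.im) : Adm hptm x := exists_hauptmodul.choose_spec.1 x hx

theorem analyticAt_hptm {x : ℂ} (hx : 0 < x.im) : AnalyticAt ℂ hptm x := (adm_hptm hx).analyticAt

theorem deriv_hypTau_ne_zero {z : ℂ} (hz : z ∈ doubleCutPlane) : deriv hypTau z ≠ 0 := by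
  rw [(hasDerivAt_hypTau hz).deriv]
  have hπ : (Real.pi : ℂ) ≠ 0 := by exact_mod_cast Real.pi_ne_zero
  obtain ⟨hz0, hz1⟩ := doubleCutPlane_ne hz
  exact div_ne_zero (neg_ne_zero.2 (mul_ne_zero Complex.I_ne_zero (div_ne_zero width_ne_zero
    (mul_ne_zero two_ne_zero hπ)))) (mul_ne_zero (mul_ne_zero hz0 hz1)
    (pow_ne_zero 2 (hyp_ne_zero hz.1)))

theorem analyticAt_hypTau {z : ℂ} (hz : z ∈ doubleCutPlane) : AnalyticAt ℂ hypTau z :=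
  (link_hypTau hz).2.1

theorem map_hypTau_nhds {z : ℂ} (hz : z ∈ doubleCutPlane) : map hypTau (𝓝 z) = 𝓝 (hypTau z) :=
  (analyticAt_hypTau hz).hasStrictDerivAt.map_nhds_eq (deriv_hypTau_ne_zero hz)

theorem half_mem_doubleCutPlane : (1 / 2 : ℂ) ∈ doubleCutPlane := by
  have := ofReal_mem_doubleCutPlane (x := 1 / 2) (by norm_num) (by norm_num)
  simpa using this

theorem hptm_hypTau {z : ℂ} (hz : z ∈ doubleCutPlane) : hptm (hypTau z) = z⁻¹ := by
  have h1 : AnalyticOnNhd ℂ (fun z => hptm (hypTau z)) doubleCutPlane := fun z hz =>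
    (analyticAt_hptm (hypTau_im_pos hz)).fun_comp (analyticAt_hypTau hz)
  have h2 : AnalyticOnNhd ℂ (fun z : ℂ => z⁻¹) doubleCutPlane := fun z hz =>
    analyticAt_id.fun_inv (doubleCutPlane_ne hz).1
  exact h1.eqOn_of_preconnected_of_eventuallyEq h2 isPreconnected_doubleCutPlane
    half_mem_doubleCutPlane exists_hauptmodul.choose_spec.2 hz

theorem hptm_ellChart {t : ℂ} (ht : t ∈ Metric.ball (0 : ℂ) 1) : hptm (ellChart t) = t ^ 5 := by
  have h1 : AnalyticOnNhd ℂ (fun t => hptm (ellChart t)) (Metric.ball 0 1) := fun t ht =>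
    (analyticAt_hptm (ellChart_im_pos ht)).fun_comp ((DifferentiableOn.analyticOnNhd (fun _ hy =>
      (differentiableAt_ellChart hy).differentiableWithinAt) Metric.isOpen_ball) t ht)
  have h2 : AnalyticOnNhd ℂ (fun t : ℂ => t ^ 5) (Metric.ball 0 1) := fun t ht =>
    analyticAt_id.fun_pow 5
  obtain ⟨t₀, ht₀, h0, hz₀, he⟩ := exists_ellChart_eq
  refine h1.eqOn_of_preconnected_of_eventuallyEq h2 (convex_ball 0 1).isPreconnected ht₀ ?_ ht
  have hc : ContinuousAt (fun t : ℂ => (t ^ 5)⁻¹) t₀ :=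
    (continuousAt_id.pow 5).inv₀ (pow_ne_zero 5 h0)
  filter_upwards [he, hc.eventually_mem (isOpen_doubleCutPlane.mem_nhds hz₀)] with t h1 h2
  rw [h1, hptm_hypTau h2, inv_inv]

/-- At `z = 1` only the chart in `1 - z` is available. Its nome vanishes there, while an exponential
does not. -/
theorem hptm_ne_one {x : ℂ} (hx : 0 < x.im) : hptm x ≠ 1 := by
  intro h
  have hl := (adm_hptm hx).link (by rw [h]; exact one_ne_zero)
  have hn : (1 : ℂ) ∉ cutPlane := by simp [mem_cutPlane]
  rcases hl.cases with h1 | h1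
  · simp only [h, inv_one] at h1
    exact hn h1
  · obtain ⟨M, -, h2⟩ := hl.right h1
    have := h2.self_of_nhds
    rw [h, inv_one, sub_self, nome_zero] at this
    exact cuspParam_ne_zero _ this

/-- The expansion of the Hauptmodul at the cusp `i∞`. -/
theorem exists_cusp_expansion : ∃ (R : ℂ → ℂ) (r Y : ℝ), 0 < r ∧ 0 < Y ∧ R 0 = 0 ∧
    (∀ w ∈ Metric.ball (0 : ℂ) r, DifferentiableAt ℂ R w) ∧
    ∀ x : ℂ, Y < x.im → cuspParam x ∈ Metric.ball (0 : ℂ) r ∧ hptm x * R (cuspParam x) = 1 := by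
  obtain ⟨r, hr, hinv⟩ := exists_uniform_local_inverse isOpen_cutPlane
    (fun z hz => differentiableAt_nome hz) (fun z hz => deriv_nome_ne_zero hz) isCompact_singleton
    (Set.singleton_subset_iff.2 zero_mem_cutPlane)
  obtain ⟨R, hR1, hR2⟩ := hinv _ rfl
  rw [nome_zero] at hR1
  set C := 2 * Real.pi / width with hC
  have hC0 : 0 < C := div_pos (by positivity) width_pos
  set Y := max 1 (-Real.log r / C) with hY
  have hlt : ∀ x : ℂ, Y < x.im → cuspParam x ∈ Metric.ball (0 : ℂ) r := by
    intro x hx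
    rw [mem_ball_zero_iff, norm_cuspParam, ← Real.lt_log_iff_exp_lt hr]
    have : -Real.log r / C < x.im := (le_max_right _ _).trans_lt hx
    rw [div_lt_iff₀ hC0] at this
    linarith
  have hYpos : 0 < Y := lt_of_lt_of_le one_pos (le_max_left _ _)
  refine ⟨R, r, Y, hr, hYpos, by simpa [nome_zero] using hR2.self_of_nhds,
    fun w hw => (hR1 w hw).1, fun x hx => ⟨hlt x hx, ?_⟩⟩
  have hcusp : ∀ x : ℂ, AnalyticAt ℂ cuspParam x := fun x => by
    unfold cuspParam
    fun_prop
  have h1 : AnalyticOnNhd ℂ (fun x => hptm x * R (cuspParam x)) {x | Y < x.im} := fun x hx =>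
    (analyticAt_hptm (hYpos.trans hx)).fun_mul (((DifferentiableOn.analyticOnNhd (fun y hy =>
      (hR1 y hy).1.differentiableWithinAt) Metric.isOpen_ball) _ (hlt x hx)).fun_comp (hcusp x))
  have hsmall : ∀ᶠ z in 𝓝 (0 : ℂ), ‖nome z‖ < Real.exp (-(C * Y)) := by
    have := (differentiableAt_nome zero_mem_cutPlane).continuousAt.norm
    refine this.eventually_lt continuousAt_const ?_
    rw [nome_zero, norm_zero]
    exact Real.exp_pos _
  have hreal : Tendsto (fun s : ℝ => (s : ℂ)) (𝓝[>] 0) (𝓝 0) := by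
    have := (Complex.continuous_ofReal.tendsto 0).mono_left
      (nhdsWithin_le_nhds (s := Set.Ioi (0 : ℝ)))
    simpa using this
  have hmem : ∀ᶠ s : ℝ in 𝓝[>] 0, s ∈ Set.Ioo (0 : ℝ) 1 := Ioo_mem_nhdsGT one_pos
  -- For small real `s > 0` the point `hypTau s` lies above height `Y`, and near it `R` inverts the
  -- nome while `b = 1 / z`. The identity theorem carries the relation to the whole half-plane `Im >
  -- Y`.
  obtain ⟨s, ⟨h2, h3⟩, hs⟩ := ((hreal.eventually (hsmall.and hR2.eventually_nhds)).and hmem).exists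
  have hsD := ofReal_mem_doubleCutPlane hs.1 hs.2
  have him : Y < (hypTau s).im := by
    rw [nome_eq hsD, norm_cuspParam, Real.exp_lt_exp] at h2
    have : C * Y < C * (hypTau s).im := by linarith
    exact lt_of_mul_lt_mul_left this hC0.le
  refine h1.eqOn_of_preconnected_of_eventuallyEq (fun x _ => analyticAt_const)
    (convex_halfSpace_im_gt Y).isPreconnected him (g := fun _ => 1) ?_ hx
  rw [EventuallyEq, ← map_hypTau_nhds hsD, eventually_map]
  filter_upwards [h3, isOpen_doubleCutPlane.eventually_mem hsD] with z h4 h5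
  rw [hptm_hypTau h5, ← nome_eq h5, h4, inv_mul_cancel₀ (doubleCutPlane_ne h5).1]

/-- High in the half-plane `b` is a function of `q`, which has this period; the identity theorem
does the rest. -/
theorem hptm_add_width {x : ℂ} (hx : 0 < x.im) : hptm (x + width) = hptm x := by
  obtain ⟨R, r, Y, hr, hY, -, -, h⟩ := exists_cusp_expansion
  have him : ∀ y : ℂ, (y + width).im = y.im := fun y => by simp
  have h1 : AnalyticOnNhd ℂ (fun x => hptm (x + width)) {x | 0 < x.im} := fun x hx =>
    AnalyticAt.fun_comp (f := fun x => x + (width : ℂ))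
      (analyticAt_hptm (by rwa [him])) (analyticAt_id.add analyticAt_const)
  have hx₁ : Y < (((Y + 1 : ℝ) : ℂ) * Complex.I).im := by simp
  refine h1.eqOn_of_preconnected_of_eventuallyEq (fun x hx => analyticAt_hptm hx)
    isPreconnected_upperHalfPlane (z₀ := ((Y + 1 : ℝ) : ℂ) * Complex.I) (hY.trans hx₁) ?_ hx
  filter_upwards [(isOpen_lt continuous_const Complex.continuous_im).eventually_mem hx₁] with y hy
  have e : cuspParam (y + width) = cuspParam y := cuspParam_eq_iff.2 ⟨1, by simp⟩
  have h2 := (h y hy).2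
  have h3 := (h (y + width) (by rw [him]; exact hy)).2
  rw [e] at h3
  exact mul_right_cancel₀ (right_ne_zero_of_mul_eq_one h2) (h3.trans h2.symm)

/-- This is `z ↦ 1 - z` written for `b = 1 / z`, multiplied out. It holds on values of `hypTau` near
`z = 1/2` by `hypTau_one_sub`, hence everywhere. -/
theorem hptm_sMat {x : ℂ} (hx : 0 < x.im) : hptm (mob sMat x) * (hptm x - 1) = hptm x := by
  have h1 : AnalyticOnNhd ℂ (fun x => hptm (mob sMat x) * (hptm x - 1)) {x | 0 < x.im} :=
    fun x hx => ((analyticAt_hptm (mob_im_pos _ hx)).fun_comp (analyticAt_mob _ hx)).fun_mul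
      ((analyticAt_hptm hx).sub analyticAt_const)
  refine h1.eqOn_of_preconnected_of_eventuallyEq (fun x hx => analyticAt_hptm hx)
    isPreconnected_upperHalfPlane (hypTau_im_pos half_mem_doubleCutPlane) ?_ hx
  rw [EventuallyEq, ← map_hypTau_nhds half_mem_doubleCutPlane, eventually_map]
  filter_upwards [isOpen_doubleCutPlane.eventually_mem half_mem_doubleCutPlane] with z hz
  obtain ⟨hz0, hz1⟩ := doubleCutPlane_ne hz
  rw [mob_sMat, ← hypTau_one_sub hz, hptm_hypTau hz, hptm_hypTau (one_sub_mem_doubleCutPlane hz)]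
  field_simp

theorem hptm_sMat_eq {x : ℂ} (hx : 0 < x.im) : hptm (mob sMat x) = hptm x / (hptm x - 1) := by
  rw [eq_div_iff (sub_ne_zero.2 (hptm_ne_one hx)), hptm_sMat hx]

theorem hptm_tMat {x : ℂ} (hx : 0 < x.im) : hptm (mob tMat x) = hptm x := by
  rw [mob_tMat, hptm_add_width hx]

theorem hptm_uMat {x : ℂ} (hx : 0 < x.im) : hptm (mob uMat x) = hptm x := by
  have h1 := mob_im_pos sMat⁻¹ hx
  rw [uMat_eq, mul_assoc, mob_mul _ _ hx, mob_mul _ _ hx, hptm_sMat_eq (mob_im_pos _ h1),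
    hptm_tMat h1, ← hptm_sMat_eq h1, ← mob_mul _ _ hx, mul_inv_cancel, mob_one]

theorem hptm_mob {M : SL(2, ℝ)} (hM : M ∈ Γs) : ∀ {x : ℂ}, 0 < x.im → hptm (mob M x) = hptm x := by
  induction hM using Subgroup.closure_induction with
  | mem M hM =>
    rcases hM with rfl | rfl
    · exact hptm_tMat
    · exact hptm_uMat
  | one => simp [mob_one]
  | mul M N _ _ h1 h2 =>
    intro x hx
    rw [mob_mul _ _ hx, h1 (mob_im_pos _ hx), h2 hx]
  | inv M _ h =>
    intro x hx
    rw [← h (mob_im_pos _ hx), ← mob_mul _ _ hx, mul_inv_cancel, mob_one]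

/-- Where `b ≠ 0` this is `Link.unique` for frozen germs. Every zero of `b` is moved by the group to
the single point `ellChart 0`. -/
theorem exists_mob_eq_of_hptm_eq {x x' : ℂ} (hx : 0 < x.im) (hx' : 0 < x'.im)
    (h : hptm x = hptm x') : ∃ M ∈ Γs, mob M x = x' := by
  by_cases h0 : hptm x = 0
  · have key : ∀ y : ℂ, 0 < y.im → hptm y = 0 → ∃ M ∈ Γs, mob M y = ellChart 0 := by
      intro y hy hy0
      obtain ⟨M, hM, t, ht, ht1, h⟩ := (adm_hptm hy).ell (by rw [hy0, norm_zero]; exact one_pos)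
      have h1 := h.self_of_nhds
      have ht0 : t y = 0 := by
        rw [hy0] at h1
        exact pow_eq_zero_iff (by norm_num) |>.1 h1.1
      exact ⟨M, hM, by rw [← h1.2, ht0]⟩
    obtain ⟨M, hM, h1⟩ := key x hx h0
    obtain ⟨N, hN, h2⟩ := key x' hx' (h ▸ h0)
    exact ⟨N⁻¹ * M, mul_mem (inv_mem hN) hM, by rw [mob_mul _ _ hx, h1, ← h2, mob_inv_mob _ hx']⟩
  · have l1 := ((adm_hptm hx).link h0).const
    have l2 := ((adm_hptm hx').link (h ▸ h0)).const
    rw [← h] at l2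
    obtain ⟨M, hM, h1⟩ := l1.unique l2
    exact ⟨M, hM, h1.self_of_nhds.symm⟩

/-- The nome, unlike `hypTau`, is defined across the negative reals. A local logarithm of it differs
from `hypTau` by a period off the cut, and the value of `b` at `z` itself follows by continuity. -/
theorem exists_hptm_eq_inv {z : ℂ} (hz : z ∈ cutPlane) (h0 : z ≠ 0) :
    ∃ x : ℂ, 0 < x.im ∧ hptm x = z⁻¹ := by
  obtain ⟨τ, hτ, him, h⟩ := exists_cuspParam_comp_eq (analyticAt_nome hz) (nome_ne_zero hz h0)
    (norm_nome_lt_one hz)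
  refine ⟨τ z, him, ?_⟩
  obtain ⟨u, hu, huz⟩ := mem_closure_iff_seq_limit.1 (cutPlane_subset_closure hz)
  have h1 : Tendsto (fun n => hptm (τ (u n))) atTop (𝓝 (hptm (τ z))) :=
    ((analyticAt_hptm him).continuousAt.tendsto.comp hτ.continuousAt.tendsto).comp huz
  have h2 : Tendsto (fun n => (u n)⁻¹) atTop (𝓝 z⁻¹) := huz.inv₀ h0
  refine tendsto_nhds_unique_of_eventuallyEq h1 h2 ?_
  filter_upwards [huz.eventually h, huz.eventually (eventually_im_pos hτ.continuousAt him)]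
    with n h3 h4
  rw [nome_eq (hu n)] at h3
  obtain ⟨k, hk⟩ := cuspParam_eq_iff.1 h3
  rw [hk, ← mob_tMat_zpow _ (hypTau_im_pos (hu n)), hptm_mob (zpow_mem tMat_mem k)
    (hypTau_im_pos (hu n)), hptm_hypTau (hu n)]

/-- The value `0` is attained at `ellChart 0`. Otherwise `1/p` or `1 - 1/p` lies in the cut plane,
and the inversion reduces the second case to the first. -/
theorem exists_hptm_eq {p : ℂ} (hp : p ≠ 1) : ∃ x : ℂ, 0 < x.im ∧ hptm x = p := by
  by_cases h0 : p = 0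
  · have h := Metric.mem_ball_self (x := (0 : ℂ)) one_pos
    exact ⟨ellChart 0, ellChart_im_pos h, by rw [hptm_ellChart h, h0]; norm_num⟩
  · rcases cutPlane_or p⁻¹ with h | h
    · simpa using exists_hptm_eq_inv h (inv_ne_zero h0)
    · have h1 : p - 1 ≠ 0 := sub_ne_zero.2 hp
      have h2 : 1 - p⁻¹ ≠ 0 := by
        intro h2
        apply h1
        field_simp at h2
        simpa using h2
      obtain ⟨x, hx, h3⟩ := exists_hptm_eq_inv h h2
      refine ⟨mob sMat x, mob_im_pos _ hx, ?_⟩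
      rw [hptm_sMat_eq hx, h3]
      have h4 : 1 - p⁻¹ = (p - 1) / p := by field_simp
      rw [h4, inv_div]
      have h5 : p / (p - 1) - 1 = 1 / (p - 1) := by
        field_simp
        ring
      rw [h5]
      field_simp

/-- By `Link`, the nome at a suitable translate is locally a function of `b`. Its derivative in the
variable of `ℍ` never vanishes, so that of `b` cannot vanish either. -/
theorem deriv_hptm_ne_zero {x : ℂ} (hx : 0 < x.im) (h0 : hptm x ≠ 0) : deriv hptm x ≠ 0 := by
  intro hd
  have hl := (adm_hptm hx).link h0
  have hb : HasDerivAt hptm 0 x := by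
    rw [← hd]
    exact (analyticAt_hptm hx).differentiableAt.hasDerivAt
  have hbi : HasDerivAt (fun y => (hptm y)⁻¹) 0 x := by
    refine HasDerivAt.congr_deriv (hb.inv h0) ?_
    simp
  have key : ∀ N : SL(2, ℝ), ∀ g : ℂ → ℂ, HasDerivAt g 0 x →
      ¬ ∀ᶠ y in 𝓝 x, cuspParam (mob N y) = g y := by
    intro N g hg h
    have h1 := (hasDerivAt_cuspParam (mob N x)).comp x (hasDerivAt_mob N hx)
    have h2 := h1.unique (hg.congr_of_eventuallyEq h)
    exact mul_ne_zero (cuspParam_deriv_ne_zero _)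
      (one_div_ne_zero (pow_ne_zero 2 (mob_denom_ne_zero N hx))) h2
  rcases hl.cases with h1 | h1
  · obtain ⟨M, -, h2⟩ := hl.left h1
    refine key M _ ?_ h2
    refine HasDerivAt.congr_deriv ((differentiableAt_nome h1).hasDerivAt.comp x hbi) ?_
    simp
  · obtain ⟨M, -, h2⟩ := hl.right h1
    refine key (sMat * M) (fun y => nome (1 - (hptm y)⁻¹)) ?_ ?_
    · refine HasDerivAt.congr_deriv ((differentiableAt_nome h1).hasDerivAt.comp x
        (hbi.const_sub 1)) ?_
      simp
    · filter_upwards [h2, eventually_nhds_im_pos hx] with y h3 h4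
      rw [mob_mul _ _ h4, ← h3, id]

/-- If `b ≠ 0` there, `b` would be locally injective, and its invariance would make `uMat * tMat`
the identity near the fixed point. Then `1 + y² + width y` vanishes on a neighbourhood;
differentiating gives `2 x + width = 0`, so `x` would be real. -/
theorem hptm_eq_zero_of_fixed {x : ℂ} (hx : 0 < x.im) (h : mob (uMat * tMat) x = x) :
    hptm x = 0 := by
  by_contra h0
  have hd := deriv_hptm_ne_zero hx h0
  have hs := (analyticAt_hptm hx).hasStrictDerivAt
  have hli := (hs.hasStrictFDerivAt_equiv hd).eventually_left_inverse
  have hcont : Tendsto (mob (uMat * tMat)) (𝓝 x) (𝓝 x) := by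
    have := (analyticAt_mob (uMat * tMat) hx).continuousAt.tendsto
    rwa [h] at this
  have hid : ∀ᶠ y : ℂ in 𝓝 x, 1 + y ^ 2 + width * y = 0 := by
    filter_upwards [hli, hcont.eventually hli, eventually_nhds_im_pos hx] with y h1 h2 h3
    rw [hptm_mob (mul_mem uMat_mem tMat_mem) h3, h1] at h2
    have h4 := mob_denom_ne_zero uMat (mob_im_pos tMat h3)
    rw [mob_mul _ _ h3, mob, eq_div_iff h4, mob_tMat] at h2
    simp [uMat] at h2
    have h5 : (width : ℂ) * (1 + y ^ 2 + width * y) = 0 := by linear_combination -h2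
    exact (mul_eq_zero.1 h5).resolve_left width_ne_zero
  have h1 : HasDerivAt (fun y : ℂ => 1 + y ^ 2 + width * y) (2 * x + width) x := by
    have := (((hasDerivAt_pow 2 x).const_add 1).add ((hasDerivAt_id x).const_mul (width : ℂ)))
    refine HasDerivAt.congr_deriv this ?_
    simp
  have h2 : HasDerivAt (fun y : ℂ => 1 + y ^ 2 + width * y) 0 x :=
    (hasDerivAt_const x (0 : ℂ)).congr_of_eventuallyEq hid
  have h3 := congrArg Complex.im (h1.unique h2)
  simp at h3
  exact hx.ne' h3

theorem tendsto_cuspParam_atImInfty : Tendsto (fun τ : ℍ => cuspParam τ) atImInfty (𝓝 0) := by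
  rw [tendsto_zero_iff_norm_tendsto_zero]
  simp only [norm_cuspParam]
  have hC0 : 0 < 2 * Real.pi / width := div_pos (by positivity) width_pos
  have h : Tendsto (fun y : ℝ => Real.exp (-(2 * Real.pi / width * y))) atTop (𝓝 0) :=
    Real.tendsto_exp_neg_atTop_nhds_zero.comp (tendsto_id.const_mul_atTop hC0)
  exact h.comp tendsto_comap

theorem isHauptmodul_hptm : IsHauptmodul fun τ => hptm τ := by
  obtain ⟨R, r, Y, hr, hY, hR0, hRd, hexp⟩ := exists_cusp_expansion
  have hR : Tendsto (fun τ : ℍ => R (cuspParam τ)) atImInfty (𝓝 0) := by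
    have := (hRd 0 (Metric.mem_ball_self hr)).continuousAt.tendsto
    rw [hR0] at this
    exact this.comp tendsto_cuspParam_atImInfty
  have hev : ∀ᶠ τ : ℍ in atImInfty, Y < τ.im := tendsto_comap.eventually (eventually_gt_atTop Y)
  refine ⟨?_, ?_, ?_, ?_, ?_, ?_⟩
  · refine DifferentiableOn.congr (f := hptm) (fun x hx =>
      (analyticAt_hptm hx).differentiableAt.differentiableWithinAt) fun x hx => ?_
    rw [Function.comp_apply, UpperHalfPlane.ofComplex_apply_of_im_pos hx]
  · intro τ τ'
    rw [exists_mem_Γ_smul_iff]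
    constructor
    · intro h
      obtain ⟨M, hM, h1⟩ := exists_mob_eq_of_hptm_eq τ.im_pos τ'.im_pos h
      refine ⟨M, hM, UpperHalfPlane.ext ?_⟩
      rw [← mob_coe]
      exact h1
    · rintro ⟨M, hM, rfl⟩
      rw [← mob_coe, hptm_mob hM τ.im_pos]
  · ext p
    constructor
    · rintro ⟨τ, rfl⟩
      exact hptm_ne_one τ.im_pos
    · intro hp
      obtain ⟨x, hx, h⟩ := exists_hptm_eq hp
      exact ⟨⟨x, hx⟩, h⟩
  · intro τ h
    apply hptm_eq_zero_of_fixed τ.im_pos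
    rw [mob_coe]
    exact congrArg UpperHalfPlane.coe h
  · have h1 : Tendsto (fun τ : ℍ => R (cuspParam τ)) atImInfty (𝓝[≠] 0) := by
      refine tendsto_nhdsWithin_iff.2 ⟨hR, ?_⟩
      filter_upwards [hev] with τ hτ
      exact right_ne_zero_of_mul_eq_one (hexp τ hτ).2
    refine (tendsto_inv₀_nhdsNE_zero.comp h1).congr' ?_
    filter_upwards [hev] with τ hτ
    exact (eq_inv_of_mul_eq_one_left (hexp τ hτ).2).symm
  · have h1 : Tendsto (fun τ : ℍ => (1 - R (cuspParam τ))⁻¹) atImInfty (𝓝 1) := by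
      have := (hR.const_sub 1).inv₀ (by norm_num)
      simpa using this
    refine h1.congr' ?_
    filter_upwards [hev] with τ hτ
    have h2 := (hexp τ hτ).2
    have h3 : ((ModularGroup.S • τ : ℍ) : ℂ) = mob sMat τ := by
      rw [UpperHalfPlane.modular_S_smul, mob_sMat]
      exact inv_neg
    rw [h3, hptm_sMat_eq τ.im_pos]
    have h4 := sub_ne_zero.2 (hptm_ne_one τ.im_pos)
    have h5 := left_ne_zero_of_mul_eq_one h2
    rw [eq_inv_of_mul_eq_one_right h2]
    rw [inv_eq_iff_eq_inv, inv_div]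
    field_simp

end HauptmodulProperties

/-! ### Flat functions, their representations and their quotients. -/

section FlatForms

/-- Holomorphic functions on the upper half-plane. -/
def IsHolo (N : ℍ → ℂ) : Prop := ∀ τ : ℍ, AnalyticAt ℂ (N ∘ UpperHalfPlane.ofComplex) τ

theorem IsHolo.isMeromorphic {N : ℍ → ℂ} (h : IsHolo N) : IsMeromorphic N := fun τ =>
  (h τ).meromorphicAt

theorem eventually_ofComplex (τ : ℍ) :
    ∀ᶠ y in 𝓝 (τ : ℂ), ∃ hy : 0 < y.im, UpperHalfPlane.ofComplex y = ⟨y, hy⟩ :=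
  (eventually_nhds_im_pos τ.im_pos).mono fun _ hy =>
    ⟨hy, UpperHalfPlane.ofComplex_apply_of_im_pos hy⟩

theorem isHolo_of_analyticAt {f : ℂ → ℂ} (hf : ∀ x : ℂ, 0 < x.im → AnalyticAt ℂ f x) :
    IsHolo fun τ => f τ := fun τ => (hf τ τ.im_pos).congr <| by
  filter_upwards [eventually_ofComplex τ] with y hy
  obtain ⟨hy, h⟩ := hy
  rw [Function.comp_apply, h]

theorem IsHolo.comp_smul {N : ℍ → ℂ} (h : IsHolo N)
    (γ : Matrix.ProjectiveSpecialLinearGroup (Fin 2) ℝ) : IsHolo fun τ => N (γ • τ) := by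
  obtain ⟨M, rfl⟩ := QuotientGroup.mk_surjective γ
  intro τ
  have h1 : AnalyticAt ℂ (N ∘ UpperHalfPlane.ofComplex) (mob M τ) := by
    rw [mob_coe]
    exact h _
  refine (h1.fun_comp (analyticAt_mob M τ.im_pos)).congr ?_
  filter_upwards [eventually_ofComplex τ] with y hy
  obtain ⟨hy, hy'⟩ := hy
  have h2 := mob_coe M ⟨y, hy⟩
  simp only at h2
  rw [Function.comp_apply, Function.comp_apply, hy', mk_smul, h2, UpperHalfPlane.ofComplex_apply]

theorem tendsto_coe_nhdsNE (τ : ℍ) : Tendsto ((↑) : ℍ → ℂ) (𝓝[≠] τ) (𝓝[≠] (τ : ℂ)) := by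
  refine tendsto_nhdsWithin_iff.2 ⟨(UpperHalfPlane.continuous_coe.tendsto τ).mono_left
    nhdsWithin_le_nhds, ?_⟩
  filter_upwards [self_mem_nhdsWithin] with τ' h h'
  exact h (UpperHalfPlane.ext h')

/-- A holomorphic function that does not vanish identically has isolated zeros. -/
theorem IsHolo.eventually_ne_zero {N : ℍ → ℂ} (h : IsHolo N) {τ₀ : ℍ} (h0 : N τ₀ ≠ 0) :
    ∀ᶠ τ in codiscrete ℍ, N τ ≠ 0 := by
  have hA : AnalyticOnNhd ℂ (N ∘ UpperHalfPlane.ofComplex) {x | 0 < x.im} := fun x hx => h ⟨x, hx⟩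
  have key : ∀ τ : ℍ, ∀ᶠ τ' in 𝓝[≠] τ, N τ' ≠ 0 := by
    intro τ
    rcases (h τ).eventually_eq_zero_or_eventually_ne_zero with h1 | h1
    · exfalso
      have := hA.eqOn_zero_of_preconnected_of_eventuallyEq_zero isPreconnected_upperHalfPlane
        τ.im_pos h1 τ₀.im_pos
      rw [Function.comp_apply, UpperHalfPlane.ofComplex_apply] at this
      exact h0 this
    · filter_upwards [(tendsto_coe_nhdsNE τ).eventually h1] with τ' h2
      rwa [Function.comp_apply, UpperHalfPlane.ofComplex_apply] at h2
  refine mem_codiscreteWithin_iff_forall_mem_nhdsNE.2 fun τ _ => ?_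
  rw [Set.compl_univ, Set.union_empty]
  exact key τ

/-- Holomorphic functions whose translates by the triangle group span a finite-dimensional
space. -/
structure Flat (N : ℍ → ℂ) : Prop where
  holo : IsHolo N
  exists_submodule : ∃ V : Submodule ℂ (ℍ → ℂ), V.FG ∧ ∀ γ : Γ, (fun τ => N (γ • τ)) ∈ V

theorem Flat.add {N N' : ℍ → ℂ} (h : Flat N) (h' : Flat N') : Flat fun τ => N τ + N' τ := by
  obtain ⟨V, hV, hV'⟩ := h.2
  obtain ⟨W, hW, hW'⟩ := h'.2
  exact ⟨fun τ => (h.1 τ).add (h'.1 τ), V ⊔ W, hV.sup hW, fun γ =>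
    Submodule.add_mem_sup (hV' γ) (hW' γ)⟩

/-- Products of translates lie in the product `V * W` inside the algebra of functions, which is
again finitely generated. -/
theorem Flat.mul {N N' : ℍ → ℂ} (h : Flat N) (h' : Flat N') : Flat fun τ => N τ * N' τ := by
  obtain ⟨V, hV, hV'⟩ := h.2
  obtain ⟨W, hW, hW'⟩ := h'.2
  exact ⟨fun τ => (h.1 τ).mul (h'.1 τ), V * W, hV.mul hW, fun γ =>
    Submodule.mul_mem_mul (hV' γ) (hW' γ)⟩

theorem flat_of_invariant {N : ℍ → ℂ} (h : IsHolo N) (hN : ∀ (γ : Γ) τ, N (γ • τ) = N τ) :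
    Flat N :=
  ⟨h, Submodule.span ℂ {N}, Submodule.fg_span_singleton N, fun γ => by
    simp only [hN]
    exact Submodule.mem_span_singleton_self N⟩

theorem flat_const (c : ℂ) : Flat fun _ => c :=
  flat_of_invariant (fun _ => analyticAt_const) fun _ _ => rfl

theorem Flat.sub {N N' : ℍ → ℂ} (h : Flat N) (h' : Flat N') : Flat fun τ => N τ - N' τ := by
  have := h.add ((flat_const (-1)).mul h')
  simpa [sub_eq_add_neg] using this

theorem flat_hptm : Flat fun τ => hptm τ := by
  refine flat_of_invariant (isHolo_of_analyticAt fun x hx => analyticAt_hptm hx) fun γ τ => ?_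
  exact (isHauptmodul_hptm.eq_iff (γ • τ) τ).2 ⟨γ⁻¹, inv_mem γ.2, by
    rw [Subgroup.smul_def, inv_smul_smul]⟩

/-- A flat function is a component of a vector that transforms by a representation. -/
theorem Flat.exists_rep {N : ℍ → ℂ} (h : Flat N) : ∃ (r : ℕ) (ρ : Γ →* GL (Fin r) ℂ)
    (X : ℍ → Fin r → ℂ) (i : Fin r), (∀ j, IsHolo fun τ => X τ j) ∧
    (∀ (γ : Γ) τ, X (γ • τ) = (ρ γ : Matrix (Fin r) (Fin r) ℂ) *ᵥ X τ) ∧ ∀ τ, X τ i = N τ := by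
  -- The zero function cannot be a basis vector, so it is treated separately.
  by_cases h0 : N = 0
  · refine ⟨1, 1, fun _ _ => 0, 0, fun _ _ => analyticAt_const, fun γ τ => ?_, fun τ => by simp [h0]⟩
    ext
    simp [Matrix.mulVec, dotProduct]
  obtain ⟨W, hW, hW'⟩ := h.2
  -- The span of the translates is stable under the group, which the given space need not be. A
  -- basis of it containing `N` is the required vector.
  set V : Submodule ℂ (ℍ → ℂ) := Submodule.span ℂ (Set.range fun (γ : Γ) (τ : ℍ) => N (γ • τ))
    with hV
  have hVW : V ≤ W := Submodule.span_le.2 (by rintro _ ⟨γ, rfl⟩; exact hW' γ)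
  have : FiniteDimensional ℂ W := Module.Finite.iff_fg.2 hW
  have : FiniteDimensional ℂ V := Submodule.finiteDimensional_of_le hVW
  have hNV : N ∈ V := Submodule.subset_span ⟨1, by simp⟩
  have hholo : ∀ f ∈ V, IsHolo f := by
    intro f hf
    induction hf using Submodule.span_induction with
    | mem f hf =>
      obtain ⟨γ, rfl⟩ := hf
      exact h.1.comp_smul γ
    | zero => exact fun τ => analyticAt_const
    | add f g _ _ h1 h2 => exact fun τ => (h1 τ).add (h2 τ)
    | smul c f _ h1 => exact fun τ => analyticAt_const.mul (h1 τ)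
  have hstab : ∀ γ : Γ, ∀ f ∈ V, LinearMap.funLeft ℂ ℂ (fun τ : ℍ => γ • τ) f ∈ V := by
    intro γ f hf
    induction hf using Submodule.span_induction with
    | mem f hf =>
      obtain ⟨δ, rfl⟩ := hf
      refine Submodule.subset_span ⟨δ * γ, ?_⟩
      ext τ
      simp [LinearMap.funLeft_apply, mul_smul]
    | zero => simp
    | add f g _ _ h1 h2 => rw [map_add]; exact V.add_mem h1 h2
    | smul c f _ h1 => rw [map_smul]; exact V.smul_mem c h1
  have hs : LinearIndepOn ℂ id ({⟨N, hNV⟩} : Set V) :=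
    LinearIndepOn.singleton (by simpa [Subtype.ext_iff] using h0)
  set b₀ := Module.Basis.extend hs with hb₀
  have := Module.Finite.finite_basis b₀
  let _ := Fintype.ofFinite (hs.extend (Set.subset_univ _))
  set e := Fintype.equivFin (hs.extend (Set.subset_univ _))
  set b := b₀.reindex e with hb
  set c : Γ → V →ₗ[ℂ] V := fun γ => (LinearMap.funLeft ℂ ℂ (fun τ : ℍ => γ • τ)).restrict (hstab γ)
    with hc
  -- Translation of functions reverses products; transposing the matrices restores a homomorphism,
  -- and is also what the action on the vector of basis functions calls for.
  let ρ : Γ →* Matrix (Fin _) (Fin _) ℂ :=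
    { toFun := fun γ => (LinearMap.toMatrix b b (c γ))ᵀ
      map_one' := by
        have : c 1 = LinearMap.id := by
          ext f τ
          simp [hc, LinearMap.restrict_apply, LinearMap.funLeft_apply]
        rw [this, LinearMap.toMatrix_id, Matrix.transpose_one]
      map_mul' := fun γ δ => by
        have : c (γ * δ) = c δ ∘ₗ c γ := by
          ext f τ
          simp [hc, LinearMap.restrict_apply, LinearMap.funLeft_apply, mul_smul]
        rw [this, LinearMap.toMatrix_comp b b b, Matrix.transpose_mul] }
  refine ⟨_, ρ.toHomUnits, fun τ j => (b j : ℍ → ℂ) τ,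
    e ⟨⟨N, hNV⟩, Module.Basis.subset_extend hs rfl⟩, fun j => hholo _ (b j).2, fun γ τ => ?_,
    fun τ => ?_⟩
  · ext j
    have h1 : (b j : ℍ → ℂ) (γ • τ) = (c γ (b j) : ℍ → ℂ) τ := rfl
    simp only
    rw [h1, ← b.sum_repr (c γ (b j))]
    simp only [Submodule.coe_sum, Submodule.coe_smul, Finset.sum_apply, Pi.smul_apply, smul_eq_mul,
      Matrix.mulVec, dotProduct]
    refine Finset.sum_congr rfl fun k _ => ?_
    congr 1
    show _ = LinearMap.toMatrix b b (c γ) k j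
    rw [LinearMap.toMatrix_apply]
  · simp [hb, hb₀]

/-- Quotients of flat functions are automorphic forms whose automorphy factor is a twist of a flat
one. -/
theorem Flat.exists_automorphicForm {N B : ℍ → ℂ} (hN : Flat N) (hB : Flat B) {τ₀ : ℍ}
    (hB0 : B τ₀ ≠ 0) : ∃ (r : ℕ) (e : AutomorphyFactor Γ r) (φ : ℍ → Fin r → ℂ) (i : Fin r),
      e.IsTwistOfFlat ∧ IsAutomorphicForm e φ ∧ ∀ τ, φ τ i = N τ / B τ := by
  obtain ⟨r, ρ, X, i, hX, hXρ, hXN⟩ := hN.exists_rep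
  obtain ⟨s, ρB, XB, iB, hXB, hXBρ, hXBN⟩ := hB.exists_rep
  -- These zeros are excluded so that the intermediate factor `B (γ₁ • τ)` cancels in the cocycle
  -- identity.
  have hne : ∀ γ : Γ, ∀ᶠ τ in codiscrete ℍ, B (γ • τ) ≠ 0 := fun γ =>
    (hB.1.comp_smul γ).eventually_ne_zero (τ₀ := γ⁻¹ • τ₀) (by
      rw [Subgroup.smul_def, InvMemClass.coe_inv, smul_inv_smul]
      exact hB0)
  have hne1 : ∀ᶠ τ in codiscrete ℍ, B τ ≠ 0 := hB.1.eventually_ne_zero hB0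
  refine ⟨r, { toFun := fun γ τ => (B τ / B (γ • τ)) • (ρ γ : Matrix (Fin r) (Fin r) ℂ)
               meromorphic := fun γ j k τ => ?_
               invertible := fun γ => ?_
               cocycle := fun γ₁ γ₂ => ?_ }, fun τ j => X τ j / B τ, i, ?_, ?_, fun τ => by
    simp only [hXN]⟩
  · exact ((hB.1 τ).meromorphicAt.div ((hB.1.comp_smul γ) τ).meromorphicAt).mul
      (MeromorphicAt.const _ _)
  · filter_upwards [hne γ, hne1] with τ h1 h2
    exact (ρ γ).isUnit.smul (Units.mk0 _ (div_ne_zero h2 h1))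
  · filter_upwards [hne γ₁] with τ h1
    rw [map_mul, Units.val_mul, Matrix.smul_mul, Matrix.mul_smul, smul_smul, mul_smul γ₂ γ₁ τ]
    congr 1
    field_simp
  · refine ⟨ρ, B, ⟨s, ρB, XB, iB, ⟨fun j => (hXB j).isMeromorphic, fun γ =>
      Eventually.of_forall fun τ => hXBρ γ τ⟩, hXBN⟩, hne1, fun γ => Eventually.of_forall fun τ => rfl⟩
  · refine ⟨fun j τ => (hX j τ).meromorphicAt.div (hB.1 τ).meromorphicAt, fun γ => ?_⟩
    filter_upwards [hne1] with τ h1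
    ext j
    have h2 := congrFun (hXρ γ τ) j
    rw [h2]
    simp only [Matrix.smul_mulVec, Pi.smul_apply, smul_eq_mul]
    have h3 : (fun j => X τ j / B τ) = (B τ)⁻¹ • X τ := by
      ext j
      simp [div_eq_inv_mul]
    rw [h3, Matrix.mulVec_smul, Pi.smul_apply, smul_eq_mul]
    field_simp

end FlatForms

/-! ### A fifth root of the Hauptmodul. -/

section FifthRoot

/-- Two analytic functions with the same fifth power differ by a root of unity. -/
theorem exists_eventuallyEq_of_pow_eq {f g : ℂ → ℂ} {x : ℂ} (hf : AnalyticAt ℂ f x)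
    (hg : AnalyticAt ℂ g x) (h : ∀ᶠ y in 𝓝 x, f y ^ 5 = g y ^ 5) :
    ∃ ω : ℂ, ω ^ 5 = 1 ∧ ∀ᶠ y in 𝓝 x, f y = ω * g y := by
  -- There are only five candidates `ω`. If every `f - ω g` had isolated zeros, some point near `x`
  -- would avoid all of them, although the fifth powers agree there.
  by_contra hn
  push Not at hn
  have h1 : ∀ ω ∈ Polynomial.nthRootsFinset 5 (1 : ℂ), ∀ᶠ y in 𝓝[≠] x, f y ≠ ω * g y := by
    intro ω hω
    rw [Polynomial.mem_nthRootsFinset (by norm_num)] at hω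
    have han : AnalyticAt ℂ (fun y => f y - ω * g y) x := hf.sub (analyticAt_const.mul hg)
    rcases han.eventually_eq_zero_or_eventually_ne_zero with h2 | h2
    · exact absurd (h2.mono fun y hy => sub_eq_zero.1 hy) (by
        simpa [Filter.not_eventually] using hn ω hω)
    · exact h2.mono fun y hy => sub_ne_zero.1 hy
  rw [← Filter.eventually_all_finset] at h1
  obtain ⟨y, h2, h3⟩ := (h1.and (h.filter_mono nhdsWithin_le_nhds)).exists
  by_cases h0 : g y = 0
  · rw [h0, zero_pow (by norm_num), pow_eq_zero_iff (by norm_num)] at h3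
    exact h2 1 (by rw [Polynomial.mem_nthRootsFinset (by norm_num)]; simp) (by rw [h3, h0, mul_zero])
  · refine h2 (f y / g y) ?_ (by field_simp)
    rw [Polynomial.mem_nthRootsFinset (by norm_num), div_pow, h3, div_self (pow_ne_zero 5 h0)]

/-- At a zero of `b` the elliptic chart exhibits `b` as the fifth power of a local coordinate, so
the zeros have order exactly five. Elsewhere a root comes from a logarithm, and it is a coordinate
since `b` is not stationary. -/
theorem exists_local_root {x : ℂ} (hx : 0 < x.im) :
    ∃ t : ℂ → ℂ, AnalyticAt ℂ t x ∧ deriv t x ≠ 0 ∧ ∀ᶠ y in 𝓝 x, t y ^ 5 = hptm y := by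
  by_cases h0 : hptm x = 0
  · obtain ⟨M, hM, t, ht, ht1, h⟩ := (adm_hptm hx).ell (by rw [h0, norm_zero]; exact one_pos)
    refine ⟨t, ht, fun hd => ?_, h.mono fun y hy => hy.1⟩
    have h1 : HasDerivAt t 0 x := by
      rw [← hd]
      exact ht.differentiableAt.hasDerivAt
    have h2 := ((differentiableAt_ellChart ht1).hasDerivAt.comp x h1).congr_of_eventuallyEq
      (f₁ := mob M) (h.mono fun y hy => hy.2.symm)
    have h3 := h2.unique (hasDerivAt_mob M hx)
    rw [mul_zero] at h3
    exact one_div_ne_zero (pow_ne_zero 2 (mob_denom_ne_zero M hx)) h3.symm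
  · obtain ⟨t, ht, h⟩ := exists_analyticAt_pow_eq (analyticAt_hptm hx) h0
    refine ⟨t, ht, fun hd => deriv_hptm_ne_zero hx h0 ?_, h⟩
    have h1 : HasDerivAt (fun y => t y ^ 5) (5 * t x ^ 4 * deriv t x) x := by
      exact HasDerivAt.congr_deriv (ht.differentiableAt.hasDerivAt.pow 5) (by simp)
    rw [(h1.congr_of_eventuallyEq (h.mono fun y hy => hy.symm)).deriv, hd, mul_zero]

/-- A germ of a root agrees with a root of unity times the local root near `x₀`, so it extends by a
radius that depends on `x₀` only. -/
theorem exists_hroot : ∃ h : ℂ → ℂ, ∀ x : ℂ, 0 < x.im →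
    AnalyticAt ℂ h x ∧ ∀ᶠ y in 𝓝 x, h y ^ 5 = hptm y := by
  obtain ⟨t, ht, -, h⟩ := exists_local_root (x := Complex.I) (by simp)
  have hloc : ∀ x₀ : ℂ, 0 < x₀.im → ∃ ε > 0, ∀ β : ℂ → ℂ, ∀ x ∈ Metric.ball x₀ ε,
      (AnalyticAt ℂ β x ∧ ∀ᶠ y in 𝓝 x, β y ^ 5 = hptm y) →
      ∃ β' : ℂ → ℂ, β' =ᶠ[𝓝 x] β ∧ ∀ y ∈ Metric.ball x ε,
        AnalyticAt ℂ β' y ∧ ∀ᶠ y' in 𝓝 y, β' y' ^ 5 = hptm y' := by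
    intro x₀ hx₀
    obtain ⟨t, ht, -, h⟩ := exists_local_root hx₀
    obtain ⟨ε, hε, hball⟩ := Metric.eventually_nhds_iff_ball.1
      (ht.eventually_analyticAt.and h.eventually_nhds)
    refine ⟨ε / 2, half_pos hε, fun β x hx ⟨h1, h2⟩ => ?_⟩
    obtain ⟨h3, h4⟩ := hball x (Metric.ball_subset_ball (by linarith) hx)
    obtain ⟨ω, hω, h5⟩ := exists_eventuallyEq_of_pow_eq h1 h3 (by
      filter_upwards [h2, h4] with y a b
      rw [a, b])
    refine ⟨fun y => ω * t y, h5.mono fun y hy => hy.symm, fun y hy => ?_⟩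
    obtain ⟨h6, h7⟩ := hball y (by
      rw [Metric.mem_ball] at hx hy ⊢
      linarith [dist_triangle y x x₀])
    refine ⟨analyticAt_const.mul h6, ?_⟩
    filter_upwards [h7] with y' hy'
    rw [mul_pow, hω, one_mul, hy']
  obtain ⟨b, -, hb⟩ := exists_extension_upperHalfPlane (c := Complex.I)
    (P := fun β x => AnalyticAt ℂ β x ∧ ∀ᶠ y in 𝓝 x, β y ^ 5 = hptm y) (by simp)
    (fun β β' x h1 h2 => ⟨h1.1.congr h2.symm, by
      filter_upwards [h1.2, h2] with y a b
      rw [b, a]⟩) (fun β x h1 => h1.1) hloc ⟨ht, h⟩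
  exact ⟨b, hb⟩

/-- A fifth root of the Hauptmodul. It is a local coordinate on the upper half-plane. -/
def hroot : ℂ → ℂ := exists_hroot.choose

theorem analyticAt_hroot {x : ℂ} (hx : 0 < x.im) : AnalyticAt ℂ hroot x :=
  (exists_hroot.choose_spec x hx).1

theorem hroot_pow {x : ℂ} (hx : 0 < x.im) : hroot x ^ 5 = hptm x :=
  (exists_hroot.choose_spec x hx).2.self_of_nhds

theorem hasDerivAt_hroot {x : ℂ} (hx : 0 < x.im) : HasDerivAt hroot (deriv hroot x) x :=
  (analyticAt_hroot hx).differentiableAt.hasDerivAt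

/-- Both sides are fifth roots of the invariant function `b`. Their ratio is a root of unity near
`i`, and the identity theorem spreads it over `ℍ`. -/
theorem hroot_mob {M : SL(2, ℝ)} (hM : M ∈ Γs) :
    ∃ ω : ℂ, ω ^ 5 = 1 ∧ ∀ x : ℂ, 0 < x.im → hroot (mob M x) = ω * hroot x := by
  have h1 : AnalyticOnNhd ℂ (fun x => hroot (mob M x)) {x | 0 < x.im} := fun x hx =>
    (analyticAt_hroot (mob_im_pos _ hx)).fun_comp (analyticAt_mob _ hx)
  have hI : (0 : ℝ) < Complex.I.im := by simp
  obtain ⟨ω, hω, h⟩ := exists_eventuallyEq_of_pow_eq (h1 Complex.I hI)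
    (analyticAt_hroot hI) (by
      filter_upwards [eventually_nhds_im_pos hI] with y hy
      rw [hroot_pow hy, hroot_pow (mob_im_pos _ hy), hptm_mob hM hy])
  refine ⟨ω, hω, fun x hx => ?_⟩
  exact h1.eqOn_of_preconnected_of_eventuallyEq
    (fun x hx => analyticAt_const.fun_mul (analyticAt_hroot hx)) isPreconnected_upperHalfPlane
    hI h hx

end FifthRoot

/-! ### The Picard–Fuchs equation on the upper half-plane. -/

section PicardFuchs

/-- The linear map `(u₁, u₂, u₃, u₄) ↦ (u₂, u₃, u₄, 0)`. -/
def shiftCLM : (Fin 4 → ℂ) →L[ℂ] (Fin 4 → ℂ) :=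
  ContinuousLinearMap.pi ![ContinuousLinearMap.proj 1, ContinuousLinearMap.proj 2,
    ContinuousLinearMap.proj 3, 0]

/-- The linear map `u ↦ (0, 0, 0, uⱼ)`. -/
def lastCLM (j : Fin 4) : (Fin 4 → ℂ) →L[ℂ] (Fin 4 → ℂ) :=
  ContinuousLinearMap.pi ![0, 0, 0, ContinuousLinearMap.proj j]

/-- The Picard–Fuchs equation pulled back to the upper half-plane, as a first order system for the
functions `uₖ = h ^ (-k) yₖ`, where `y₁ = f` and `yₖ₊₁ = (θ + k/5) yₖ`. -/
def pfSystem (x : ℂ) : (Fin 4 → ℂ) →L[ℂ] (Fin 4 → ℂ) :=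
  (-5 * deriv hroot x) • shiftCLM +
    ((5 * deriv hroot x / (1 - hroot x ^ 5) * (-(1 / 625) * hroot x)) • lastCLM 0 +
      (5 * deriv hroot x / (1 - hroot x ^ 5) * (3 / 25 * hroot x ^ 2)) • lastCLM 1 +
      (5 * deriv hroot x / (1 - hroot x ^ 5) * (-hroot x ^ 3)) • lastCLM 2 +
      (5 * deriv hroot x / (1 - hroot x ^ 5) * (2 * hroot x ^ 4)) • lastCLM 3)

theorem pfSystem_apply (x : ℂ) (u : Fin 4 → ℂ) : pfSystem x u =
    ![-5 * deriv hroot x * u 1, -5 * deriv hroot x * u 2, -5 * deriv hroot x * u 3,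
      5 * deriv hroot x / (1 - hroot x ^ 5) * (2 * hroot x ^ 4 * u 3 - hroot x ^ 3 * u 2 +
        3 / 25 * hroot x ^ 2 * u 1 - 1 / 625 * hroot x * u 0)] := by
  ext i
  fin_cases i <;> simp [pfSystem, shiftCLM, lastCLM]
  ring

/-- Since `z = h⁻⁵`, differentiation along `ℍ` is `-5 (h' / h) θ`, and differentiating `h⁻ᵏ` adds
precisely the shift `k/5` to `θ`. So `uₖ' = -5 h' uₖ₊₁` with no negative power of `h`, and the only
denominator `1 - h⁵ = 1 - b` has no zeros. -/
theorem differentiableOn_pfSystem : DifferentiableOn ℂ pfSystem {x | 0 < x.im} := by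
  have h1 : DifferentiableOn ℂ hroot {x | 0 < x.im} := fun x hx =>
    (analyticAt_hroot hx).differentiableAt.differentiableWithinAt
  have h2 : DifferentiableOn ℂ (deriv hroot) {x | 0 < x.im} := fun x hx =>
    (analyticAt_hroot hx).deriv.differentiableAt.differentiableWithinAt
  have h3 : ∀ x ∈ {x : ℂ | 0 < x.im}, 1 - hroot x ^ 5 ≠ 0 := fun x hx => by
    rw [hroot_pow hx]
    exact sub_ne_zero.2 (hptm_ne_one hx).symm
  have h4 : DifferentiableOn ℂ (fun x => 5 * deriv hroot x / (1 - hroot x ^ 5)) {x | 0 < x.im} :=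
    DifferentiableOn.div (by fun_prop) (by fun_prop) h3
  unfold pfSystem
  refine DifferentiableOn.add ?_ (DifferentiableOn.add (DifferentiableOn.add
    (DifferentiableOn.add ?_ ?_) ?_) ?_) <;>
  refine DifferentiableOn.smul_const ?_ _ <;> fun_prop

/-- Solutions of the Picard–Fuchs system on the upper half-plane. -/
def IsPFSol (U : ℂ → Fin 4 → ℂ) : Prop := ∀ x : ℂ, 0 < x.im → HasDerivAt U (pfSystem x (U x)) x

theorem IsPFSol.eqOn {U V : ℂ → Fin 4 → ℂ} (hU : IsPFSol U) (hV : IsPFSol V) {c : ℂ}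
    (hc : 0 < c.im) (h : U c = V c) : ∀ x : ℂ, 0 < x.im → U x = V x :=
  linearODE_eqOn isOpen_upperHalfPlane isPreconnected_upperHalfPlane hc
    (differentiableOn_pfSystem.differentiableAt (isOpen_upperHalfPlane.mem_nhds hc)).continuousAt
    hU hV h

/-- The system depends on `h` only, and it is homogeneous: `h ↦ ω h` together with `uₖ ↦ ωᵏ uₖ`
preserves it, because `z` does not change. Indices start at `0`, whence the exponent `i + 1`. -/
theorem IsPFSol.mob {U : ℂ → Fin 4 → ℂ} (hU : IsPFSol U) {M : SL(2, ℝ)} {ω : ℂ} (hω : ω ^ 5 = 1)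
    (hM : ∀ x : ℂ, 0 < x.im → hroot (mob M x) = ω * hroot x) :
    IsPFSol fun x i => ω ^ ((i : ℕ) + 1) * U (mob M x) i := by
  intro x hx
  have hMx := mob_im_pos M hx
  have hd : deriv hroot (YamaguchiYau.mob M x) *
      (1 / ((M 1 0 : ℝ) * x + (M 1 1 : ℝ)) ^ 2) = ω * deriv hroot x := by
    have h1 := (hasDerivAt_hroot hMx).comp x (hasDerivAt_mob M hx)
    have h2 := ((hasDerivAt_hroot hx).const_mul ω).congr_of_eventuallyEq
      (f₁ := hroot ∘ YamaguchiYau.mob M) (by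
        filter_upwards [eventually_nhds_im_pos hx] with y hy
        exact hM y hy)
    exact h1.unique h2
  set m := 1 / (((M 1 0 : ℝ) : ℂ) * x + (M 1 1 : ℝ)) ^ 2 with hm
  have h1 := (hU _ hMx).scomp x (hasDerivAt_mob M hx)
  rw [hasDerivAt_pi] at h1 ⊢
  intro i
  refine HasDerivAt.congr_deriv ((h1 i).const_mul (ω ^ ((i : ℕ) + 1))) ?_
  simp only [pfSystem_apply, Pi.smul_apply, smul_eq_mul, hM x hx, mul_pow, hω, one_mul]
  rw [← hm]
  set d := deriv hroot (YamaguchiYau.mob M x)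
  set d' := deriv hroot x
  fin_cases i
  · simp
    linear_combination (5 * ω * U (YamaguchiYau.mob M x) 1) * hd
  · simp
    linear_combination (5 * ω ^ 2 * U (YamaguchiYau.mob M x) 2) * hd
  · simp
    linear_combination (5 * ω ^ 3 * U (YamaguchiYau.mob M x) 3) * hd
  · simp
    have h5 : ω ^ 4 * ω = 1 := by rw [← pow_succ, hω]
    set P := (2 * (ω ^ 4 * hroot x ^ 4) * U (YamaguchiYau.mob M x) 3 -
      ω ^ 3 * hroot x ^ 3 * U (YamaguchiYau.mob M x) 2 +
      3 / 25 * (ω ^ 2 * hroot x ^ 2) * U (YamaguchiYau.mob M x) 1 -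
      625⁻¹ * (ω * hroot x) * U (YamaguchiYau.mob M x) 0) with hP
    have e : ∀ p q : ℂ, ω ^ 4 * (m * (5 * d / p * q)) = 5 * (ω ^ 4 * (d * m)) / p * q := by
      intro p q
      ring
    rw [e, hd, show ω ^ 4 * (ω * d') = d' by linear_combination d' * h5, hP]
    ring

theorem exists_isPFSol {c : ℂ} (hc : 0 < c.im) (a : Fin 4 → ℂ) : ∃ U, IsPFSol U ∧ U c = a := by
  obtain ⟨U, h1, h2⟩ := exists_linearODE_solution_upperHalfPlane hc differentiableOn_pfSystem a
  exact ⟨U, h2, h1⟩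

theorem IsPFSol.analyticAt {U : ℂ → Fin 4 → ℂ} (hU : IsPFSol U) (i : Fin 4) {x : ℂ}
    (hx : 0 < x.im) : AnalyticAt ℂ (fun x => U x i) x :=
  analyticAt_of_eventually_hasDerivAt
    ((eventually_nhds_im_pos hx).mono fun y hy => (hasDerivAt_pi.1 (hU y hy)) i)

/-- A translate of a solution, rescaled, is again a solution, hence a combination of the four with
unit initial values at `i`. The powers of `ω` from the rescaling are exactly those produced by the
power of `h`. -/
theorem IsPFSol.flat {U : ℂ → Fin 4 → ℂ} (hU : IsPFSol U) (k : Fin 4) :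
    Flat fun τ => hroot τ ^ ((k : ℕ) + 1) * U τ k := by
  refine ⟨isHolo_of_analyticAt (f := fun x => hroot x ^ ((k : ℕ) + 1) * U x k) fun x hx =>
    ((analyticAt_hroot hx).fun_pow _).fun_mul (hU.analyticAt k hx), ?_⟩
  have hI : (0 : ℝ) < Complex.I.im := by simp
  choose Φ hΦ hΦI using fun j : Fin 4 => exists_isPFSol hI (Pi.single j 1)
  refine ⟨Submodule.span ℂ (Set.range fun (j : Fin 4) (τ : ℍ) =>
    hroot τ ^ ((k : ℕ) + 1) * Φ j τ k), Submodule.fg_span (Set.finite_range _), fun γ => ?_⟩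
  obtain ⟨M, hM, hMγ⟩ : (γ : Matrix.ProjectiveSpecialLinearGroup (Fin 2) ℝ) ∈ Γs.map
    (QuotientGroup.mk' (Subgroup.center SL(2, ℝ))) := Γ_eq_map ▸ γ.2
  obtain ⟨ω, hω, hωM⟩ := hroot_mob hM
  set V : ℂ → Fin 4 → ℂ := fun x i => ω ^ ((i : ℕ) + 1) * U (YamaguchiYau.mob M x) i with hVdef
  have hV : IsPFSol V := hU.mob hω hωM
  have hsum : IsPFSol fun x => ∑ j, V Complex.I j • Φ j x := by
    intro x hx
    rw [map_sum]
    simp only [map_smul]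
    exact HasDerivAt.fun_sum fun j _ => (hΦ j x hx).fun_const_smul _
  have heq := hV.eqOn hsum hI (by
    ext i
    simp [hΦI, Finset.sum_apply, Pi.single_apply])
  have hfun : (fun τ : ℍ => hroot ↑(γ • τ) ^ ((k : ℕ) + 1) * U ↑(γ • τ) k) =
      ∑ j, V Complex.I j • fun τ : ℍ => hroot τ ^ ((k : ℕ) + 1) * Φ j τ k := by
    ext τ
    have h1 : ((γ • τ : ℍ) : ℂ) = YamaguchiYau.mob M τ := by
      rw [mob_coe, Subgroup.smul_def, ← hMγ]
      rfl
    have h2 := congrFun (heq τ τ.im_pos) k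
    rw [h1, hωM τ τ.im_pos, mul_pow, mul_comm (ω ^ _), mul_assoc]
    change _ * V τ k = _
    rw [h2]
    simp only [Finset.sum_apply, Pi.smul_apply, smul_eq_mul, Finset.mul_sum]
    exact Finset.sum_congr rfl fun j _ => by ring
  rw [hfun]
  exact Submodule.sum_mem _ fun j _ => Submodule.smul_mem _ _ (Submodule.subset_span ⟨j, rfl⟩)

/-- Local solutions of the Picard–Fuchs equation continue to the upper half-plane, together with
their derivatives with respect to `θ = z d/dz`, and the continuations are flat. -/
theorem exists_flat_continuation {f : Fin 4 → ℂ → ℂ} {f₄ : ℂ → ℂ} {z₀ : ℂ}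
    (hz₀ : z₀ ∈ doubleCutPlane) (h0 : ∀ᶠ z in 𝓝 z₀, HasDerivAt (f 0) (f 1 z / z) z)
    (h1 : ∀ᶠ z in 𝓝 z₀, HasDerivAt (f 1) (f 2 z / z) z)
    (h2 : ∀ᶠ z in 𝓝 z₀, HasDerivAt (f 2) (f 3 z / z) z)
    (h3 : ∀ᶠ z in 𝓝 z₀, HasDerivAt (f 3) (f₄ z / z) z)
    (h4 : ∀ᶠ z in 𝓝 z₀, f₄ z = z * (f₄ z + 2 * f 3 z + 7 / 5 * f 2 z + 2 / 5 * f 1 z +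
      24 / 625 * f 0 z)) :
    ∃ F : Fin 4 → ℂ → ℂ, (∀ i, Flat fun τ => F i τ) ∧
      (∀ i, ∀ x : ℂ, 0 < x.im → AnalyticAt ℂ (F i) x) ∧
      ∀ i, ∀ᶠ x in 𝓝 (hypTau z₀), F i x = f i (hptm x)⁻¹ := by
  have hx₀ := hypTau_im_pos hz₀
  have hb₀ := hptm_hypTau hz₀
  have hb₀' : hptm (hypTau z₀) ≠ 0 := by
    rw [hb₀]
    exact inv_ne_zero (doubleCutPlane_ne hz₀).1
  have hcont : Tendsto (fun x => (hptm x)⁻¹) (𝓝 (hypTau z₀)) (𝓝 z₀) := by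
    have := ((analyticAt_hptm hx₀).continuousAt.inv₀ hb₀').tendsto
    rwa [Pi.inv_apply, hb₀, inv_inv] at this
  have hne : ∀ᶠ x in 𝓝 (hypTau z₀), hroot x ≠ 0 := by
    refine (analyticAt_hroot hx₀).continuousAt.eventually_ne fun h => hb₀' ?_
    rw [← hroot_pow hx₀, h, zero_pow (by norm_num)]
  -- The numerators are the expanded products `(θ + 1/5) f`, `(θ + 2/5)(θ + 1/5) f` and `(θ + 3/5)(θ
  -- + 2/5)(θ + 1/5) f`.
  set u : ℂ → Fin 4 → ℂ := fun x =>
    ![f 0 (hptm x)⁻¹ / hroot x, (f 1 (hptm x)⁻¹ + 1 / 5 * f 0 (hptm x)⁻¹) / hroot x ^ 2,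
      (f 2 (hptm x)⁻¹ + 3 / 5 * f 1 (hptm x)⁻¹ + 2 / 25 * f 0 (hptm x)⁻¹) / hroot x ^ 3,
      (f 3 (hptm x)⁻¹ + 6 / 5 * f 2 (hptm x)⁻¹ + 11 / 25 * f 1 (hptm x)⁻¹ +
        6 / 125 * f 0 (hptm x)⁻¹) / hroot x ^ 4] with hu
  have hode : ∀ᶠ x in 𝓝 (hypTau z₀), HasDerivAt u (pfSystem x (u x)) x := by
    filter_upwards [hcont.eventually h0, hcont.eventually h1, hcont.eventually h2,
      hcont.eventually h3, hcont.eventually h4, hne, eventually_nhds_im_pos hx₀]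
      with x h0 h1 h2 h3 h4 hne hx
    have hb : hptm x = hroot x ^ 5 := (hroot_pow hx).symm
    have hb0 : hptm x ≠ 0 := by rw [hb]; exact pow_ne_zero 5 hne
    have hb1 : 1 - hroot x ^ 5 ≠ 0 := by
      rw [← hb]
      exact sub_ne_zero.2 (hptm_ne_one hx).symm
    have hh := hasDerivAt_hroot hx
    have hz : HasDerivAt (fun x => (hptm x)⁻¹) (-(5 * hroot x ^ 4 * deriv hroot x) /
        (hroot x ^ 5) ^ 2) x := by
      have e1 : HasDerivAt hptm (5 * hroot x ^ 4 * deriv hroot x) x := by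
        refine HasDerivAt.congr_of_eventuallyEq
          (HasDerivAt.congr_deriv (hh.pow 5) (by simp)) ?_
        filter_upwards [eventually_nhds_im_pos hx] with y hy
        simp [hroot_pow hy]
      rw [← hb]
      exact e1.inv hb0
    have key : ∀ g g' : ℂ → ℂ, HasDerivAt g (g' (hptm x)⁻¹ / (hptm x)⁻¹) (hptm x)⁻¹ →
        HasDerivAt (fun x => g (hptm x)⁻¹)
          (-5 * deriv hroot x / hroot x * g' (hptm x)⁻¹) x := by
      intro g g' hg
      refine HasDerivAt.congr_deriv (HasDerivAt.comp x hg hz) ?_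
      rw [hb]
      field_simp
    have k0 := key _ _ h0
    have k1 := key _ _ h1
    have k2 := key _ _ h2
    have k3 := key _ _ h3
    have h4' : (hroot x ^ 5 - 1) * f₄ (hptm x)⁻¹ = 2 * f 3 (hptm x)⁻¹ + 7 / 5 * f 2 (hptm x)⁻¹ +
        2 / 5 * f 1 (hptm x)⁻¹ + 24 / 625 * f 0 (hptm x)⁻¹ := by
      have : hroot x ^ 5 * (hptm x)⁻¹ = 1 := by rw [hb]; exact mul_inv_cancel₀ (pow_ne_zero 5 hne)
      generalize (hptm x)⁻¹ = z at *
      linear_combination hroot x ^ 5 * h4 + (f₄ z + 2 * f 3 z + 7 / 5 * f 2 z + 2 / 5 * f 1 z +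
        24 / 625 * f 0 z) * this
    rw [pfSystem_apply, hasDerivAt_pi]
    intro i
    fin_cases i
    · refine HasDerivAt.congr_deriv (k0.div hh hne) ?_
      simp [hu]
      field_simp
      ring
    · refine HasDerivAt.congr_deriv ((k1.add (k0.const_mul (1 / 5))).div (hh.pow 2)
        (pow_ne_zero 2 hne)) ?_
      simp [hu]
      field_simp
      ring
    · refine HasDerivAt.congr_deriv (((k2.add (k1.const_mul (3 / 5))).add
        (k0.const_mul (2 / 25))).div (hh.pow 3) (pow_ne_zero 3 hne)) ?_
      simp [hu]
      field_simp
      ring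
    · refine HasDerivAt.congr_deriv ((((k3.add (k2.const_mul (6 / 5))).add
        (k1.const_mul (11 / 25))).add (k0.const_mul (6 / 125))).div (hh.pow 4)
        (pow_ne_zero 4 hne)) ?_
      generalize f₄ (hptm x)⁻¹ = g4 at *
      simp only [hu, Pi.add_apply, Fin.reduceFinMk, Matrix.cons_val,
        Matrix.cons_val_zero, Matrix.cons_val_one]
      generalize f 3 (hptm x)⁻¹ = g3 at *
      generalize f 2 (hptm x)⁻¹ = g2 at *
      generalize f 1 (hptm x)⁻¹ = g1 at *
      generalize f 0 (hptm x)⁻¹ = g0 at *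
      have hg4 : g4 = -(2 * g3 + 7 / 5 * g2 + 2 / 5 * g1 + 24 / 625 * g0) / (1 - hroot x ^ 5) := by
        rw [eq_div_iff hb1]
        linear_combination -h4'
      rw [hg4]
      field_simp
      ring
  obtain ⟨U, hU, hU0⟩ := exists_isPFSol hx₀ (u (hypTau z₀))
  have hUu : U =ᶠ[𝓝 (hypTau z₀)] u := linearODE_eventuallyEq
    (differentiableOn_pfSystem.differentiableAt (isOpen_upperHalfPlane.mem_nhds hx₀)).continuousAt
    ((eventually_nhds_im_pos hx₀).mono hU) hode hU0
  set y : Fin 4 → ℂ → ℂ := fun k x => hroot x ^ ((k : ℕ) + 1) * U x k with hy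
  have hyf : ∀ k, Flat fun τ => y k τ := fun k => hU.flat k
  have hya : ∀ k, ∀ x : ℂ, 0 < x.im → AnalyticAt ℂ (y k) x := fun k x hx =>
    ((analyticAt_hroot hx).fun_pow _).fun_mul (hU.analyticAt k hx)
  -- The inverse of the triangular change of basis from `θᵏ f` to the functions `yₖ`; constant
  -- coefficients keep the result flat.
  refine ⟨![y 0, fun x => y 1 x - 1 / 5 * y 0 x,
    fun x => y 2 x - 3 / 5 * y 1 x + 1 / 25 * y 0 x,
    fun x => y 3 x - 6 / 5 * y 2 x + 7 / 25 * y 1 x - 1 / 125 * y 0 x], fun i => ?_,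
    fun i x hx => ?_, fun i => ?_⟩
  · fin_cases i
    · exact hyf 0
    · exact (hyf 1).sub ((flat_const _).mul (hyf 0))
    · exact ((hyf 2).sub ((flat_const _).mul (hyf 1))).add ((flat_const _).mul (hyf 0))
    · exact (((hyf 3).sub ((flat_const _).mul (hyf 2))).add ((flat_const _).mul (hyf 1))).sub
        ((flat_const _).mul (hyf 0))
  · have a0 := hya 0 x hx
    have a1 := hya 1 x hx
    have a2 := hya 2 x hx
    have a3 := hya 3 x hx
    fin_cases i
    · exact a0
    · exact a1.sub (analyticAt_const.mul a0)
    · exact (a2.sub (analyticAt_const.mul a1)).add (analyticAt_const.mul a0)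
    · exact ((a3.sub (analyticAt_const.mul a2)).add (analyticAt_const.mul a1)).sub
        (analyticAt_const.mul a0)
  · filter_upwards [hUu, hne] with x h5 h6
    fin_cases i
    all_goals
      simp [hy, h5, hu]
      field_simp
      try ring

end PicardFuchs

/-! ### Formal series -/

section FormalDerivation

theorem coeff_ddz (f : ℂ⸨X⸩) (n : ℤ) : (ddz f).coeff n = (n + 1) * f.coeff (n + 1) := by
  rw [ddz, LaurentSeries.derivative_apply, LaurentSeries.hasseDeriv_coeff]
  simp

/-- The derivation `θ = z d/dz` on Laurent series. -/
def thetaLS (f : ℂ⸨X⸩) : ℂ⸨X⸩ where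
  coeff n := n * f.coeff n
  isPWO_support' := f.isPWO_support.mono fun n hn h => hn (by simp [h])

/-- `θ` multiplies the coefficient of degree `n` by `n`, and degrees add in a product, so the rule
holds term by term. The Leibniz rule for `∂_z = z⁻¹ θ` follows. -/
theorem thetaLS_mul (f g : ℂ⸨X⸩) : thetaLS (f * g) = thetaLS f * g + f * thetaLS g := by
  ext n
  have h1 : (thetaLS f).support ⊆ f.support := fun n hn h => hn (by simp [thetaLS, h])
  have h2 : (thetaLS g).support ⊆ g.support := fun n hn h => hn (by simp [thetaLS, h])
  rw [HahnSeries.coeff_add, HahnSeries.coeff_mul_left' f.isPWO_support h1,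
    HahnSeries.coeff_mul_right' g.isPWO_support h2, ← Finset.sum_add_distrib]
  show (n : ℂ) * (f * g).coeff n = _
  rw [HahnSeries.coeff_mul, Finset.mul_sum]
  refine Finset.sum_congr rfl fun ij hij => ?_
  have h3 : ij.1 + ij.2 = n := by simp at hij; exact hij.2.2
  simp only [thetaLS]
  rw [← h3]
  push_cast
  ring

theorem ddz_eq (f : ℂ⸨X⸩) : ddz f = HahnSeries.single (-1) 1 * thetaLS f := by
  ext n
  rw [coeff_ddz, HahnSeries.coeff_single_mul]
  simp [thetaLS]

theorem ddz_mul (f g : ℂ⸨X⸩) : ddz (f * g) = ddz f * g + f * ddz g := by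
  rw [ddz_eq, ddz_eq, ddz_eq, thetaLS_mul]
  ring

theorem ddz_add (f g : ℂ⸨X⸩) : ddz (f + g) = ddz f + ddz g := map_add _ f g

theorem ddz_div (f : ℂ⸨X⸩) {g : ℂ⸨X⸩} (hg : g ≠ 0) :
    ddz (f / g) = (ddz f * g - f * ddz g) / g ^ 2 := by
  have h := ddz_mul (f / g) g
  rw [div_mul_cancel₀ _ hg] at h
  rw [h]
  field_simp
  ring

theorem ddz_coe (p : ℂ⟦X⟧) : ddz (p : ℂ⸨X⸩) = ((PowerSeries.derivative ℂ p : ℂ⟦X⟧) : ℂ⸨X⸩) := by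
  ext n
  rw [coeff_ddz, PowerSeries.coeff_coe, PowerSeries.coeff_coe]
  rcases lt_or_ge n 0 with h | h
  · rw [if_pos h]
    rcases eq_or_ne n (-1) with rfl | h'
    · simp
    · rw [if_pos (by omega), mul_zero]
  · rw [if_neg h.not_gt, if_neg (by omega), PowerSeries.coeff_derivative]
    obtain ⟨m, rfl⟩ := Int.eq_ofNat_of_zero_le h
    have : (((m : ℕ) : ℤ) + 1).natAbs = m + 1 := by omega
    rw [this]
    simp
    ring

/-- The variable `z`, as a Laurent series. -/
abbrev zLS : ℂ⸨X⸩ := ((PowerSeries.X : ℂ⟦X⟧) : ℂ⸨X⸩)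

theorem zLS_ne_zero : zLS ≠ 0 := by
  rw [zLS, PowerSeries.coe_X]
  exact HahnSeries.single_ne_zero one_ne_zero

theorem single_neg_one : (HahnSeries.single (-1) 1 : ℂ⸨X⸩) = zLS⁻¹ := by
  rw [zLS, PowerSeries.coe_X, HahnSeries.inv_single, inv_one]

theorem ddz_zLS : ddz zLS = 1 := by
  rw [zLS, ddz_coe, PowerSeries.derivative_X, PowerSeries.coe_one]

theorem algebraMap_X : algebraMap (RatFunc ℂ) ℂ⸨X⸩ RatFunc.X = zLS := by
  rw [zLS, PowerSeries.coe_X]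
  exact RatFunc.coe_X

theorem ddz_algebraMap (r : RatFunc ℂ) :
    ∃ s : RatFunc ℂ, ddz (algebraMap (RatFunc ℂ) ℂ⸨X⸩ r) = algebraMap (RatFunc ℂ) ℂ⸨X⸩ s := by
  have hpoly : ∀ p : Polynomial ℂ, ddz (algebraMap (RatFunc ℂ) ℂ⸨X⸩ (p : RatFunc ℂ)) =
      algebraMap (RatFunc ℂ) ℂ⸨X⸩ ((Polynomial.derivative p : Polynomial ℂ) : RatFunc ℂ) := by
    intro p
    rw [← RatFunc.coe_coe, ← RatFunc.coe_coe, ddz_coe, PowerSeries.derivative_coe]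
  induction r using RatFunc.induction_on with
  | f p q hq =>
    set A := algebraMap (RatFunc ℂ) ℂ⸨X⸩ with hA
    have hq' : algebraMap (Polynomial ℂ) (RatFunc ℂ) q ≠ 0 := by simpa using hq
    have hAq : A (algebraMap (Polynomial ℂ) (RatFunc ℂ) q) ≠ 0 := by
      rw [Ne, map_eq_zero]
      exact hq'
    refine ⟨(algebraMap (Polynomial ℂ) (RatFunc ℂ) (Polynomial.derivative p) *
      algebraMap (Polynomial ℂ) (RatFunc ℂ) q - algebraMap (Polynomial ℂ) (RatFunc ℂ) p *
      algebraMap (Polynomial ℂ) (RatFunc ℂ) (Polynomial.derivative q)) /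
      algebraMap (Polynomial ℂ) (RatFunc ℂ) q ^ 2, ?_⟩
    rw [map_div₀, ddz_div _ hAq, map_div₀, map_sub, map_mul, map_mul, map_pow]
    have h1 := hpoly p
    have h2 := hpoly q
    simp only [RatFunc.coePolynomial] at h1 h2
    rw [h1, h2]

end FormalDerivation

/-! ### The Frobenius series and the symplectic relation. -/

section FrobeniusSeries

/-- The derivation `θ = z d/dz` on power series. -/
def thetaPS (p : ℂ⟦X⟧) : ℂ⟦X⟧ := PowerSeries.X * PowerSeries.derivative ℂ p

theorem coeff_thetaPS (p : ℂ⟦X⟧) (n : ℕ) :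
    PowerSeries.coeff n (thetaPS p) = n * PowerSeries.coeff n p := by
  rw [thetaPS]
  cases n with
  | zero => simp
  | succ n =>
    rw [PowerSeries.coeff_succ_X_mul, PowerSeries.coeff_derivative]
    push_cast
    ring

theorem thetaPS_add (p q : ℂ⟦X⟧) : thetaPS (p + q) = thetaPS p + thetaPS q := by
  rw [thetaPS, thetaPS, thetaPS, map_add, mul_add]

theorem thetaPS_sub (p q : ℂ⟦X⟧) : thetaPS (p - q) = thetaPS p - thetaPS q := by
  rw [thetaPS, thetaPS, thetaPS, map_sub, mul_sub]

theorem thetaPS_mul (p q : ℂ⟦X⟧) : thetaPS (p * q) = thetaPS p * q + p * thetaPS q := by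
  rw [thetaPS, thetaPS, thetaPS, Derivation.leibniz, smul_eq_mul, smul_eq_mul]
  ring

theorem thetaPS_X : thetaPS PowerSeries.X = PowerSeries.X := by
  rw [thetaPS, PowerSeries.derivative_X, mul_one]

theorem thetaPS_smul (c : ℂ) (p : ℂ⟦X⟧) : thetaPS (c • p) = c • thetaPS p := by
  rw [thetaPS, thetaPS, Derivation.map_smul, mul_smul_comm]

theorem eq_C_of_thetaPS_eq_zero {p : ℂ⟦X⟧} (h : thetaPS p = 0) :
    p = PowerSeries.C (PowerSeries.constantCoeff p) := by
  ext n
  rw [PowerSeries.coeff_C]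
  split_ifs with hn
  · subst hn
    simp
  · have := congrArg (PowerSeries.coeff n) h
    rw [coeff_thetaPS, map_zero] at this
    exact (mul_eq_zero.1 this).resolve_left (by exact_mod_cast hn)

theorem constantCoeff_thetaPS (p : ℂ⟦X⟧) : PowerSeries.constantCoeff (thetaPS p) = 0 := by
  simp [thetaPS]

/-- The power series `I₀`. -/
def F₀ : ℂ⟦X⟧ := PowerSeries.mk fun n => frobeniusCoeff n 0

/-- The power series `J₁`. -/
def F₁ : ℂ⟦X⟧ := PowerSeries.mk fun n => deriv (frobeniusCoeff n) 0

theorem frobeniusCoeff_zero (ε : ℂ) : frobeniusCoeff 0 ε = 1 := by simp [frobeniusCoeff]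

theorem frobeniusCoeff_succ (n : ℕ) (ε : ℂ) : frobeniusCoeff (n + 1) ε = frobeniusCoeff n ε *
    ((ε + n + 1 / 5) * (ε + n + 2 / 5) * (ε + n + 3 / 5) * (ε + n + 4 / 5) / (ε + n + 1) ^ 4) := by
  rw [frobeniusCoeff, Finset.prod_range_succ, ← frobeniusCoeff]
  congr 1
  simp [Finset.prod_Icc_succ_top]

theorem differentiableAt_frobeniusCoeff (n : ℕ) {ε : ℂ} (h : ∀ m : ℕ, ε + m + 1 ≠ 0) :
    DifferentiableAt ℂ (frobeniusCoeff n) ε := by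
  induction n with
  | zero =>
    have : frobeniusCoeff 0 = fun _ => 1 := funext frobeniusCoeff_zero
    rw [this]
    fun_prop
  | succ n ih =>
    have : frobeniusCoeff (n + 1) = fun ε => frobeniusCoeff n ε * ((ε + n + 1 / 5) *
      (ε + n + 2 / 5) * (ε + n + 3 / 5) * (ε + n + 4 / 5) / (ε + n + 1) ^ 4) :=
      funext (frobeniusCoeff_succ n)
    rw [this]
    refine ih.mul (DifferentiableAt.div (by fun_prop) (by fun_prop) (pow_ne_zero 4 (h n)))

theorem natCast_succ_ne_zero (n : ℕ) : (0 : ℂ) + n + 1 ≠ 0 := by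
  rw [zero_add]
  exact_mod_cast n.succ_ne_zero

/-- The recursion for the coefficients of `I₀`. -/
theorem frobeniusCoeff_rec (n : ℕ) : ((n : ℂ) + 1) ^ 4 * frobeniusCoeff (n + 1) 0 =
    (n ^ 4 + 2 * n ^ 3 + 7 / 5 * n ^ 2 + 2 / 5 * n + 24 / 625) * frobeniusCoeff n 0 := by
  have h := natCast_succ_ne_zero n
  rw [zero_add] at h
  rw [frobeniusCoeff_succ]
  simp only [zero_add]
  field_simp
  ring

/-- The recursion for the coefficients of `J₁`. -/
theorem deriv_frobeniusCoeff_rec (n : ℕ) : ((n : ℂ) + 1) ^ 4 * deriv (frobeniusCoeff (n + 1)) 0 +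
    4 * (n + 1) ^ 3 * frobeniusCoeff (n + 1) 0 =
    (n ^ 4 + 2 * n ^ 3 + 7 / 5 * n ^ 2 + 2 / 5 * n + 24 / 625) * deriv (frobeniusCoeff n) 0 +
    (4 * n ^ 3 + 6 * n ^ 2 + 14 / 5 * n + 2 / 5) * frobeniusCoeff n 0 := by
  have hd : ∀ n, HasDerivAt (frobeniusCoeff n) (deriv (frobeniusCoeff n) 0) 0 := fun n =>
    (differentiableAt_frobeniusCoeff n natCast_succ_ne_zero).hasDerivAt
  have hlin : ∀ c : ℂ, HasDerivAt (fun ε : ℂ => ε + n + c) 1 0 := fun c =>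
    ((hasDerivAt_id (0 : ℂ)).add_const (n : ℂ)).add_const c
  have h1 := ((hlin 1).pow 4).mul (hd (n + 1))
  have h2 := ((((hlin (1 / 5)).mul (hlin (2 / 5))).mul (hlin (3 / 5))).mul (hlin (4 / 5))).mul (hd n)
  have h3 : (fun ε : ℂ => ε + n + 1) ^ 4 * frobeniusCoeff (n + 1) =ᶠ[𝓝 0]
      (fun ε : ℂ => ε + n + 1 / 5) * (fun ε : ℂ => ε + n + 2 / 5) *
        (fun ε : ℂ => ε + n + 3 / 5) * (fun ε : ℂ => ε + n + 4 / 5) * frobeniusCoeff n := by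
    filter_upwards [(hlin 1).continuousAt.eventually_ne (natCast_succ_ne_zero n)] with ε hε
    simp only [Pi.mul_apply, Pi.pow_apply, frobeniusCoeff_succ]
    field_simp
  have h4 := h1.unique (h2.congr_of_eventuallyEq h3)
  simp only [Pi.mul_apply, Pi.pow_apply, zero_add] at h4
  push_cast at h4
  linear_combination h4

theorem F₀_ode : thetaPS (thetaPS (thetaPS (thetaPS F₀))) = PowerSeries.X *
    (thetaPS (thetaPS (thetaPS (thetaPS F₀))) + (2 : ℂ) • thetaPS (thetaPS (thetaPS F₀)) +
      (7 / 5 : ℂ) • thetaPS (thetaPS F₀) + (2 / 5 : ℂ) • thetaPS F₀ + (24 / 625 : ℂ) • F₀) := by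
  ext n
  cases n with
  | zero => simp [thetaPS]
  | succ n =>
    rw [PowerSeries.coeff_succ_X_mul]
    simp only [map_add, PowerSeries.coeff_smul, coeff_thetaPS, F₀, PowerSeries.coeff_mk, smul_eq_mul]
    have := frobeniusCoeff_rec n
    push_cast
    linear_combination this

/-- The logarithm-free parts of the functions `θ ^ k I₁`. -/
def logJet : ℕ → ℂ⟦X⟧
  | 0 => F₁
  | n + 1 => thetaPS (logJet n) + thetaPS^[n] F₀

/-- The coefficients of this identity are the `ε`-derivative of the Frobenius recursion at `ε = 0`;
the part of `I₁` with the logarithm is governed by `F₀_ode`. -/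
theorem logJet_ode : logJet 4 = PowerSeries.X * (logJet 4 + (2 : ℂ) • logJet 3 +
    (7 / 5 : ℂ) • logJet 2 + (2 / 5 : ℂ) • logJet 1 + (24 / 625 : ℂ) • logJet 0) := by
  ext n
  cases n with
  | zero => simp [logJet, thetaPS]
  | succ n =>
    rw [PowerSeries.coeff_succ_X_mul]
    simp only [logJet, map_add, PowerSeries.coeff_smul, coeff_thetaPS, Function.iterate_succ,
      Function.iterate_zero, Function.comp_apply, id, F₀, F₁, PowerSeries.coeff_mk, smul_eq_mul]
    have := deriv_frobeniusCoeff_rec n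
    push_cast
    linear_combination this

/-- The Wronskian of `I₀` and `I₁` with respect to `θ`. -/
def wronskPS : ℂ⟦X⟧ := F₀ * logJet 1 - thetaPS F₀ * logJet 0

theorem constantCoeff_F₀ : PowerSeries.constantCoeff F₀ = 1 := by
  rw [← PowerSeries.coeff_zero_eq_constantCoeff_apply, F₀, PowerSeries.coeff_mk, frobeniusCoeff_zero]

theorem constantCoeff_wronskPS : PowerSeries.constantCoeff wronskPS = 1 := by
  simp [wronskPS, logJet, constantCoeff_thetaPS, constantCoeff_F₀]

theorem thetaPS_wronskPS : thetaPS wronskPS = F₀ * logJet 2 - thetaPS (thetaPS F₀) * logJet 0 := by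
  simp only [wronskPS, thetaPS_sub, thetaPS_mul, logJet, thetaPS_add, Function.iterate_succ,
      Function.iterate_zero, Function.comp_apply, id]
  ring

theorem thetaPS_thetaPS_wronskPS : thetaPS (thetaPS wronskPS) =
    F₀ * logJet 3 - thetaPS (thetaPS (thetaPS F₀)) * logJet 0 +
      (thetaPS F₀ * logJet 2 - thetaPS (thetaPS F₀) * logJet 1) := by
  rw [thetaPS_wronskPS]
  simp only [thetaPS_sub, thetaPS_mul, logJet, thetaPS_add, Function.iterate_succ,
      Function.iterate_zero, Function.comp_apply, id]
  ring

/-- The vanishing of the symplectic form on the pair `(I₀, I₁)`. -/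
theorem symplectic_eq_zero :
    (1 - PowerSeries.X) * (F₀ * logJet 3 - thetaPS (thetaPS (thetaPS F₀)) * logJet 0 -
      (thetaPS F₀ * logJet 2 - thetaPS (thetaPS F₀) * logJet 1)) =
    PowerSeries.X * (thetaPS wronskPS + (2 / 5 : ℂ) • wronskPS) := by
  rw [← sub_eq_zero]
  set Ω := (1 - PowerSeries.X) * (F₀ * logJet 3 - thetaPS (thetaPS (thetaPS F₀)) * logJet 0 -
      (thetaPS F₀ * logJet 2 - thetaPS (thetaPS F₀) * logJet 1)) -
    PowerSeries.X * (thetaPS wronskPS + (2 / 5 : ℂ) • wronskPS) with hΩ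
  have h0 : PowerSeries.constantCoeff Ω = 0 := by
    simp [hΩ, logJet, constantCoeff_thetaPS]
  -- The derivative is `I₀` times the equation for `I₁` minus `I₁` times the equation for `I₀`. The
  -- lower order terms cancel because of the coefficient relation `7/5 = 1 + 2/5`, the self-duality
  -- of the operator.
  have h1 : thetaPS Ω = 0 := by
    have e1 := F₀_ode
    have e2 := logJet_ode
    have e3 : thetaPS (logJet 3) = logJet 4 - thetaPS (thetaPS (thetaPS F₀)) := by
      simp [logJet]
    have e4 : thetaPS (logJet 2) = logJet 3 - thetaPS (thetaPS F₀) := by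
      simp [logJet]
    have e5 : thetaPS (logJet 1) = logJet 2 - thetaPS F₀ := by
      simp [logJet]
    have e6 : thetaPS (logJet 0) = logJet 1 - F₀ := by
      simp [logJet]
    have e7 : thetaPS (1 : ℂ⟦X⟧) = 0 := by simp [thetaPS]
    rw [hΩ]
    simp only [thetaPS_sub, thetaPS_mul, thetaPS_X, thetaPS_add, thetaPS_smul,
      thetaPS_thetaPS_wronskPS, e3, e4, e5, e6, e7]
    rw [thetaPS_wronskPS, wronskPS]
    simp only [PowerSeries.smul_eq_C_mul] at e1 e2 ⊢
    have c2 : (PowerSeries.C (2 : ℂ) : ℂ⟦X⟧) = 2 := map_ofNat _ 2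
    have c75 : (PowerSeries.C (7 / 5 : ℂ) : ℂ⟦X⟧) = 1 + PowerSeries.C (2 / 5 : ℂ) := by
      rw [← map_one PowerSeries.C, ← map_add]
      norm_num
    rw [c2, c75] at e1 e2
    generalize thetaPS (thetaPS (thetaPS (thetaPS F₀))) = f4 at *
    generalize thetaPS (thetaPS (thetaPS F₀)) = f3 at *
    generalize thetaPS (thetaPS F₀) = f2 at *
    generalize thetaPS F₀ = f1 at *
    generalize (PowerSeries.X : ℂ⟦X⟧) = x at *
    linear_combination F₀ * e2 - logJet 0 * e1
  rw [eq_C_of_thetaPS_eq_zero h1, h0, map_zero]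

/-- The differential equation of second order for the Wronskian. -/
theorem wronskPS_ode : (1 - PowerSeries.X) * (F₀ * thetaPS (thetaPS wronskPS) -
      2 * (thetaPS F₀ * thetaPS wronskPS - thetaPS (thetaPS F₀) * wronskPS)) =
    PowerSeries.X * F₀ * (thetaPS wronskPS + (2 / 5 : ℂ) • wronskPS) := by
  have h := symplectic_eq_zero
  -- A Plücker relation: multiplied by `I₀`, the minor of first and second derivatives is expressed
  -- through the Wronskian and its derivative, so `I₁` disappears.
  have h1 : F₀ * (thetaPS F₀ * logJet 2 - thetaPS (thetaPS F₀) * logJet 1) =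
      thetaPS F₀ * thetaPS wronskPS - thetaPS (thetaPS F₀) * wronskPS := by
    rw [thetaPS_wronskPS, wronskPS]
    ring
  rw [thetaPS_thetaPS_wronskPS, ← h1]
  linear_combination F₀ * h

end FrobeniusSeries

/-! ### The differential ring -/

section DifferentialRing

theorem coe_thetaPS (p : ℂ⟦X⟧) : ((thetaPS p : ℂ⟦X⟧) : ℂ⸨X⸩) = zLS * ddz (p : ℂ⸨X⸩) := by
  rw [thetaPS, PowerSeries.coe_mul, ddz_coe]

theorem coe_ne_zero_of_constantCoeff {p : ℂ⟦X⟧} (h : PowerSeries.constantCoeff p = 1) :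
    (p : ℂ⸨X⸩) ≠ 0 := by
  intro h0
  have h1 : (p : ℂ⸨X⸩).coeff 0 = 0 := by rw [h0, HahnSeries.coeff_zero]
  rw [PowerSeries.coeff_coe, if_neg (lt_irrefl _), Int.natAbs_zero,
    PowerSeries.coeff_zero_eq_constantCoeff_apply, h] at h1
  exact one_ne_zero h1

theorem I₀_eq : I₀ = (F₀ : ℂ⸨X⸩) := rfl

theorem J₁_eq : J₁ = (F₁ : ℂ⸨X⸩) := rfl

theorem I₀_ne_zero : I₀ ≠ 0 := coe_ne_zero_of_constantCoeff constantCoeff_F₀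

/-- The derivative `T'` in terms of the Wronskian of `I₀` and `I₁`. -/
theorem coe_wronskPS : (wronskPS : ℂ⸨X⸩) = zLS * I₀ ^ 2 * T' := by
  have h0 := I₀_ne_zero
  have hz := zLS_ne_zero
  rw [T', ddz_div _ h0, single_neg_one, wronskPS]
  simp only [PowerSeries.coe_sub, PowerSeries.coe_mul, coe_thetaPS, logJet, PowerSeries.coe_add,
    Function.iterate_zero, id, ← I₀_eq, ← J₁_eq]
  field_simp
  ring

theorem T'_ne_zero : T' ≠ 0 := by
  intro h
  have := coe_ne_zero_of_constantCoeff constantCoeff_wronskPS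
  rw [coe_wronskPS, h, mul_zero] at this
  exact this rfl

theorem coe_C_eq (c : ℂ) : ((PowerSeries.C c : ℂ⟦X⟧) : ℂ⸨X⸩) = HahnSeries.C c :=
  PowerSeries.coe_C c

instance charZero_laurentSeries : CharZero ℂ⸨X⸩ :=
  charZero_of_injective_ringHom (HahnSeries.C_injective (Γ := ℤ) (R := ℂ))

theorem one_sub_zLS_ne_zero : 1 - zLS ≠ 0 := by
  have h : ((1 - PowerSeries.X : ℂ⟦X⟧) : ℂ⸨X⸩) ≠ 0 :=
    coe_ne_zero_of_constantCoeff (by simp)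
  rwa [PowerSeries.coe_sub, PowerSeries.coe_one] at h

/-- The fourth derivative of `I₀`. -/
theorem ddz_ddz_ddz_ddz_I₀ : ddz (ddz (ddz (ddz I₀))) =
    (zLS ^ 3 * (1 - zLS))⁻¹ * ((8 * zLS ^ 3 - 6 * zLS ^ 2) * ddz (ddz (ddz I₀)) +
      (72 / 5 * zLS ^ 2 - 7 * zLS) * ddz (ddz I₀) + (24 / 5 * zLS - 1) * ddz I₀ +
      24 / 625 * I₀) := by
  have hz := zLS_ne_zero
  have h1 := one_sub_zLS_ne_zero
  have h := congrArg (fun p : ℂ⟦X⟧ => (p : ℂ⸨X⸩)) F₀_ode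
  simp only [PowerSeries.coe_mul, PowerSeries.coe_add, coe_thetaPS, PowerSeries.smul_eq_C_mul,
    coe_C_eq, map_div₀, map_ofNat, ddz_mul, ddz_add, ddz_zLS, ← I₀_eq, one_mul] at h
  rw [eq_inv_mul_iff_mul_eq₀ (mul_ne_zero (pow_ne_zero 3 hz) h1)]
  refine mul_left_cancel₀ hz ?_
  linear_combination h

/-- The second derivative of `T'`, in terms of logarithmic derivatives. -/
theorem ddz_ddz_T' {g₁ g₂ g₄ : ℂ⸨X⸩} (h₁ : ddz I₀ = g₁ * I₀) (h₂ : ddz (ddz I₀) = g₂ * I₀)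
    (h₄ : ddz T' = g₄ * T') : ddz (ddz T') =
      (zLS ^ 2 * (1 - zLS))⁻¹ * ((1 - zLS) * (-1 - 3 * zLS * g₄ - 2 * zLS * g₁ * (1 + zLS * g₄)
        - 4 * (zLS * g₁ + zLS ^ 2 * g₂) + 2 * (zLS * g₁) ^ 2) +
        zLS * (2 * zLS * g₁ + 1 + zLS * g₄ + 2 / 5)) * T' := by
  have hz := zLS_ne_zero
  have h1 := one_sub_zLS_ne_zero
  have h := congrArg (fun p : ℂ⟦X⟧ => (p : ℂ⸨X⸩)) wronskPS_ode
  have c2 : ((2 : ℂ⟦X⟧) : ℂ⸨X⸩) = 2 := by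
    rw [← map_ofNat PowerSeries.C 2, coe_C_eq, map_ofNat]
  simp only [PowerSeries.coe_mul, PowerSeries.coe_add, PowerSeries.coe_sub, PowerSeries.coe_one,
    coe_thetaPS, PowerSeries.smul_eq_C_mul, c2, coe_C_eq, map_div₀, map_ofNat, coe_wronskPS,
    ddz_mul, ddz_add, ddz_zLS, ← I₀_eq, one_mul, pow_two] at h
  rw [mul_assoc, eq_inv_mul_iff_mul_eq₀ (mul_ne_zero (pow_ne_zero 2 hz) h1)]
  generalize ddz (ddz T') = t at h ⊢
  simp only [h₂] at h
  simp only [h₁, h₄] at h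
  refine mul_left_cancel₀ (mul_ne_zero hz (pow_ne_zero 3 I₀_ne_zero)) ?_
  linear_combination h

theorem algebraMap_mem_FYY (r : RatFunc ℂ) : algebraMap (RatFunc ℂ) ℂ⸨X⸩ r ∈ FYY :=
  FYY.algebraMap_mem r

theorem generator_mem (k : Fin 4) : generator k ∈ FYY :=
  Algebra.subset_adjoin ⟨k, rfl⟩

theorem zLS_mem_FYY : zLS ∈ FYY := by
  rw [← algebraMap_X]
  exact algebraMap_mem_FYY _

/-- By the rule for differentiating a quotient, only `I₀''''/I₀` and `T'''/T'` are new, and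
`ddz_ddz_ddz_ddz_I₀` and `ddz_ddz_T'` express them by generators, with powers of `z` and `1 - z` as
denominators. -/
theorem ddz_generator_mem (k : Fin 4) : ddz (generator k) ∈ FYY := by
  have h0 := I₀_ne_zero
  have ht := T'_ne_zero
  have hz := zLS_ne_zero
  have hz1 := one_sub_zLS_ne_zero
  have m1 : ddz I₀ / I₀ ∈ FYY := generator_mem 0
  have m2 : ddz (ddz I₀) / I₀ ∈ FYY := generator_mem 1
  have m3 : ddz (ddz (ddz I₀)) / I₀ ∈ FYY := generator_mem 2
  have m4 : ddz T' / T' ∈ FYY := generator_mem 3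
  have mz := zLS_mem_FYY
  have mq : ∀ q : ℚ, (q : ℂ⸨X⸩) ∈ FYY := fun q => by
    rw [← map_ratCast (algebraMap (RatFunc ℂ) ℂ⸨X⸩) q]
    exact algebraMap_mem_FYY _
  have mi : ∀ n, (zLS ^ n * (1 - zLS))⁻¹ ∈ FYY := fun n => by
    have := algebraMap_mem_FYY (RatFunc.X ^ n * (1 - RatFunc.X))⁻¹
    rwa [map_inv₀, map_mul, map_pow, map_sub, map_one, algebraMap_X] at this
  have m75 := mq (72 / 5)
  have m24 := mq (24 / 5)
  have m25 := mq (2 / 5)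
  have m625 := mq (24 / 625)
  push_cast at m75 m24 m25 m625
  have mn : ∀ n : ℕ, [n.AtLeastTwo] → (OfNat.ofNat n : ℂ⸨X⸩) ∈ FYY := fun n _ => ofNat_mem FYY n
  have hlog : ∀ f g : ℂ⸨X⸩, g ≠ 0 → ddz (f / g) = ddz f / g - (ddz g / g) * (f / g) := by
    intro f g hg
    rw [ddz_div f hg]
    field_simp
  fin_cases k
  · show ddz (ddz I₀ / I₀) ∈ FYY
    rw [hlog _ _ h0]
    exact sub_mem m2 (mul_mem m1 m1)
  · show ddz (ddz (ddz I₀) / I₀) ∈ FYY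
    rw [hlog _ _ h0]
    exact sub_mem m3 (mul_mem m1 m2)
  · show ddz (ddz (ddz (ddz I₀)) / I₀) ∈ FYY
    rw [hlog _ _ h0]
    refine sub_mem ?_ (mul_mem m1 m3)
    rw [ddz_ddz_ddz_ddz_I₀, mul_div_assoc, add_div, add_div, add_div, mul_div_assoc,
      mul_div_assoc, mul_div_assoc, mul_div_assoc, div_self h0, mul_one]
    refine mul_mem (mi 3) ?_
    repeat' first
      | assumption | apply add_mem | apply sub_mem | apply mul_mem | apply pow_mem | apply mn
      | apply one_mem
  · show ddz (ddz T' / T') ∈ FYY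
    rw [hlog _ _ ht]
    refine sub_mem ?_ (mul_mem m4 m4)
    rw [ddz_ddz_T' (g₁ := ddz I₀ / I₀) (g₂ := ddz (ddz I₀) / I₀) (g₄ := ddz T' / T')
      (by field_simp) (by field_simp) (by field_simp), mul_div_assoc, div_self ht, mul_one]
    refine mul_mem (mi 2) ?_
    clear hlog m3 m24 m75 m625
    generalize ddz I₀ / I₀ = g₁ at m1 ⊢
    generalize ddz (ddz I₀) / I₀ = g₂ at m2 ⊢
    generalize ddz T' / T' = g₄ at m4 ⊢
    generalize (2 / 5 : ℂ⸨X⸩) = c at m25 ⊢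
    have mneg : (-1 : ℂ⸨X⸩) ∈ FYY := neg_mem (one_mem _)
    repeat' first
      | assumption | apply add_mem | apply sub_mem | apply mul_mem | apply pow_mem | apply mn
      | apply one_mem

theorem ddz_mem_FYY {f : ℂ⸨X⸩} (hf : f ∈ FYY) : ddz f ∈ FYY := by
  refine Algebra.adjoin_induction (p := fun f _ => ddz f ∈ FYY) ?_ ?_ ?_ ?_ hf
  · rintro _ ⟨k, rfl⟩
    exact ddz_generator_mem k
  · intro r
    obtain ⟨s, hs⟩ := ddz_algebraMap r
    rw [hs]
    exact algebraMap_mem_FYY s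
  · intro f g _ _ hf hg
    rw [ddz_add]
    exact add_mem hf hg
  · intro f g hf' hg' hf hg
    rw [ddz_mul]
    exact add_mem (mul_mem hf hg') (mul_mem hf' hg)

theorem exists_derivation_FYY :
    ∃ d : Derivation ℤ FYY FYY, ∀ f : FYY, (d f : ℂ⸨X⸩) = ddz (f : ℂ⸨X⸩) := by
  let L : FYY →+ FYY :=
    { toFun := fun f => ⟨ddz f, ddz_mem_FYY f.2⟩
      map_zero' := Subtype.ext (map_zero _)
      map_add' := fun f g => Subtype.ext (ddz_add f g) }
  refine ⟨Derivation.mk' L.toIntLinearMap ?_, fun f => rfl⟩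
  intro f g
  refine Subtype.ext ?_
  show ddz ((f : ℂ⸨X⸩) * g) = (f : ℂ⸨X⸩) * ddz g + (g : ℂ⸨X⸩) * ddz f
  rw [ddz_mul]
  ring

end DifferentialRing

/-! ### Convergence at `z = 0` -/

section ConvergentSeries

/-- The power series `p` converges near `0`, with sum `f`. -/
def IsExpansion (p : ℂ⟦X⟧) (f : ℂ → ℂ) : Prop :=
  ∀ᶠ z in 𝓝 (0 : ℂ), HasSum (fun n => PowerSeries.coeff n p * z ^ n) (f z)

variable {p q : ℂ⟦X⟧} {f g : ℂ → ℂ}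

theorem isExpansion_iff : IsExpansion p f ↔ HasFPowerSeriesAt f
    (FormalMultilinearSeries.ofScalars ℂ fun n => PowerSeries.coeff n p) 0 := by
  rw [hasFPowerSeriesAt_iff, IsExpansion]
  refine eventually_congr (Eventually.of_forall fun z => ?_)
  simp [FormalMultilinearSeries.coeff_ofScalars, mul_comm]

theorem IsExpansion.analyticAt (h : IsExpansion p f) : AnalyticAt ℂ f 0 :=
  (isExpansion_iff.1 h).analyticAt

theorem IsExpansion.congr (h : IsExpansion p f) (hfg : f =ᶠ[𝓝 0] g) : IsExpansion p g := by
  filter_upwards [h, hfg] with z hz hz'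
  rwa [← hz']

theorem IsExpansion.eventuallyEq (h : IsExpansion p f) (h' : IsExpansion p g) : f =ᶠ[𝓝 0] g := by
  filter_upwards [h, h'] with z hz hz'
  exact hz.unique hz'

theorem IsExpansion.eq (h : IsExpansion p f) (h' : IsExpansion q f) : p = q := by
  have h1 := (isExpansion_iff.1 h).eq_formalMultilinearSeries (isExpansion_iff.1 h')
  ext n
  have h2 := congrArg (fun s : FormalMultilinearSeries ℂ ℂ ℂ => s.coeff n) h1
  simpa [FormalMultilinearSeries.coeff_ofScalars] using h2

theorem isExpansion_taylor (hf : AnalyticAt ℂ f 0) :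
    IsExpansion (PowerSeries.mk fun n => iteratedDeriv n f 0 / n.factorial) f := by
  rw [isExpansion_iff]
  simpa only [PowerSeries.coeff_mk] using hf.hasFPowerSeriesAt

theorem IsExpansion.coeff_eq (h : IsExpansion p f) (n : ℕ) :
    PowerSeries.coeff n p = iteratedDeriv n f 0 / n.factorial := by
  rw [h.eq (isExpansion_taylor h.analyticAt), PowerSeries.coeff_mk]

theorem IsExpansion.apply_zero (h : IsExpansion p f) : f 0 = PowerSeries.constantCoeff p := by
  rw [← PowerSeries.coeff_zero_eq_constantCoeff_apply, h.coeff_eq 0]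
  simp

theorem IsExpansion.add (h : IsExpansion p f) (h' : IsExpansion q g) :
    IsExpansion (p + q) fun z => f z + g z := by
  filter_upwards [h, h'] with z hz hz'
  simpa only [map_add, add_mul] using hz.add hz'

theorem IsExpansion.sub (h : IsExpansion p f) (h' : IsExpansion q g) :
    IsExpansion (p - q) fun z => f z - g z := by
  filter_upwards [h, h'] with z hz hz'
  simpa only [map_sub, sub_mul] using hz.sub hz'

theorem IsExpansion.smul (h : IsExpansion p f) (c : ℂ) : IsExpansion (c • p) fun z => c * f z := by
  filter_upwards [h] with z hz
  simpa only [PowerSeries.coeff_smul, smul_eq_mul, mul_assoc] using hz.mul_left c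

theorem IsExpansion.mul (h : IsExpansion p f) (h' : IsExpansion q g) :
    IsExpansion (p * q) fun z => f z * g z := by
  filter_upwards [h, h'] with z hz hz'
  have s1 := hz.summable.norm
  have s2 := hz'.summable.norm
  have h1 := tsum_mul_tsum_eq_tsum_sum_antidiagonal_of_summable_norm s1 s2
  have h2 := (summable_norm_sum_mul_antidiagonal_of_summable_norm s1 s2).of_norm.hasSum
  rw [← h1, hz.tsum_eq, hz'.tsum_eq] at h2
  refine h2.congr_fun fun n => ?_
  rw [PowerSeries.coeff_mul, Finset.sum_mul]
  refine Finset.sum_congr rfl fun ij hij => ?_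
  rw [← Finset.HasAntidiagonal.mem_antidiagonal.1 hij]
  ring

theorem isExpansion_X : IsExpansion PowerSeries.X fun z => z := by
  refine Eventually.of_forall fun z => ?_
  have := hasSum_single (f := fun n => PowerSeries.coeff n (PowerSeries.X : ℂ⟦X⟧) * z ^ n) 1
    fun n hn => by simp [PowerSeries.coeff_X, hn]
  simpa using this

theorem isExpansion_one : IsExpansion 1 fun _ => 1 := by
  refine Eventually.of_forall fun z => ?_
  have := hasSum_single (f := fun n => PowerSeries.coeff n (1 : ℂ⟦X⟧) * z ^ n) 0
    fun n hn => by simp [PowerSeries.coeff_one, hn]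
  simpa using this

theorem IsExpansion.derivative (h : IsExpansion p f) :
    IsExpansion (PowerSeries.derivative ℂ p) (deriv f) := by
  have h1 := isExpansion_taylor h.analyticAt.deriv
  convert h1 using 1
  ext n
  rw [PowerSeries.coeff_derivative, h.coeff_eq, PowerSeries.coeff_mk, iteratedDeriv_succ',
    Nat.factorial_succ]
  have : (n : ℂ) + 1 ≠ 0 := by exact_mod_cast n.succ_ne_zero
  have h3 : (n.factorial : ℂ) ≠ 0 := by exact_mod_cast n.factorial_ne_zero
  push_cast
  field_simp

theorem IsExpansion.theta (h : IsExpansion p f) : IsExpansion (thetaPS p) fun z => z * deriv f z :=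
  isExpansion_X.mul h.derivative

/-- The Taylor series of `1 / f` multiplies with `p` to `1` by uniqueness of expansions, so it is
the formal inverse. -/
theorem IsExpansion.inv (h : IsExpansion p f) (h0 : PowerSeries.constantCoeff p ≠ 0) :
    IsExpansion p⁻¹ fun z => (f z)⁻¹ := by
  have hf0 : f 0 ≠ 0 := by rwa [h.apply_zero]
  have h1 := isExpansion_taylor (h.analyticAt.fun_inv hf0)
  have h2 := (h1.mul h).eq (isExpansion_one.congr ?_)
  · rwa [(PowerSeries.eq_inv_iff_mul_eq_one h0).2 h2] at h1
  · filter_upwards [h.analyticAt.continuousAt.eventually_ne hf0] with z hz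
    rw [inv_mul_cancel₀ hz]

theorem isExpansion_of_bounded {C : ℝ} (h : ∀ n, ‖PowerSeries.coeff n p‖ ≤ C) :
    ∃ f, IsExpansion p f := by
  refine ⟨fun z => ∑' n, PowerSeries.coeff n p * z ^ n, ?_⟩
  filter_upwards [Metric.ball_mem_nhds (0 : ℂ) one_pos] with z hz
  refine Summable.hasSum (Summable.of_norm_bounded (g := fun n => C * ‖z‖ ^ n) ?_ fun n => ?_)
  · exact (summable_geometric_of_lt_one (norm_nonneg _) (by simpa using hz)).mul_left C
  · rw [norm_mul, norm_pow]
    exact mul_le_mul_of_nonneg_right (h n) (by positivity)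

/-- Laurent series with a pole of order at most `k`. -/
theorem IsExpansion.hasSum_laurent (h : IsExpansion p f) {g : ℂ⸨X⸩} {k : ℕ}
    (hg : zLS ^ k * g = (p : ℂ⸨X⸩)) :
    ∀ᶠ z in 𝓝 (0 : ℂ), z ≠ 0 → HasSum (fun n : ℤ => g.coeff n * z ^ n) (f z / z ^ k) := by
  have hc : ∀ n : ℤ, g.coeff n = (p : ℂ⸨X⸩).coeff (n + k) := by
    intro n
    rw [← hg, zLS, PowerSeries.coe_X, HahnSeries.single_pow, HahnSeries.coeff_single_mul]
    simp
  filter_upwards [h] with z hz h0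
  have h1 : HasSum (fun n : ℤ => (p : ℂ⸨X⸩).coeff n * z ^ n) (f z) := by
    have hinj : Function.Injective (fun n : ℕ => (n : ℤ)) := Nat.cast_injective
    rw [← hinj.hasSum_iff]
    · refine hz.congr_fun fun n => ?_
      simp [PowerSeries.coeff_coe]
    · intro n hn
      have : n < 0 := by
        by_contra h
        exact hn ⟨n.toNat, by simp; omega⟩
      rw [PowerSeries.coeff_coe, if_pos this, zero_mul]
  have h2 := ((Equiv.addRight (k : ℤ)).hasSum_iff.2 h1).div_const (z ^ k)
  refine h2.congr_fun fun n => ?_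
  simp only [Function.comp_apply, Equiv.coe_addRight]
  rw [hc, zpow_add₀ h0, zpow_natCast]
  field_simp

end ConvergentSeries

/-! ### Bounds for the Frobenius coefficients. -/

section FrobeniusConvergence

/-- Since `Re ε ≥ -1/10`, each factor `ε + n + k/5` of a numerator is at most `ε + n + 1` in
modulus. Uniformity in `ε` is what allows Cauchy's estimate to bound the `ε`-derivatives. -/
theorem norm_frobeniusCoeff_le (n : ℕ) {ε : ℂ} (hε : ‖ε‖ ≤ 1 / 10) : ‖frobeniusCoeff n ε‖ ≤ 1 := by
  induction n with
  | zero => simp [frobeniusCoeff_zero]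
  | succ n ih =>
    have hre : |ε.re| ≤ 1 / 10 := (Complex.abs_re_le_norm ε).trans hε
    rw [abs_le] at hre
    have hn : (0 : ℝ) ≤ n := n.cast_nonneg
    have hle : ∀ c : ℝ, 1 / 5 ≤ c → c ≤ 4 / 5 → ‖ε + n + c‖ ≤ ‖ε + n + 1‖ := by
      intro c hc hc'
      rw [← sq_le_sq₀ (norm_nonneg _) (norm_nonneg _), ← Complex.normSq_eq_norm_sq,
        ← Complex.normSq_eq_norm_sq, Complex.normSq_apply, Complex.normSq_apply]
      simp
      nlinarith
    have hpos : 0 < ‖ε + n + 1‖ := by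
      rw [norm_pos_iff]
      intro h
      have := congrArg Complex.re h
      simp at this
      linarith
    rw [frobeniusCoeff_succ, norm_mul, norm_div, norm_pow]
    refine mul_le_one₀ ih (by positivity) ?_
    rw [div_le_one (by positivity), norm_mul, norm_mul, norm_mul]
    have h1 := hle (1 / 5) (by norm_num) (by norm_num)
    have h2 := hle (2 / 5) (by norm_num) (by norm_num)
    have h3 := hle (3 / 5) (by norm_num) (by norm_num)
    have h4 := hle (4 / 5) (by norm_num) (by norm_num)
    push_cast at h1 h2 h3 h4
    calc _ ≤ ‖ε + n + 1‖ * ‖ε + n + 1‖ * ‖ε + n + 1‖ * ‖ε + n + 1‖ := by gcongr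
      _ = _ := by ring

theorem exists_isExpansion_F₀ : ∃ f, IsExpansion F₀ f :=
  isExpansion_of_bounded (C := 1) fun n => by
    rw [F₀, PowerSeries.coeff_mk]
    exact norm_frobeniusCoeff_le n (by simp)

theorem exists_isExpansion_F₁ : ∃ f, IsExpansion F₁ f :=
  isExpansion_of_bounded (C := 1 / (1 / 10)) fun n => by
    rw [F₁, PowerSeries.coeff_mk]
    refine Complex.norm_deriv_le_of_forall_mem_sphere_norm_le (by norm_num) ?_ fun ε hε =>
      norm_frobeniusCoeff_le n (by simpa using hε.le)
    refine DifferentiableOn.diffContOnCl fun ε hε => ?_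
    refine (differentiableAt_frobeniusCoeff n fun m h => ?_).differentiableWithinAt
    rw [closure_ball _ (by norm_num)] at hε
    have h1 : ‖ε‖ ≤ 1 / 10 := by simpa using hε
    have h2 := (abs_le.1 ((Complex.abs_re_le_norm ε).trans h1)).1
    have h3 := congrArg Complex.re h
    have h4 : (0 : ℝ) ≤ m := m.cast_nonneg
    simp at h3
    linarith

end FrobeniusConvergence

/-! ### Continuation of the generators -/

section CuspBehaviour

theorem tendsto_hptm_inv : Tendsto (fun τ : ℍ => (hptm τ)⁻¹) atImInfty (𝓝 0) :=
  tendsto_inv₀_cobounded.comp isHauptmodul_hptm.cusp_zero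

theorem eventually_hptm_ne_zero : ∀ᶠ τ : ℍ in atImInfty, hptm τ ≠ 0 :=
  isHauptmodul_hptm.cusp_zero.eventually_ne_cobounded 0

/-- Identity theorem for functions of `z = 1 / b` near the cusp `i∞`. -/
theorem exists_forall_eq_of_eventually_eq {φ : ℂ → ℂ} (hφ : AnalyticAt ℂ φ 0) :
    ∃ Y : ℝ, ∀ Φ : ℂ → ℂ, (∀ x : ℂ, 0 < x.im → AnalyticAt ℂ Φ x) → ∀ x₀ : ℂ, Y < x₀.im →
      (∀ᶠ x in 𝓝 x₀, Φ x = φ (hptm x)⁻¹) → ∀ τ : ℍ, Y < τ.im → Φ τ = φ (hptm τ)⁻¹ := by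
  have hev : ∀ᶠ τ : ℍ in atImInfty, hptm τ ≠ 0 ∧ AnalyticAt ℂ φ (hptm τ)⁻¹ :=
    eventually_hptm_ne_zero.and (tendsto_hptm_inv.eventually hφ.eventually_analyticAt)
  -- The height depends on `φ` alone and not on `Φ`: the base point from which `Φ` is continued is
  -- chosen afterwards, above this height.
  obtain ⟨A, hA⟩ := UpperHalfPlane.atImInfty_mem _ |>.1 hev
  refine ⟨max A 0, fun Φ hΦ x₀ hx₀ h τ hτ => ?_⟩
  have hS : IsPreconnected {x : ℂ | max A 0 < x.im} :=
    (convex_halfSpace_im_gt (max A 0)).isPreconnected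
  refine AnalyticOnNhd.eqOn_of_preconnected_of_eventuallyEq (f := Φ)
    (g := fun x => φ (hptm x)⁻¹) (fun x hx => hΦ x ((le_max_right A 0).trans_lt hx))
    (fun x hx => ?_) hS hx₀ h hτ
  have hx0 : 0 < x.im := (le_max_right A 0).trans_lt hx
  have h1 := hA ⟨x, hx0⟩ ((le_max_left A 0).trans_lt hx).le
  exact AnalyticAt.fun_comp (g := φ) h1.2 ((analyticAt_hptm hx0).fun_inv h1.1)

/-- The nome tends to `0` with `z`, and its modulus is `exp(-2π Im τ / width)`. -/
theorem eventually_lt_im_hypTau (Y : ℝ) :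
    ∀ᶠ z in 𝓝 (0 : ℂ), z ∈ doubleCutPlane → Y < (hypTau z).im := by
  have h1 : Tendsto (fun z => ‖nome z‖) (𝓝 0) (𝓝 0) := by
    have := (differentiableAt_nome zero_mem_cutPlane).continuousAt.norm.tendsto
    rwa [nome_zero, norm_zero] at this
  have hC0 : 0 < 2 * Real.pi / width := div_pos (by positivity) width_pos
  filter_upwards [h1.eventually_lt_const (Real.exp_pos (-(2 * Real.pi / width * Y)))] with z hz hz'
  rw [nome_eq hz', norm_cuspParam, Real.exp_lt_exp] at hz
  exact lt_of_mul_lt_mul_left (neg_lt_neg_iff.1 hz) hC0.le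

end CuspBehaviour

/-! ### Continuation of the periods and of their Wronskian. -/

section Periods

theorem IsExpansion.hasDerivAt {p : ℂ⟦X⟧} {f g : ℂ → ℂ} (h : IsExpansion p f)
    (h' : IsExpansion (thetaPS p) g) :
    ∀ᶠ z in 𝓝 (0 : ℂ), z ≠ 0 → HasDerivAt f (g z / z) z := by
  filter_upwards [h.analyticAt.eventually_analyticAt, h'.eventuallyEq h.theta] with z hz hz' h0
  refine hz.differentiableAt.hasDerivAt.congr_deriv ?_
  rw [hz']
  field_simp

theorem exists_isExpansion_iterate (i : ℕ) : ∃ f, IsExpansion (thetaPS^[i] F₀) f := by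
  induction i with
  | zero => exact exists_isExpansion_F₀
  | succ i ih =>
    obtain ⟨f, hf⟩ := ih
    rw [Function.iterate_succ_apply']
    exact ⟨_, hf.theta⟩

theorem exists_isExpansion_logJet (i : ℕ) : ∃ f, IsExpansion (logJet i) f := by
  induction i with
  | zero => exact exists_isExpansion_F₁
  | succ i ih =>
    obtain ⟨f, hf⟩ := ih
    obtain ⟨g, hg⟩ := exists_isExpansion_iterate i
    exact ⟨_, hf.theta.add hg⟩

/-- The function `θ ^ i I₀` near `z = 0`. -/
def jet₀ (i : ℕ) : ℂ → ℂ := (exists_isExpansion_iterate i).choose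

theorem isExpansion_jet₀ (i : ℕ) : IsExpansion (thetaPS^[i] F₀) (jet₀ i) :=
  (exists_isExpansion_iterate i).choose_spec

/-- The part without logarithm of the function `θ ^ i I₁` near `z = 0`. -/
def jetReg (i : ℕ) : ℂ → ℂ := (exists_isExpansion_logJet i).choose

theorem isExpansion_jetReg (i : ℕ) : IsExpansion (logJet i) (jetReg i) :=
  (exists_isExpansion_logJet i).choose_spec

/-- The function `θ ^ i I₁` near `z = 0`. -/
def jet₁ (i : ℕ) (z : ℂ) : ℂ := jet₀ i z * Complex.log z + jetReg i z

theorem hasDerivAt_jet₀ (i : ℕ) :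
    ∀ᶠ z in 𝓝 (0 : ℂ), z ≠ 0 → HasDerivAt (jet₀ i) (jet₀ (i + 1) z / z) z := by
  refine (isExpansion_jet₀ i).hasDerivAt ?_
  rw [← Function.iterate_succ_apply' thetaPS i F₀]
  exact isExpansion_jet₀ (i + 1)

/-- Differentiating the logarithm produces one extra copy of `θⁱ I₀`, which is the correction built
into `logJet`. -/
theorem hasDerivAt_jet₁ (i : ℕ) :
    ∀ᶠ z in 𝓝 (0 : ℂ), z ∈ Complex.slitPlane → HasDerivAt (jet₁ i) (jet₁ (i + 1) z / z) z := by
  have h : IsExpansion (thetaPS (logJet i)) fun z => jetReg (i + 1) z - jet₀ i z := by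
    have := (isExpansion_jetReg (i + 1)).sub (isExpansion_jet₀ i)
    rwa [logJet, add_sub_cancel_right] at this
  filter_upwards [hasDerivAt_jet₀ i, (isExpansion_jetReg i).hasDerivAt h] with z h1 h2 hz
  have h0 := Complex.slitPlane_ne_zero hz
  refine (((h1 h0).fun_mul (Complex.hasDerivAt_log hz)).fun_add (h2 h0)).congr_deriv ?_
  rw [jet₁]
  field_simp
  ring

theorem jet₀_ode : ∀ᶠ z in 𝓝 (0 : ℂ), jet₀ 4 z = z * (jet₀ 4 z + 2 * jet₀ 3 z +
    7 / 5 * jet₀ 2 z + 2 / 5 * jet₀ 1 z + 24 / 625 * jet₀ 0 z) := by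
  have h := isExpansion_X.mul (((((isExpansion_jet₀ 4).add ((isExpansion_jet₀ 3).smul 2)).add
    ((isExpansion_jet₀ 2).smul (7 / 5))).add ((isExpansion_jet₀ 1).smul (2 / 5))).add
    ((isExpansion_jet₀ 0).smul (24 / 625)))
  exact (isExpansion_jet₀ 4).eventuallyEq (by convert h using 1; exact F₀_ode)

theorem jetReg_ode : ∀ᶠ z in 𝓝 (0 : ℂ), jetReg 4 z = z * (jetReg 4 z + 2 * jetReg 3 z +
    7 / 5 * jetReg 2 z + 2 / 5 * jetReg 1 z + 24 / 625 * jetReg 0 z) := by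
  have h := isExpansion_X.mul (((((isExpansion_jetReg 4).add ((isExpansion_jetReg 3).smul 2)).add
    ((isExpansion_jetReg 2).smul (7 / 5))).add ((isExpansion_jetReg 1).smul (2 / 5))).add
    ((isExpansion_jetReg 0).smul (24 / 625)))
  rw [← logJet_ode] at h
  exact (isExpansion_jetReg 4).eventuallyEq h

theorem isExpansion_wronskPS :
    IsExpansion wronskPS fun z => jet₀ 0 z * jetReg 1 z - jet₀ 1 z * jetReg 0 z :=
  ((isExpansion_jet₀ 0).mul (isExpansion_jetReg 1)).sub
    ((isExpansion_jet₀ 1).mul (isExpansion_jetReg 0))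

theorem isExpansion_thetaPS_wronskPS :
    IsExpansion (thetaPS wronskPS) fun z => jet₀ 0 z * jetReg 2 z - jet₀ 2 z * jetReg 0 z := by
  rw [thetaPS_wronskPS]
  exact ((isExpansion_jet₀ 0).mul (isExpansion_jetReg 2)).sub
    ((isExpansion_jet₀ 2).mul (isExpansion_jetReg 0))

/-- The periods and their derivatives continue to components of flat automorphic forms, and the
logarithm disappears from the Wronskian of `I₀` and `I₁`. -/
theorem exists_flat_periods : ∃ F H : Fin 4 → ℂ → ℂ, (∀ i, Flat fun τ => F i τ) ∧
    (∀ i, Flat fun τ => H i τ) ∧ (∀ i, ∀ᶠ τ : ℍ in atImInfty, F i τ = jet₀ i (hptm τ)⁻¹) ∧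
    (∀ᶠ τ : ℍ in atImInfty, F 0 τ * H 1 τ - F 1 τ * H 0 τ =
      jet₀ 0 (hptm τ)⁻¹ * jetReg 1 (hptm τ)⁻¹ - jet₀ 1 (hptm τ)⁻¹ * jetReg 0 (hptm τ)⁻¹) ∧
    ∀ᶠ τ : ℍ in atImInfty, F 0 τ * H 2 τ - F 2 τ * H 0 τ =
      jet₀ 0 (hptm τ)⁻¹ * jetReg 2 (hptm τ)⁻¹ - jet₀ 2 (hptm τ)⁻¹ * jetReg 0 (hptm τ)⁻¹ := by
  have hjet : ∀ i : Fin 4, _ := fun i =>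
    exists_forall_eq_of_eventually_eq (isExpansion_jet₀ i).analyticAt
  choose Y hY using hjet
  obtain ⟨Y₁, hY₁⟩ := exists_forall_eq_of_eventually_eq isExpansion_wronskPS.analyticAt
  obtain ⟨Y₂, hY₂⟩ := exists_forall_eq_of_eventually_eq isExpansion_thetaPS_wronskPS.analyticAt
  have hfreq : ∃ᶠ z in 𝓝 (0 : ℂ), z ∈ doubleCutPlane :=
    mem_closure_iff_frequently.1 (cutPlane_subset_closure zero_mem_cutPlane)
  have hd₀ : ∀ᶠ z₀ in 𝓝 (0 : ℂ), ∀ i : Fin 4, ∀ᶠ z in 𝓝 z₀, z ≠ 0 →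
      HasDerivAt (jet₀ i) (jet₀ (i + 1) z / z) z :=
    eventually_all.2 fun i => (hasDerivAt_jet₀ i).eventually_nhds
  have hd₁ : ∀ᶠ z₀ in 𝓝 (0 : ℂ), ∀ i : Fin 4, ∀ᶠ z in 𝓝 z₀, z ∈ Complex.slitPlane →
      HasDerivAt (jet₁ i) (jet₁ (i + 1) z / z) z :=
    eventually_all.2 fun i => (hasDerivAt_jet₁ i).eventually_nhds
  have hYY : ∀ᶠ z in 𝓝 (0 : ℂ), ∀ i : Fin 4, z ∈ doubleCutPlane → Y i < (hypTau z).im :=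
    eventually_all.2 fun i => eventually_lt_im_hypTau (Y i)
  -- As `0` lies in the closure of the doubly cut plane, one base point can be chosen off the cuts,
  -- where all local equations hold and whose image in `ℍ` lies above all the heights.
  obtain ⟨z₀, hz₀, hd₀, hd₁, hYY, h1, h2, o₀, o₁⟩ := (hfreq.and_eventually (hd₀.and (hd₁.and
    (hYY.and ((eventually_lt_im_hypTau Y₁).and ((eventually_lt_im_hypTau Y₂).and
      (jet₀_ode.eventually_nhds.and jetReg_ode.eventually_nhds))))))).exists
  have hcut : ∀ᶠ z in 𝓝 z₀, z ∈ doubleCutPlane := isOpen_doubleCutPlane.mem_nhds hz₀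
  have hd₀' : ∀ i : Fin 4, ∀ᶠ z in 𝓝 z₀, HasDerivAt (jet₀ i) (jet₀ (i + 1) z / z) z := fun i => by
    filter_upwards [hcut, hd₀ i] with z hz h
    exact h (doubleCutPlane_ne hz).1
  have hd₁' : ∀ i : Fin 4, ∀ᶠ z in 𝓝 z₀, HasDerivAt (jet₁ i) (jet₁ (i + 1) z / z) z := fun i => by
    filter_upwards [hcut, hd₁ i] with z hz h
    exact h hz.2
  obtain ⟨F, hF, hFa, hFe⟩ := exists_flat_continuation (f := fun i => jet₀ i) (f₄ := jet₀ 4) hz₀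
    (hd₀' 0) (hd₀' 1) (hd₀' 2) (hd₀' 3) o₀
  obtain ⟨H, hH, hHa, hHe⟩ := exists_flat_continuation (f := fun i => jet₁ i) (f₄ := jet₁ 4) hz₀
    (hd₁' 0) (hd₁' 1) (hd₁' 2) (hd₁' 3) (by
      filter_upwards [o₀, o₁] with z e₀ e₁
      simp only [jet₁, Fin.val_zero, Fin.val_one, Fin.val_two, show ((3 : Fin 4) : ℕ) = 3 from rfl]
      linear_combination Complex.log z * e₀ + e₁)
  have hat : ∀ A : ℝ, ∀ᶠ τ : ℍ in atImInfty, A < τ.im := fun A =>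
    tendsto_comap.eventually (eventually_gt_atTop A)
  refine ⟨F, H, hF, hH, fun i => ?_, ?_, ?_⟩
  · filter_upwards [hat (Y i)] with τ hτ
    exact hY i (F i) (hFa i) (hypTau z₀) (hYY i hz₀) (hFe i) τ hτ
  · filter_upwards [hat Y₁] with τ hτ
    -- The period `H` has no expansion at the cusp, but in this combination the terms with `log z`
    -- cancel. It agrees near the base point with an analytic function of `z`, so the identity
    -- theorem applies to it.
    refine hY₁ (fun x => F 0 x * H 1 x - F 1 x * H 0 x) (fun x hx =>
      ((hFa 0 x hx).fun_mul (hHa 1 x hx)).fun_sub ((hFa 1 x hx).fun_mul (hHa 0 x hx)))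
      (hypTau z₀) (h1 hz₀) ?_ τ hτ
    filter_upwards [hFe 0, hFe 1, hHe 0, hHe 1] with x e0 e1 e2 e3
    rw [e0, e1, e2, e3]
    simp only [jet₁, Fin.val_zero, Fin.val_one]
    ring
  · filter_upwards [hat Y₂] with τ hτ
    refine hY₂ (fun x => F 0 x * H 2 x - F 2 x * H 0 x) (fun x hx =>
      ((hFa 0 x hx).fun_mul (hHa 2 x hx)).fun_sub ((hFa 2 x hx).fun_mul (hHa 0 x hx)))
      (hypTau z₀) (h2 hz₀) ?_ τ hτ
    filter_upwards [hFe 0, hFe 2, hHe 0, hHe 2] with x e0 e1 e2 e3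
    rw [e0, e1, e2, e3]
    simp only [jet₁, Fin.val_zero, Fin.val_two]
    ring

end Periods

/-! ### The generators as quotients of flat functions. -/

section Generators

theorem coe_inv_eq {p : ℂ⟦X⟧} (h : PowerSeries.constantCoeff p ≠ 0) :
    ((p⁻¹ : ℂ⟦X⟧) : ℂ⸨X⸩) = (p : ℂ⸨X⸩)⁻¹ := by
  refine eq_inv_of_mul_eq_one_left ?_
  rw [← PowerSeries.coe_mul, PowerSeries.inv_mul_cancel _ h, PowerSeries.coe_one]

theorem ddz_one : ddz 1 = 0 := by
  rw [← PowerSeries.coe_one, ddz_coe, Derivation.map_one_eq_zero, PowerSeries.coe_zero]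

theorem zLS_mul_generator_zero :
    zLS ^ 1 * generator 0 = ((thetaPS F₀ * F₀⁻¹ : ℂ⟦X⟧) : ℂ⸨X⸩) := by
  show zLS ^ 1 * (ddz I₀ / I₀) = _
  rw [PowerSeries.coe_mul, coe_inv_eq (by rw [constantCoeff_F₀]; exact one_ne_zero), coe_thetaPS,
    ← I₀_eq]
  ring

theorem zLS_mul_generator_one :
    zLS ^ 2 * generator 1 = (((thetaPS (thetaPS F₀) - thetaPS F₀) * F₀⁻¹ : ℂ⟦X⟧) : ℂ⸨X⸩) := by
  show zLS ^ 2 * (ddz (ddz I₀) / I₀) = _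
  rw [PowerSeries.coe_mul, coe_inv_eq (by rw [constantCoeff_F₀]; exact one_ne_zero)]
  simp only [PowerSeries.coe_sub, coe_thetaPS, ← I₀_eq, ddz_mul, ddz_zLS]
  ring

/-- From `z³ ∂³ = θ (θ - 1)(θ - 2) = θ³ - 3 θ² + 2 θ`. -/
theorem zLS_mul_generator_two :
    zLS ^ 3 * generator 2 = (((thetaPS (thetaPS (thetaPS F₀)) - (3 : ℂ) • thetaPS (thetaPS F₀) +
      (2 : ℂ) • thetaPS F₀) * F₀⁻¹ : ℂ⟦X⟧) : ℂ⸨X⸩) := by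
  show zLS ^ 3 * (ddz (ddz (ddz I₀)) / I₀) = _
  rw [PowerSeries.coe_mul, coe_inv_eq (by rw [constantCoeff_F₀]; exact one_ne_zero)]
  simp only [PowerSeries.coe_sub, PowerSeries.coe_add, PowerSeries.coe_mul, coe_thetaPS, ← I₀_eq,
    ddz_mul, ddz_add, ddz_zLS, ddz_one, PowerSeries.smul_eq_C_mul, map_ofNat]
  ring

/-- The logarithmic `θ`-derivative of `W = z I₀² T'`, solved for that of `T'`. -/
theorem zLS_mul_generator_three :
    zLS ^ 1 * generator 3 = ((thetaPS wronskPS * wronskPS⁻¹ - 1 -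
      (2 : ℂ) • (thetaPS F₀ * F₀⁻¹) : ℂ⟦X⟧) : ℂ⸨X⸩) := by
  show zLS ^ 1 * (ddz T' / T') = _
  have h0 := I₀_ne_zero
  have ht := T'_ne_zero
  have hz := zLS_ne_zero
  simp only [PowerSeries.coe_sub, PowerSeries.coe_one, PowerSeries.coe_mul, coe_thetaPS, ← I₀_eq,
    coe_inv_eq (show PowerSeries.constantCoeff F₀ ≠ 0 by rw [constantCoeff_F₀]; exact one_ne_zero),
    coe_inv_eq (show PowerSeries.constantCoeff wronskPS ≠ 0 by
      rw [constantCoeff_wronskPS]; exact one_ne_zero), coe_wronskPS,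
    pow_two, ddz_mul, ddz_zLS, PowerSeries.smul_eq_C_mul, map_ofNat]
  field_simp
  ring

/-- A Laurent series whose sum is, near the cusp `i∞`, a quotient of components of flat
automorphic forms. -/
theorem exists_continuation_of_flat {N B : ℍ → ℂ} (hN : Flat N) (hB : Flat B) {p : ℂ⟦X⟧}
    {f : ℂ → ℂ} (hp : IsExpansion p f) {g : ℂ⸨X⸩} {k : ℕ} (hg : zLS ^ k * g = (p : ℂ⸨X⸩))
    (h0 : ∀ᶠ τ in atImInfty, B τ ≠ 0)
    (h : ∀ᶠ τ in atImInfty, N τ / B τ = f (hptm τ)⁻¹ * hptm τ ^ k) :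
    ∃ G : ℍ → ℂ, IsContinuation (fun τ => hptm τ) g G ∧
      ∃ (r : ℕ) (e : AutomorphyFactor Γ r) (φ : ℍ → Fin r → ℂ) (i : Fin r),
        e.IsTwistOfFlat ∧ IsAutomorphicForm e φ ∧ ∀ τ, φ τ i = G τ := by
  obtain ⟨τ₀, hτ₀⟩ := h0.exists
  obtain ⟨r, e, φ, i, he, hφ, hφi⟩ := hN.exists_automorphicForm hB hτ₀
  refine ⟨fun τ => N τ / B τ, ⟨?_, ?_⟩, r, e, φ, i, he, hφ, hφi⟩
  · have := hφ.1 i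
    rwa [funext hφi] at this
  · filter_upwards [h, eventually_hptm_ne_zero, tendsto_hptm_inv.eventually (hp.hasSum_laurent hg)]
      with τ h1 h2 h3
    have h4 := h3 (inv_ne_zero h2)
    rwa [inv_pow, div_inv_eq_mul, ← h1] at h4

theorem exists_continuation_generator (k : Fin 4) :
    ∃ G : ℍ → ℂ, IsContinuation (fun τ => hptm τ) (generator k) G ∧
      ∃ (r : ℕ) (e : AutomorphyFactor Γ r) (φ : ℍ → Fin r → ℂ) (i : Fin r),
        e.IsTwistOfFlat ∧ IsAutomorphicForm e φ ∧ ∀ τ, φ τ i = G τ := by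
  obtain ⟨F, H, hF, hH, hFe, hD₁, hD₂⟩ := exists_flat_periods
  have c0 : PowerSeries.constantCoeff F₀ ≠ 0 := by rw [constantCoeff_F₀]; exact one_ne_zero
  have cW : PowerSeries.constantCoeff wronskPS ≠ 0 := by
    rw [constantCoeff_wronskPS]; exact one_ne_zero
  have f0 := isExpansion_jet₀ 0
  have f1 := isExpansion_jet₀ 1
  have f2 := isExpansion_jet₀ 2
  have f3 := isExpansion_jet₀ 3
  have n0 : ∀ᶠ τ : ℍ in atImInfty, F 0 τ ≠ 0 := by
    have h := f0.analyticAt.continuousAt.eventually_ne (y := 0) (by rwa [f0.apply_zero])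
    filter_upwards [hFe 0, tendsto_hptm_inv.eventually h] with τ h1 h2
    rw [h1]
    exact h2
  have nW : ∀ᶠ τ : ℍ in atImInfty, F 0 τ * H 1 τ - F 1 τ * H 0 τ ≠ 0 := by
    have h := isExpansion_wronskPS.analyticAt.continuousAt.eventually_ne (y := 0)
      (by rwa [isExpansion_wronskPS.apply_zero])
    filter_upwards [hD₁, tendsto_hptm_inv.eventually h] with τ h1 h2
    rw [h1]
    exact h2
  have hD : Flat fun τ : ℍ => F 0 τ * H 1 τ - F 1 τ * H 0 τ :=
    ((hF 0).mul (hH 1)).sub ((hF 1).mul (hH 0))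
  have hD' : Flat fun τ : ℍ => F 0 τ * H 2 τ - F 2 τ * H 0 τ :=
    ((hF 0).mul (hH 2)).sub ((hF 2).mul (hH 0))
  fin_cases k
  · refine exists_continuation_of_flat (flat_hptm.mul (hF 1)) (hF 0) (f1.mul (f0.inv c0))
      zLS_mul_generator_zero n0 ?_
    filter_upwards [hFe 0, hFe 1] with τ e0 e1
    rw [e0, e1]
    simp only [Fin.val_zero, Fin.val_one]
    ring
  · refine exists_continuation_of_flat (flat_hptm.mul (flat_hptm.mul ((hF 2).sub (hF 1)))) (hF 0)
      ((f2.sub f1).mul (f0.inv c0)) zLS_mul_generator_one n0 ?_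
    filter_upwards [hFe 0, hFe 1, hFe 2] with τ e0 e1 e2
    rw [e0, e1, e2]
    simp only [Fin.val_zero, Fin.val_one, Fin.val_two]
    ring
  · refine exists_continuation_of_flat (flat_hptm.mul (flat_hptm.mul (flat_hptm.mul
      (((hF 3).sub ((flat_const 3).mul (hF 2))).add ((flat_const 2).mul (hF 1)))))) (hF 0)
      (((f3.sub (f2.smul 3)).add (f1.smul 2)).mul (f0.inv c0)) zLS_mul_generator_two n0 ?_
    filter_upwards [hFe 0, hFe 1, hFe 2, hFe 3] with τ e0 e1 e2 e3
    rw [e0, e1, e2, e3]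
    simp only [Fin.val_zero, Fin.val_one, Fin.val_two, show ((3 : Fin 4) : ℕ) = 3 from rfl]
    ring
  -- The common denominator is `W I₀`; the factor `b` in the numerator accounts for the pole `1 /
  -- z`.
  · refine exists_continuation_of_flat (flat_hptm.mul (((hD'.mul (hF 0)).sub (hD.mul (hF 0))).sub
      ((flat_const 2).mul ((hF 1).mul hD)))) (hD.mul (hF 0))
      (((isExpansion_thetaPS_wronskPS.mul (isExpansion_wronskPS.inv cW)).sub isExpansion_one).sub
        ((f1.mul (f0.inv c0)).smul 2)) zLS_mul_generator_three ?_ ?_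
    · filter_upwards [n0, nW] with τ h0 hW
      exact mul_ne_zero hW h0
    · filter_upwards [hFe 0, hFe 1, hD₁, hD₂, n0, nW] with τ e0 e1 d1 d2 h0 hW
      rw [← d1, ← d2]
      simp only [Fin.val_zero, Fin.val_one] at e0 e1
      rw [← e0, ← e1]
      generalize F 0 τ * H 1 τ - F 1 τ * H 0 τ = D at hW ⊢
      field_simp

end Generators

end YamaguchiYau

end

theorem mainTheorem4 :
    (∃ d : Derivation ℤ YamaguchiYau.FYY YamaguchiYau.FYY,
      ∀ f : YamaguchiYau.FYY, (d f : LaurentSeries ℂ) = YamaguchiYau.ddz (f : LaurentSeries ℂ)) ∧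
    ∃ b : UpperHalfPlane → ℂ, YamaguchiYau.IsHauptmodul b ∧
      ∀ k : Fin 4, ∃ G : UpperHalfPlane → ℂ,
        YamaguchiYau.IsContinuation b (YamaguchiYau.generator k) G ∧
        ∃ (r : ℕ) (e : YamaguchiYau.AutomorphyFactor YamaguchiYau.Γ r)
          (φ : UpperHalfPlane → Fin r → ℂ) (i : Fin r),
          e.IsTwistOfFlat ∧ YamaguchiYau.IsAutomorphicForm e φ ∧ ∀ τ, φ τ i = G τ := by
  exact ⟨YamaguchiYau.exists_derivation_FYY, fun τ => YamaguchiYau.hptm τ,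
    YamaguchiYau.isHauptmodul_hptm, YamaguchiYau.exists_continuation_generator⟩
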